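/- **Notation.** A code of length $n$ over a commutative ring $R$ is a submodule $C\subseteq R^n$; $C^\perp$ is its dual for $\langle x,y\rangle=\sum x_iy_i$, and $C$ is self-dual if $C=C^\perp$. Let $S=\mathbb F_2+u\mathbb F_2$ ($u^2=0$) and $T=\mathbb F_4+u\mathbb F_4=S[\omega]/(\omega^2+\omega+1)$, $\bar\omega=1+\omega$. The Gray maps are $\varphi:S^n\to\mathbb F_2^{2n}$, $\varphi(a+bu)=(b,a+b)$ for $a,b\in\mathbb F_2^n$, and $\psi:T^n\to S^{2n}$, $\psi(a\omega+b\bar\omega)=(a,b)$ for $a,b\in S^n$. Write $3$ for $1+u\in S$; elements of $T$ are written as hexadecimal digits with respect to the basis $(u\omega,\omega,u,1)$. A circulant (reverse circulant) matrix is one in which each row is the right (left) cyclic shift of the previous one. *Generalized four circulant code* of $A,B,C$: the code generated by the rows of $\left(I\ \Big|\ \begin{smallmatrix}A&B+C\\B^T+C&A^T\end{smallmatrix}\right)$. *Extension* of a self-dual code $C\subseteq R^n$ by a unit $c$ with $c^2=1$ and $X\in R^n$ with $\langle X,X\rangle=1$: the code of length $n+2$ generated by $(1,0,X)$ and the rows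 $(y_i,cy_i,r_i)$, $y_i=\langle r_i,X\rangle$, where the $r_i$ generate $C$. *Neighbor* of a binary self-dual code $C$ given by $x$: the code $\langle\langle x\rangle^\perp\cap C,\,x\rangle$; two self-dual codes of dimension $k$ are neighbors if their intersection has dimension $k-1$. A binary self-dual code of length $n$ is extremal if its minimum distance is $4\lfloor n/24\rfloor+4$ (resp. $4\lfloor n/24\rfloor+6$ if $n\equiv22\bmod 24$). Put $$W_{68,2}(\beta,\gamma)=\sum_{j=0}^{7}a_j(1+y^2)^{34-4j}\bigl(y^2(1-y^2)^2\bigr)^j=1+(442+4\beta)y^{12}+(14960-8\beta-256\gamma)y^{14}+\cdots,$$ with $(a_0,\dots,a_7)=(1,-34,391,-1802,3179,-1870,4\beta,-256\gamma)$. **The codes.** (a) Let $\mathcal F_2$ be the generalized four circulant code of length $32$ over $S$ with $A,B$ circulant with first rows $(u,u,0,u,1,u,1,u)$, $(u,u,u,0,0,1,1,3)$ and $C$ reverse circulant with first row $(0,0,3,0,0,0,3,0)$. Then $\mathcal D_1$, $\mathcal D_2$ are the images under $\varphi$ of the extensions of $\mathcal F_2$ by $c=1$, $X=(31u011u30uu113u3333u11u010301101)$,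 and by $c=1+u$, $X=(130031u300013101313u31uu301u3103)$, with $\gamma=5$ and $\beta=101$, resp. $\beta=105$. (b) $\mathcal N_i$, $1\le i\le 6$, is the neighbor of $\mathcal D_{d}$ given by $x$, where $x$ has the listed $34$ entries, in order, at the redundancy coordinates (the last $34$ coordinates when the generator matrix is brought to standard form) and is $0$ elsewhere. The redundancy coordinates are $35,\dots,68$ for $\mathcal D_1$ and $33,36,37,\dots,68$ for $\mathcal D_2$. $$\begin{array}{c|c|c|c|c} i&d&x&\gamma&\beta\\\hline 1 & 2 & 1010111001011100010100000010000000 & 5 & 109 \\ 2 & 2 & 0000110011011010111101110100011100 & 5 & 111 \\ 3 & 2 & 0000111110011111111011010001100000 & 5 & 112 \\ 4 & 2 & 1101110000001001011100101100010101 & 5 & 114 \\ 5 & 1 & 1110110100000001001100000111001010 & 5 & 115 \\ 6 & 2 & 1001010001010101110010111110111000 & 6 & 133 \\ \end{array}$$ (c) Let $\mathcal E_6$ be the generalized four circulant code of length $16$ over $T$ with $A,B$ circulant with first rows $(F,9,7,9)$, $(2,4,3,F)$ and $C=C'R$, where $C'$ is circulant with first row $(F,5,B,8)$ and $R$ is the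 back-diagonal matrix (so $C$ is reverse circulant with first row $(8,B,5,F)$). Let $\mathcal C$ be the image under $\varphi$ of the extension of $\psi(\mathcal E_6)$ by $c=1$ and $X=(3,0,1,1,u,0,u,3,0,1,1,u,1,0,0,u,3,0,0,u,u,u,1,3,3,0,1,3,1,u,0,3)$, with $\gamma=6$, $\beta=157$. (d) $\mathcal C_i$, $1\le i\le 34$, is the neighbor of $\mathcal C$ given by the vector $x$ whose first $34$ entries are $0$ and whose last $34$ entries are listed, with $\gamma=6$ and the listed $\beta$. $$\begin{array}{c|c|c} i&x&\beta\\\hline 1 & 1111111100111100001100001000000111 & 137 \\ 2 & 0101001001001111111011100010111011 & 139 \\ 3 & 1000001100000110110110000111100010 & 140 \\ 4 & 0010011101110110011001110110110110 & 141 \\ 5 & 1111111111000011111101100010011001 & 142 \\ 6 & 1001000001111111111010010000011110 & 143 \\ 7 & 1100100010000111001100111111110001 & 144 \\ 8 & 0000110001110110011011011010000110 & 145 \\ 9 & 1000010100001010110101110111110101 & 146 \\ 10 & 1100110100000010010000110010011110 & 147 \\ 11 & 1110101000011110100101111111101011 & 148 \\ 12 & 0110011001001101000111010101011000 & 149 \\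 13 & 1111111100101101000000001011111000 & 150 \\ 14 & 0000100001100010111010011111111000 & 151 \\ 15 & 1110000010100000001110110110000101 & 152 \\ 16 & 1010100100110011111101001101001001 & 153 \\ 17 & 1111010010000100100000101000011101 & 155 \\ 18 & 1000001011110111100101100000001000 & 159 \\ 19 & 0001010001010101010010010001100010 & 160 \\ 20 & 1100000100011110101111110001010101 & 161 \\ 21 & 0101110011110010110000111111010011 & 163 \\ 22 & 1000000111111000000010111100010001 & 164 \\ 23 & 0100000001010000001001110110010110 & 165 \\ 24 & 0111001010010100000010010010101000 & 166 \\ 25 & 1111010011000111000101101001011100 & 167 \\ 26 & 0010110010110100000010001111000000 & 168 \\ 27 & 0000010011010110001010010000101001 & 169 \\ 28 & 1110101000110000011111010101010101 & 170 \\ 29 & 1110100001100111100100000010010010 & 171 \\ 30 & 1000001101101110010001101010111101 & 172 \\ 31 & 1100100001110011101001010001100000 & 173 \\ 32 & 0100011001000011000100010100101100 & 174 \\ 33 & 0110000001110110000111101000101011 & 177 \\ 34 & 1011111000100000001011010000101010 & 184 \\ \end{array}$$ **Theorem.** $\mathcal F_2$, $\mathcal E_6$ and $\psi(\mathcal E_6)$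 are self-dual, the data $c,X$ above satisfy $c^2=1$ and $\langle X,X\rangle=1$, each $\mathcal N_i$ is a neighbor of its $\mathcal D_d$, and each $\mathcal C_i$ is a neighbor of $\mathcal C$. Each of the $43$ codes $\mathcal D_1,\mathcal D_2,\mathcal N_1,\dots,\mathcal N_6,\mathcal C,\mathcal C_1,\dots,\mathcal C_{34}$ is an extremal binary self-dual $[68,34,12]$ code, and its weight enumerator is $W_{68,2}(\beta,\gamma)$ for the listed $(\beta,\gamma)$. The $43$ weight enumerators, and the $43$ pairs $(\gamma,\beta)$, are pairwise different; the pairs that occur are exactly the $7$ pairs $\gamma=5$, $\beta\in\{101,105,109,111,112,114,115\}$, and the $36$ pairs $\gamma=6$, $\beta\in\{133,137,139,140,141,142,143,144,145,146,147,148,149,150,151,152,153,155,157,159,160,161,163,164,165,166,167,168,169,170,171,172,173,174,177,184\}$. -/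

import Mathlib

/-!
Binary codes, codes over `F₂ + uF₂` and over `F₄ + uF₄`, Gray maps, the generalized four circulant
construction, the extension construction, the neighbor construction, and the tables of
generators of the codes of length `68`.
-/

namespace SelfDualCodes

open Polynomial

/-! ### Codes -/

/-- A (linear) code of length `n` over `R`: a submodule of `Rⁿ`. -/
abbrev Code (R : Type) [CommRing R] (n : ℕ) : Type := Submodule R (Fin n → R)

section Basic

variable {R : Type} [CommRing R] {n k : ℕ}

/-- The dual code with respect to the Euclidean inner product `⟨x, y⟩ = ∑ xᵢ yᵢ`. -/
def dualCode (C : Code R n) : Code R n where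
  carrier := {x | ∀ y ∈ C, x ⬝ᵥ y = 0}
  add_mem' := fun {a b} ha hb y hy => by
    rw [add_dotProduct, ha y hy, hb y hy, add_zero]
  zero_mem' := fun y _ => zero_dotProduct y
  smul_mem' := fun c x hx y hy => by
    rw [smul_dotProduct, hx y hy, smul_zero]

/-- `C = C^⊥`. -/
def IsSelfDual (C : Code R n) : Prop := dualCode C = C

/-- The code generated by the rows of a matrix. -/
def rowCode {ι : Type} (G : Matrix ι (Fin n) R) : Code R n :=
  Submodule.span R (Set.range fun i => G i)

/-- The matrix of the extension construction: first row `(1, 0, X)`, and below it the rows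
`(yᵢ, c yᵢ, rᵢ)` with `yᵢ = ⟨rᵢ, X⟩`, where `rᵢ` are the rows of `G`. -/
def extensionMatrix {ι : Type} (G : Matrix ι (Fin n) R) (c : R) (X : Fin n → R) :
    Matrix (Option ι) (Fin (n + 2)) R
  | none => Matrix.vecCons 1 (Matrix.vecCons 0 X)
  | some i => Matrix.vecCons (G i ⬝ᵥ X) (Matrix.vecCons (c * (G i ⬝ᵥ X)) (G i))

/-- The extension of the code `C` by `X` and `c`: the extension construction, with all the codewords
of `C` as the rows of the generator matrix (by `extendCode_rowCode`, any other generator matrix gives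
the same code). -/
def extendCode (C : Code R n) (c : R) (X : Fin n → R) : Code R (n + 2) :=
  rowCode (extensionMatrix (fun (r : C) => (r : Fin n → R)) c X)

theorem extendCode_rowCode {ι : Type} (G : Matrix ι (Fin n) R) (c : R) (X : Fin n → R) :
    extendCode (rowCode G) c X = rowCode (extensionMatrix G c X) := by
  apply le_antisymm
  · refine Submodule.span_le.2 ?_
    rintro _ ⟨i, rfl⟩
    rcases i with _ | ⟨r, hr⟩
    · exact Submodule.subset_span ⟨none, rfl⟩
    · change Matrix.vecCons (r ⬝ᵥ X) (Matrix.vecCons (c * (r ⬝ᵥ X)) r) ∈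
        rowCode (extensionMatrix G c X)
      refine Submodule.span_induction (p := fun r _ =>
        Matrix.vecCons (r ⬝ᵥ X) (Matrix.vecCons (c * (r ⬝ᵥ X)) r) ∈
          rowCode (extensionMatrix G c X)) ?_ ?_ ?_ ?_ hr
      · rintro _ ⟨i, rfl⟩
        exact Submodule.subset_span ⟨some i, rfl⟩
      · simp
      · intro x y _ _ hx hy
        have := Submodule.add_mem _ hx hy
        simpa [add_dotProduct, mul_add] using this
      · intro a x _ hx
        have := Submodule.smul_mem _ a hx
        simpa [smul_dotProduct, mul_left_comm] using this
  · refine Submodule.span_le.2 ?_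
    rintro _ ⟨i, rfl⟩
    rcases i with _ | i
    · exact Submodule.subset_span ⟨none, rfl⟩
    · exact Submodule.subset_span ⟨some ⟨G i, Submodule.subset_span ⟨i, rfl⟩⟩, rfl⟩

/-- The circulant matrix with first row `r`: every row is the right cyclic shift of the row
above it. -/
def circ (r : Fin n → R) : Matrix (Fin n) (Fin n) R := fun i j => r (j - i)

/-- The reverse circulant matrix with first row `r`: every row is the left cyclic shift of the row
above it. -/
def revCirc (r : Fin n → R) : Matrix (Fin n) (Fin n) R := fun i j => r (j + i)

/-- The back-diagonal matrix. -/
def backDiag : Matrix (Fin n) (Fin n) R := fun i j => if j = i.rev then 1 else 0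

/-- The generalized four circulant matrix `( I | A, B + C ; Bᵀ + C, Aᵀ )`. -/
def genFourCirc (A B C : Matrix (Fin n) (Fin n) R) :
    Matrix (Fin n ⊕ Fin n) (Fin ((n + n) + (n + n))) R :=
  (Matrix.fromCols 1 (Matrix.fromBlocks A (B + C) (B.transpose + C) A.transpose)).submatrix id
    (((finSumFinEquiv (m := n) (n := n)).sumCongr (finSumFinEquiv (m := n) (n := n))).trans
      finSumFinEquiv).symm

/-- Two self-dual codes are neighbors if their intersection has codimension one in both. -/
def AreNeighbors {F : Type} [Field F] (C D : Code F n) : Prop :=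
  IsSelfDual C ∧ IsSelfDual D ∧
    Module.finrank F (C ⊓ D : Code F n) + 1 = Module.finrank F C ∧
    Module.finrank F (C ⊓ D : Code F n) + 1 = Module.finrank F D

/-- The neighbor construction `⟨⟨x⟩^⊥ ∩ C, x⟩`. -/
def neighborCode (C : Code R n) (x : Fin n → R) : Code R n :=
  (dualCode (Submodule.span R {x}) ⊓ C) ⊔ Submodule.span R {x}

end Basic

/-! ### Binary codes -/

/-- The binary field. -/
abbrev F2 : Type := ZMod 2

/-- `C` has minimum distance `d`: this is the least Hamming weight of a nonzero codeword. -/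
def HasMinDist {n : ℕ} (C : Code F2 n) (d : ℕ) : Prop :=
  IsLeast {w : ℕ | ∃ x ∈ C, x ≠ 0 ∧ hammingNorm x = w} d

/-- The upper bound on the minimum distance of a binary self-dual code of length `n`. -/
def selfDualBound (n : ℕ) : ℕ := if n % 24 = 22 then 4 * (n / 24) + 6 else 4 * (n / 24) + 4

/-- Extremal binary self-dual codes: those meeting the bound. -/
def IsExtremal {n : ℕ} (C : Code F2 n) : Prop := IsSelfDual C ∧ HasMinDist C (selfDualBound n)

open Classical in
/-- The weight enumerator `∑ y ^ wt(x)`, the sum being over the codewords `x`. -/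
noncomputable def weightEnumerator {n : ℕ} (C : Code F2 n) : ℤ[X] :=
  ∑ x : Fin n → F2, if x ∈ C then X ^ hammingNorm x else 0

/-- The weight enumerator `W_{68,2} = 1 + (442+4β) y¹² + (14960-8β-256γ) y¹⁴ + ⋯`, with all its
terms (see `W682_eq_gleason`). -/
noncomputable def W682 (β γ : ℤ) : ℤ[X] :=
  1
    + C (442 + 4 * β) * (X ^ 12 + X ^ 56)
    + C (14960 - 8 * β - 256 * γ) * (X ^ 14 + X ^ 54)
    + C (174471 - 36 * β + 2048 * γ) * (X ^ 16 + X ^ 52)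
    + C (1478048 + 80 * β - 5632 * γ) * (X ^ 18 + X ^ 50)
    + C (9546537 + 140 * β + 2048 * γ) * (X ^ 20 + X ^ 48)
    + C (46699952 - 360 * β + 21248 * γ) * (X ^ 22 + X ^ 46)
    + C (175078410 - 300 * β - 40960 * γ) * (X ^ 24 + X ^ 44)
    + C (509477760 + 960 * β - 2048 * γ) * (X ^ 26 + X ^ 42)
    + C (1160564636 + 360 * β + 90112 * γ) * (X ^ 28 + X ^ 40)
    + C (2081169376 - 1680 * β - 86528 * γ) * (X ^ 30 + X ^ 38)
    + C (2949602799 - 168 * β - 53248 * γ) * (X ^ 32 + X ^ 36)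
    + C (3312254400 + 2016 * β + 146432 * γ) * X ^ 34 + X ^ 68

/-- `W_{68,2}` in Gleason's form `∑ aⱼ (1+y²)^(34-4j) (y²(1-y²)²)^j`. -/
theorem W682_eq_gleason (β γ : ℤ) :
    W682 β γ = (1 + X ^ 2) ^ 34
      - 34 * (1 + X ^ 2) ^ 30 * (X ^ 2 * (1 - X ^ 2) ^ 2)
      + 391 * (1 + X ^ 2) ^ 26 * (X ^ 2 * (1 - X ^ 2) ^ 2) ^ 2
      - 1802 * (1 + X ^ 2) ^ 22 * (X ^ 2 * (1 - X ^ 2) ^ 2) ^ 3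
      + 3179 * (1 + X ^ 2) ^ 18 * (X ^ 2 * (1 - X ^ 2) ^ 2) ^ 4
      - 1870 * (1 + X ^ 2) ^ 14 * (X ^ 2 * (1 - X ^ 2) ^ 2) ^ 5
      + C (4 * β) * (1 + X ^ 2) ^ 10 * (X ^ 2 * (1 - X ^ 2) ^ 2) ^ 6
      - C (256 * γ) * (1 + X ^ 2) ^ 6 * (X ^ 2 * (1 - X ^ 2) ^ 2) ^ 7 := by
  simp only [W682, map_add, map_sub, map_mul, map_ofNat]
  ring

/-! ### The rings `F₂ + uF₂`, `F₄ + uF₄` and the Gray maps -/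

/-- `F₂ + uF₂`, `u² = 0`: the dual numbers over `F₂`. -/
abbrev F2u : Type := DualNumber F2

/-- `F₄ + uF₄ = (F₂ + uF₂)[ω] / (ω² + ω + 1)`. An element is `re + im * ω`, with `re` and `im` in
`F₂ + uF₂`, and `ω² = 1 + 1 * ω`. -/
abbrev F4u : Type := QuadraticAlgebra F2u 1 1

/-- The Gray map `φ : a + bu ↦ (b, a + b)`, `a, b ∈ F₂ⁿ`. -/
def grayPhi (n : ℕ) : (Fin n → F2u) →ₗ[F2] (Fin (n + n) → F2) where
  toFun x := Fin.append (fun i => (x i).snd) (fun i => (x i).fst + (x i).snd)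
  map_add' x y := by
    ext i
    refine Fin.addCases (fun i => ?_) (fun i => ?_) i
    · simp
    · simp only [Fin.append_right, Pi.add_apply, TrivSqZeroExt.fst_add, TrivSqZeroExt.snd_add]
      ring
  map_smul' c x := by
    ext i
    refine Fin.addCases (fun i => ?_) (fun i => ?_) i
    · simp
    · simp [mul_add, -Fin.natAdd_eq_addNat]

instance : IsScalarTower F2u F4u F4u :=
  ⟨fun x y z => by ext1 <;> simp <;> ring⟩

/-- The binary image `φ(C)` of a code over `F₂ + uF₂`. -/
def binaryImage {n : ℕ} (C : Code F2u n) : Code F2 (n + n) :=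
  (C.restrictScalars F2).map (grayPhi n)

/-- The Gray map `ψ : aω + bω̄ ↦ (a, b)`, `a, b ∈ (F₂ + uF₂)ⁿ`, where `ω̄ = 1 + ω`: if
`z = re + im * ω` then `b = re` and `a = re + im` (the characteristic being two). -/
def grayPsi (n : ℕ) : (Fin n → F4u) →ₗ[F2u] (Fin (n + n) → F2u) where
  toFun z := Fin.append (fun i => (z i).re + (z i).im) (fun i => (z i).re)
  map_add' x y := by
    ext1 i
    refine Fin.addCases (fun i => ?_) (fun i => ?_) i
    · simp only [Fin.append_left, Pi.add_apply, QuadraticAlgebra.re_add, QuadraticAlgebra.im_add]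
      ring
    · simp [-Fin.natAdd_eq_addNat]
  map_smul' c x := by
    ext1 i
    refine Fin.addCases (fun i => ?_) (fun i => ?_) i
    · simp [mul_add]
    · simp [-Fin.natAdd_eq_addNat]

/-- The image `ψ(C)` over `F₂ + uF₂` of a code over `F₄ + uF₄`. -/
def psiImage {n : ℕ} (C : Code F4u n) : Code F2u (n + n) :=
  (C.restrictScalars F2u).map (grayPsi n)

/-- The shorthand `0, 1, 2, 3` for the elements `0, 1, u, 1 + u` of `F₂ + uF₂`. -/
def dig (m : ℕ) : F2u :=
  TrivSqZeroExt.inl ((m % 2 : ℕ) : F2) + TrivSqZeroExt.inr ((m / 2 : ℕ) : F2)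

/-- The hexadecimal shorthand for the elements of `F₄ + uF₄`, with respect to the ordered basis
`uω, ω, u, 1` (of weights `8, 4, 2, 1`). -/
def hex (m : ℕ) : F4u := ⟨dig (m % 4), dig (m / 4)⟩

/-- The unit `1 + u`. -/
def oneU : F2u := dig 3

/-! ### The codes of length `64` that are extended -/

/-- The generalized four circulant code `ℱ₂` of length `32` over `F₂ + uF₂`. -/
def codeF2 : Code F2u 32 :=
  rowCode (genFourCirc
    (circ fun i => dig (![2, 2, 0, 2, 1, 2, 1, 2] i : ℕ) : Matrix (Fin 8) (Fin 8) F2u)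
    (circ fun i => dig (![2, 2, 2, 0, 0, 1, 1, 3] i : ℕ))
    (revCirc fun i => dig (![0, 0, 3, 0, 0, 0, 3, 0] i : ℕ)))

/-- The code `ℰ₆` of length `16` over `F₄ + uF₄`, with `r_A = (F,9,7,9)`, `r_B = (2,4,3,F)` and
`r_C = (F,5,B,8)`. The reverse circulant matrix `C` is given as `C' R`, where `C'` is the circulant
matrix with first row `r_C` and `R` is the back-diagonal matrix; `A` is symmetric. -/
def codeE6 : Code F4u 16 :=
  rowCode (genFourCirc
    (circ fun i => hex (![15, 9, 7, 9] i : ℕ) : Matrix (Fin 4) (Fin 4) F4u)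
    (circ fun i => hex (![2, 4, 3, 15] i : ℕ))
    ((circ fun i => hex (![15, 5, 11, 8] i : ℕ)) * backDiag))

/-! ### The codes of length `68` -/

/-- The units `c` used to extend `ℱ₂`. -/
def unitD : Fin 2 → F2u := ![1, oneU]

/-- The vectors `X` used to extend `ℱ₂`. -/
def vecD (i : Fin 2) : Fin 32 → F2u := fun j => dig (([
    [3, 1, 2, 0, 1, 1, 2, 3, 0, 2, 2, 1, 1, 3, 2, 3, 3, 3, 3, 2, 1, 1, 2, 0, 1, 0, 3, 0, 1, 1, 0, 1],
    [1, 3, 0, 0, 3, 1, 2, 3, 0, 0, 0, 1, 3, 1, 0, 1, 3, 1, 3, 2, 3, 1, 2, 2, 3, 0, 1, 2, 3, 1, 0, 3]].getD i []).getD j 0)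

/-- The binary codes `𝒟_{68,1}` and `𝒟_{68,2}`. -/
def codeD (i : Fin 2) : Code F2 68 := binaryImage (extendCode codeF2 (unitD i) (vecD i))

/-- The vector `X` used to extend `ψ(ℰ₆)` (with `c = 1`). -/
def vecC68 : Fin 32 → F2u := fun j => dig (
    [3, 0, 1, 1, 2, 0, 2, 3, 0, 1, 1, 2, 1, 0, 0, 2, 3, 0, 0, 2, 2, 2, 1, 3, 3, 0, 1, 3, 1, 2, 0, 3].getD j 0)

/-- The binary code `φ(𝒞₆₈)`. -/
def codeC68 : Code F2 68 := binaryImage (extendCode (psiImage codeE6) 1 vecC68)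

/-- The vector of `F₂⁶⁸` with entry `t k` at the coordinate `pos k` and all other entries `0`. -/
def placeAt (pos : Fin 34 → Fin 68) (t : Fin 34 → ℕ) : Fin 68 → F2 :=
  ∑ k, Pi.single (pos k) (t k : F2)

/-- The redundancy coordinates `35, …, 68` of a code with generator matrix in the standard form
`(I | M)`. -/
def lastHalf (k : Fin 34) : Fin 68 := Fin.natAdd 34 k

/-- The redundancy coordinates of `𝒟_{68,i}`. For `i = 1` the first `34` coordinates are an
information set. For `i = 2` the first information set is `{1, …, 32, 34, 35}` (counting from `1`), and
the redundancy coordinates are `33, 36, 37, …, 68`; moving them to the end, in this order, gives the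
code with generator matrix in standard form. -/
def redundancyD (i : Fin 2) (k : Fin 34) : Fin 68 :=
  if i = 1 ∧ k = 0 then 32 else lastHalf k

/-- The indices of the codes `𝒟` of which `𝒩_{68,1}, …, 𝒩_{68,6}` are neighbors. -/
def parentN : Fin 6 → Fin 2 := ![1, 1, 1, 1, 0, 1]

/-- The last `34` entries, in standard form, of the vectors `x` defining `𝒩_{68,i}`. -/
def vecN (i : Fin 6) (k : Fin 34) : ℕ := ([
    [1, 0, 1, 0, 1, 1, 1, 0, 0, 1, 0, 1, 1, 1, 0, 0, 0, 1, 0, 1, 0, 0, 0, 0, 0, 0, 1, 0, 0, 0, 0, 0, 0, 0],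
    [0, 0, 0, 0, 1, 1, 0, 0, 1, 1, 0, 1, 1, 0, 1, 0, 1, 1, 1, 1, 0, 1, 1, 1, 0, 1, 0, 0, 0, 1, 1, 1, 0, 0],
    [0, 0, 0, 0, 1, 1, 1, 1, 1, 0, 0, 1, 1, 1, 1, 1, 1, 1, 1, 0, 1, 1, 0, 1, 0, 0, 0, 1, 1, 0, 0, 0, 0, 0],
    [1, 1, 0, 1, 1, 1, 0, 0, 0, 0, 0, 0, 1, 0, 0, 1, 0, 1, 1, 1, 0, 0, 1, 0, 1, 1, 0, 0, 0, 1, 0, 1, 0, 1],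
    [1, 1, 1, 0, 1, 1, 0, 1, 0, 0, 0, 0, 0, 0, 0, 1, 0, 0, 1, 1, 0, 0, 0, 0, 0, 1, 1, 1, 0, 0, 1, 0, 1, 0],
    [1, 0, 0, 1, 0, 1, 0, 0, 0, 1, 0, 1, 0, 1, 0, 1, 1, 1, 0, 0, 1, 0, 1, 1, 1, 1, 1, 0, 1, 1, 1, 0, 0, 0]].getD i []).getD k 0

/-- The codes `𝒩_{68,1}, …, 𝒩_{68,6}`. -/
def codeN (i : Fin 6) : Code F2 68 :=
  neighborCode (codeD (parentN i)) (placeAt (redundancyD (parentN i)) (vecN i))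

/-- The last `34` entries of the vectors defining the neighbors `𝒞_{68,i}` of `φ(𝒞₆₈)`. -/
def vecC (i : Fin 34) (k : Fin 34) : ℕ := ([
    [1, 1, 1, 1, 1, 1, 1, 1, 0, 0, 1, 1, 1, 1, 0, 0, 0, 0, 1, 1, 0, 0, 0, 0, 1, 0, 0, 0, 0, 0, 0, 1, 1, 1],
    [0, 1, 0, 1, 0, 0, 1, 0, 0, 1, 0, 0, 1, 1, 1, 1, 1, 1, 1, 0, 1, 1, 1, 0, 0, 0, 1, 0, 1, 1, 1, 0, 1, 1],
    [1, 0, 0, 0, 0, 0, 1, 1, 0, 0, 0, 0, 0, 1, 1, 0, 1, 1, 0, 1, 1, 0, 0, 0, 0, 1, 1, 1, 1, 0, 0, 0, 1, 0],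
    [0, 0, 1, 0, 0, 1, 1, 1, 0, 1, 1, 1, 0, 1, 1, 0, 0, 1, 1, 0, 0, 1, 1, 1, 0, 1, 1, 0, 1, 1, 0, 1, 1, 0],
    [1, 1, 1, 1, 1, 1, 1, 1, 1, 1, 0, 0, 0, 0, 1, 1, 1, 1, 1, 1, 0, 1, 1, 0, 0, 0, 1, 0, 0, 1, 1, 0, 0, 1],
    [1, 0, 0, 1, 0, 0, 0, 0, 0, 1, 1, 1, 1, 1, 1, 1, 1, 1, 1, 0, 1, 0, 0, 1, 0, 0, 0, 0, 0, 1, 1, 1, 1, 0],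
    [1, 1, 0, 0, 1, 0, 0, 0, 1, 0, 0, 0, 0, 1, 1, 1, 0, 0, 1, 1, 0, 0, 1, 1, 1, 1, 1, 1, 1, 1, 0, 0, 0, 1],
    [0, 0, 0, 0, 1, 1, 0, 0, 0, 1, 1, 1, 0, 1, 1, 0, 0, 1, 1, 0, 1, 1, 0, 1, 1, 0, 1, 0, 0, 0, 0, 1, 1, 0],
    [1, 0, 0, 0, 0, 1, 0, 1, 0, 0, 0, 0, 1, 0, 1, 0, 1, 1, 0, 1, 0, 1, 1, 1, 0, 1, 1, 1, 1, 1, 0, 1, 0, 1],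
    [1, 1, 0, 0, 1, 1, 0, 1, 0, 0, 0, 0, 0, 0, 1, 0, 0, 1, 0, 0, 0, 0, 1, 1, 0, 0, 1, 0, 0, 1, 1, 1, 1, 0],
    [1, 1, 1, 0, 1, 0, 1, 0, 0, 0, 0, 1, 1, 1, 1, 0, 1, 0, 0, 1, 0, 1, 1, 1, 1, 1, 1, 1, 1, 0, 1, 0, 1, 1],
    [0, 1, 1, 0, 0, 1, 1, 0, 0, 1, 0, 0, 1, 1, 0, 1, 0, 0, 0, 1, 1, 1, 0, 1, 0, 1, 0, 1, 0, 1, 1, 0, 0, 0],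
    [1, 1, 1, 1, 1, 1, 1, 1, 0, 0, 1, 0, 1, 1, 0, 1, 0, 0, 0, 0, 0, 0, 0, 0, 1, 0, 1, 1, 1, 1, 1, 0, 0, 0],
    [0, 0, 0, 0, 1, 0, 0, 0, 0, 1, 1, 0, 0, 0, 1, 0, 1, 1, 1, 0, 1, 0, 0, 1, 1, 1, 1, 1, 1, 1, 1, 0, 0, 0],
    [1, 1, 1, 0, 0, 0, 0, 0, 1, 0, 1, 0, 0, 0, 0, 0, 0, 0, 1, 1, 1, 0, 1, 1, 0, 1, 1, 0, 0, 0, 0, 1, 0, 1],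
    [1, 0, 1, 0, 1, 0, 0, 1, 0, 0, 1, 1, 0, 0, 1, 1, 1, 1, 1, 1, 0, 1, 0, 0, 1, 1, 0, 1, 0, 0, 1, 0, 0, 1],
    [1, 1, 1, 1, 0, 1, 0, 0, 1, 0, 0, 0, 0, 1, 0, 0, 1, 0, 0, 0, 0, 0, 1, 0, 1, 0, 0, 0, 0, 1, 1, 1, 0, 1],
    [1, 0, 0, 0, 0, 0, 1, 0, 1, 1, 1, 1, 0, 1, 1, 1, 1, 0, 0, 1, 0, 1, 1, 0, 0, 0, 0, 0, 0, 0, 1, 0, 0, 0],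
    [0, 0, 0, 1, 0, 1, 0, 0, 0, 1, 0, 1, 0, 1, 0, 1, 0, 1, 0, 0, 1, 0, 0, 1, 0, 0, 0, 1, 1, 0, 0, 0, 1, 0],
    [1, 1, 0, 0, 0, 0, 0, 1, 0, 0, 0, 1, 1, 1, 1, 0, 1, 0, 1, 1, 1, 1, 1, 1, 0, 0, 0, 1, 0, 1, 0, 1, 0, 1],
    [0, 1, 0, 1, 1, 1, 0, 0, 1, 1, 1, 1, 0, 0, 1, 0, 1, 1, 0, 0, 0, 0, 1, 1, 1, 1, 1, 1, 0, 1, 0, 0, 1, 1],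
    [1, 0, 0, 0, 0, 0, 0, 1, 1, 1, 1, 1, 1, 0, 0, 0, 0, 0, 0, 0, 1, 0, 1, 1, 1, 1, 0, 0, 0, 1, 0, 0, 0, 1],
    [0, 1, 0, 0, 0, 0, 0, 0, 0, 1, 0, 1, 0, 0, 0, 0, 0, 0, 1, 0, 0, 1, 1, 1, 0, 1, 1, 0, 0, 1, 0, 1, 1, 0],
    [0, 1, 1, 1, 0, 0, 1, 0, 1, 0, 0, 1, 0, 1, 0, 0, 0, 0, 0, 0, 1, 0, 0, 1, 0, 0, 1, 0, 1, 0, 1, 0, 0, 0],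
    [1, 1, 1, 1, 0, 1, 0, 0, 1, 1, 0, 0, 0, 1, 1, 1, 0, 0, 0, 1, 0, 1, 1, 0, 1, 0, 0, 1, 0, 1, 1, 1, 0, 0],
    [0, 0, 1, 0, 1, 1, 0, 0, 1, 0, 1, 1, 0, 1, 0, 0, 0, 0, 0, 0, 1, 0, 0, 0, 1, 1, 1, 1, 0, 0, 0, 0, 0, 0],
    [0, 0, 0, 0, 0, 1, 0, 0, 1, 1, 0, 1, 0, 1, 1, 0, 0, 0, 1, 0, 1, 0, 0, 1, 0, 0, 0, 0, 1, 0, 1, 0, 0, 1],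
    [1, 1, 1, 0, 1, 0, 1, 0, 0, 0, 1, 1, 0, 0, 0, 0, 0, 1, 1, 1, 1, 1, 0, 1, 0, 1, 0, 1, 0, 1, 0, 1, 0, 1],
    [1, 1, 1, 0, 1, 0, 0, 0, 0, 1, 1, 0, 0, 1, 1, 1, 1, 0, 0, 1, 0, 0, 0, 0, 0, 0, 1, 0, 0, 1, 0, 0, 1, 0],
    [1, 0, 0, 0, 0, 0, 1, 1, 0, 1, 1, 0, 1, 1, 1, 0, 0, 1, 0, 0, 0, 1, 1, 0, 1, 0, 1, 0, 1, 1, 1, 1, 0, 1],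
    [1, 1, 0, 0, 1, 0, 0, 0, 0, 1, 1, 1, 0, 0, 1, 1, 1, 0, 1, 0, 0, 1, 0, 1, 0, 0, 0, 1, 1, 0, 0, 0, 0, 0],
    [0, 1, 0, 0, 0, 1, 1, 0, 0, 1, 0, 0, 0, 0, 1, 1, 0, 0, 0, 1, 0, 0, 0, 1, 0, 1, 0, 0, 1, 0, 1, 1, 0, 0],
    [0, 1, 1, 0, 0, 0, 0, 0, 0, 1, 1, 1, 0, 1, 1, 0, 0, 0, 0, 1, 1, 1, 1, 0, 1, 0, 0, 0, 1, 0, 1, 0, 1, 1],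
    [1, 0, 1, 1, 1, 1, 1, 0, 0, 0, 1, 0, 0, 0, 0, 0, 0, 0, 1, 0, 1, 1, 0, 1, 0, 0, 0, 0, 1, 0, 1, 0, 1, 0]].getD i []).getD k 0

/-- The codes `𝒞_{68,1}, …, 𝒞_{68,34}`. -/
def codeC (i : Fin 34) : Code F2 68 := neighborCode codeC68 (placeAt lastHalf (vecC i))

/-- The index type of the new codes: two extensions of `ℱ₂`, six neighbors of these, the code
`φ(𝒞₆₈)`, and `34` neighbors of it. -/
inductive NewIndex : Type
  | d (i : Fin 2)
  | n (i : Fin 6)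
  | c68
  | c (i : Fin 34)

/-- The new binary codes of length `68`. -/
def newCode : NewIndex → Code F2 68
  | .d i => codeD i
  | .n i => codeN i
  | .c68 => codeC68
  | .c i => codeC i

/-- The value of `γ` listed for each code. -/
def gammaOf : NewIndex → ℕ
  | .d _ => 5
  | .n i => [5, 5, 5, 5, 5, 6].getD i 0
  | .c68 => 6
  | .c _ => 6

/-- The value of `β` listed for each code. -/
def betaOf : NewIndex → ℕ
  | .d i => [101, 105].getD i 0
  | .n i => [109, 111, 112, 114, 115, 133].getD i 0
  | .c68 => 157
  | .c i => [137, 139, 140, 141, 142, 143, 144, 145, 146, 147, 148, 149, 150, 151, 152, 153, 155, 159, 160, 161, 163, 164, 165, 166, 167, 168, 169, 170, 171, 172, 173, 174, 177, 184].getD i 0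

/-- The list of values of `β` with `γ = 5`. -/
def betas5 : Finset ℕ := {101, 105, 109, 111, 112, 114, 115}

/-- The list of values of `β` with `γ = 6`. -/
def betas6 : Finset ℕ :=
  {133, 137, 139, 140, 141, 142, 143, 144, 145, 146, 147, 148, 149, 150, 151, 152,
    153, 155, 157, 159, 160, 161, 163, 164, 165, 166, 167, 168, 169, 170, 171,
    172, 173, 174, 177, 184}

end SelfDualCodes

/-! Let `A_w` be the number of codewords of weight `w` in a self-dual binary code `C` of length 68.
Let `B_k` be the number of vectors of weight `k` in its shadow, the set of `y` with `⟨c, y⟩ =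
wt(c)/2` modulo 2 for all `c ∈ C`. All weights of `C` are even, and the all-one word makes the
distribution symmetric. So if no weight strictly between 0 and 12 occurs, only `A_12, A_14, …, A_34`
are unknown. The MacWilliams identities for `C` and for its shadow, in the degrees 0, 2, …, 10, are
twelve linear equations for these twelve numbers, with `A_k` and `B_k`, `k ≤ 10`, on the other side.
The signs `(-1)^(w/2)` split the system into two invertible blocks of size 6. Hence the light words
determine everything: if 0 is the only codeword of weight at most 10, and the shadow has `γ` vectors
of weight 6, `β - 14γ` of weight 10 and no other light ones, then the weight enumerator is `W682 β
γ`. Since `A_12 = 442 + 4β > 0`, the minimum distance is 12 (`macWilliams`, `weightList_solve`,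
`isExtremal68_of_counts`).

The light words are counted by computation. Up to a permutation of coordinates the code has a
generator matrix `(I | M)` with `M Mᵀ = I`. Its words are the pairs `(a, b)` with `a = M b`,
equivalently `b = Mᵀ a`, and the shadow is the affine version `a = M b + σ`, where `σ` holds the
half weights of the rows modulo 2. A pair of total weight at most 10 has `wt a ≤ 5`, or else `wt a ≥
6` and `wt b ≤ 4`. It is therefore enough to run through the balls of radius 5 and 4 in `F₂³⁴`, with
331212 and 52956 vectors (`card_pairs_eq`). All vectors of a ball are handled at once: each
coordinate of the ball is one large natural number, check bits are XORs of such numbers, and weights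
are accumulated by Boolean operations on them (`ballCounts_eq`, `card_of_lightCountsAre`).

Self-duality is computed only for the two short codes `codeF2` and `codeE6`. The Gray maps, the
extension and the neighbor construction preserve it (`isSelfDual_binaryImage`,
`isSelfDual_psiImage`, `isSelfDual_extendCode`, `isSelfDual_neighborCode`). It also makes membership
a matter of parity checks, and a self-dual code that contains the 34 rows of `(I | M)` is determined
by them (`IsSelfDual.mem_iff_systematic`). The matrices `M` are thus certificates, which only have
to be checked.

The weight enumerators differ because the coefficient of `y^12` gives `β`, and that of `y^14` then
gives `γ`. -/

namespace SelfDualCodes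

open Polynomial

/-! ### Bit-sliced enumeration of words of small weight -/

/-- `force n f` is `f n`, arranged so that the kernel evaluates `n` before it passes it on. -/
def force {α : Type} (n : ℕ) (f : ℕ → α) : α :=
  Nat.casesOn n (f 0) fun m => f (m + 1)

@[simp] theorem force_eq {α : Type} (n : ℕ) (f : ℕ → α) : force n f = f n := by
  cases n <;> rfl

/-- Pseudorandom numbers below `2 ^ 64`. A table of words is stored by columns, as natural numbers
whose bits from `64` on are the entries; the low bits hold arbitrary values, which keep the
hashes of the columns apart. -/
def noise (i : ℕ) : ℕ := 11400714819323198485 * (i + 1) % 2 ^ 64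

theorem noise_testBit (i j : ℕ) : (noise i).testBit (64 + j) = false :=
  Nat.testBit_lt_two_pow
    ((Nat.mod_lt _ (by positivity)).trans_le (Nat.pow_le_pow_right (by norm_num) (by omega)))

/-- The right shift by 64 drops the low noise bits of the second column, and the left shift places
its entries behind those of the first. The continuation-passing form, here and below, lets `force`
turn each new column into a literal before it is used. -/
def stackCols {α : Type} (s : ℕ) : List ℕ → List ℕ → (List ℕ → α) → α
  | a :: as, b :: bs, f =>
    force (a ||| (b >>> 64) <<< s) fun v => stackCols s as bs fun vs => f (v :: vs)
  | _, _, f => f []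

theorem stackCols_eq {α : Type} (s : ℕ) (as bs : List ℕ) (f : List ℕ → α) :
    stackCols s as bs f = f (List.zipWith (fun a b => a ||| (b >>> 64) <<< s) as bs) := by
  induction as generalizing bs f with
  | nil => rfl
  | cons a as ih => cases bs <;> simp [stackCols, ih]

/-- The table of the words `0w`, `w` in the table `t`, and `1w`, `w` in the table `p`. -/
def joinTables (h : ℕ) (p t : ℕ × List ℕ) : ℕ × List ℕ :=
  (t.1 + p.1, (((2 ^ p.1 - 1) <<< (t.1 + 64)) ||| noise h) ::
    List.zipWith (fun a b => a ||| (b >>> 64) <<< (t.1 + 64)) t.2 p.2)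

/-- One step of Pascal's recursion for all radii: `p` is the old table of the radius preceding that
of the head of the list. `nextTablesList` is the plain version for proofs. -/
def nextTables {α : Type} (i : ℕ) (p : ℕ × List ℕ) :
    List (ℕ × List ℕ) → (List (ℕ × List ℕ) → α) → α
  | [], f => f []
  | t :: ts, f =>
    force (t.1 + p.1) fun s =>
    force (((2 ^ p.1 - 1) <<< (t.1 + 64)) ||| noise (6 * i + ts.length)) fun h =>
      stackCols (t.1 + 64) t.2 p.2 fun c => nextTables i t ts fun r => f ((s, h :: c) :: r)

def nextTablesList (i : ℕ) (p : ℕ × List ℕ) : List (ℕ × List ℕ) → List (ℕ × List ℕ)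
  | [] => []
  | t :: ts => joinTables (6 * i + ts.length) p t :: nextTablesList i t ts

theorem nextTables_eq {α : Type} (i : ℕ) (p : ℕ × List ℕ) (ts : List (ℕ × List ℕ))
    (f : List (ℕ × List ℕ) → α) : nextTables i p ts f = f (nextTablesList i p ts) := by
  induction ts generalizing p f with
  | nil => rfl
  | cons t ts ih => simp [nextTables, nextTablesList, joinTables, stackCols_eq, ih]

/-- The tables of the words of length `n` with at most `0, …, K` ones. -/
def tables {α : Type} (K : ℕ) : ℕ → (List (ℕ × List ℕ) → α) → α
  | 0, f => f (List.replicate (K + 1) (1, []))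
  | n + 1, f => tables K n fun r => match r with
    | [] => f []
    | t :: ts => nextTables n t ts fun r => f ((t.1, noise (6 * n + 6) :: t.2) :: r)

/-- The table `t` holds the words in the list `W`. -/
def IsTable (n : ℕ) (t : ℕ × List ℕ) (W : List (List Bool)) : Prop :=
  t.1 = W.length ∧ t.2.length = n ∧
    ∀ j, t.2.map (fun c => c.testBit (64 + j)) = W.getD j (List.replicate n false)

/-- The table `t` holds the words of length `n` with at most `k` ones. -/
def IsBallTable (n k : ℕ) (t : ℕ × List ℕ) : Prop :=
  ∃ W : List (List Bool), W.Nodup ∧ (∀ w, w ∈ W ↔ w.length = n ∧ w.count true ≤ k) ∧ IsTable n t W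

/-- The columns of a table vanish beyond its last word, which is what the default value in `IsTable`
records. The shifted columns of `p` therefore meet only zeros in those of `t`, and the disjunction
is a concatenation. -/
theorem IsTable.join {n h : ℕ} {p t : ℕ × List ℕ} {V W : List (List Bool)}
    (hp : IsTable n p V) (ht : IsTable n t W) :
    IsTable (n + 1) (joinTables h p t) (W.map (false :: ·) ++ V.map (true :: ·)) := by
  obtain ⟨p1, p2, p3⟩ := hp
  obtain ⟨t1, t2, t3⟩ := ht
  refine ⟨by simp [joinTables, p1, t1], by simp [joinTables, p2, t2], fun j => ?_⟩
  have key : ∀ a b : ℕ, (a ||| (b >>> 64) <<< (t.1 + 64)).testBit (64 + j) =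
      (a.testBit (64 + j) || (decide (t.1 ≤ j) && b.testBit (64 + (j - t.1)))) := by
    intro a b
    rw [Nat.testBit_or, Nat.testBit_shiftLeft, Nat.testBit_shiftRight]
    by_cases hj : t.1 ≤ j
    · simp [hj, show t.1 + 64 ≤ 64 + j by omega, show 64 + j - (t.1 + 64) = j - t.1 by omega]
    · simp [hj, show ¬ t.1 + 64 ≤ 64 + j by omega]
  have hhead : ((2 ^ p.1 - 1) <<< (t.1 + 64) ||| noise h).testBit (64 + j) =
      (decide (t.1 ≤ j) && decide (j - t.1 < p.1)) := by
    rw [Nat.testBit_or, noise_testBit, Nat.testBit_shiftLeft, Nat.testBit_two_pow_sub_one]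
    by_cases hj : t.1 ≤ j
    · simp [hj, show t.1 + 64 ≤ 64 + j by omega, show 64 + j - (t.1 + 64) = j - t.1 by omega]
    · simp [hj, show ¬ t.1 + 64 ≤ 64 + j by omega]
  simp only [joinTables, List.map_cons, hhead, List.map_zipWith, key]
  by_cases hj : j < t.1
  · have h1 := t3 j
    rw [List.getD_eq_getElem _ _ (by omega)] at h1
    rw [List.getD_eq_getElem _ _ (by simp; omega), List.getElem_append_left (by simp; omega),
      List.getElem_map, ← h1]
    simp only [show ¬ t.1 ≤ j by omega, decide_false, Bool.false_and, Bool.or_false]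
    congr 1
    apply List.ext_getElem <;> simp [p2, t2]
  · have h1 := t3 j
    have h2 := p3 (j - t.1)
    rw [List.getD_eq_default _ _ (by omega)] at h1
    -- Past the words of `t` only the columns of `p`, moved by `t.1`, contribute.
    have h3 : List.zipWith (fun a b => a.testBit (64 + j) ||
        (decide (t.1 ≤ j) && b.testBit (64 + (j - t.1)))) t.2 p.2 =
        p.2.map (fun c => c.testBit (64 + (j - t.1))) := by
      apply List.ext_getElem
      · simp [p2, t2]
      · intro i hi hi'
        simp only [List.length_zipWith, lt_min_iff] at hi
        have : (t.2[i]'hi.1).testBit (64 + j) = false := by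
          have := congrArg (fun l => l.getD i false) h1
          simpa [List.getD_eq_getElem?_getD, hi.1, List.getElem?_replicate, ← t2] using this
        simp [this, show t.1 ≤ j by omega]
    rw [h3, h2]
    by_cases hj' : j - t.1 < p.1
    · rw [List.getD_eq_getElem _ _ (by omega), List.getD_eq_getElem _ _ (by simp; omega),
        List.getElem_append_right (by simp; omega)]
      simp [hj', show t.1 ≤ j by omega, ← t1]
    · rw [List.getD_eq_default _ _ (by omega), List.getD_eq_default _ _ (by simp; omega)]
      simp [hj', List.replicate_succ]

/-- After a leading 0 the tail may still have `k + 1` ones, after a leading 1 only `k`. -/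
theorem IsBallTable.join {n k h : ℕ} {p t : ℕ × List ℕ}
    (hp : IsBallTable n k p) (ht : IsBallTable n (k + 1) t) :
    IsBallTable (n + 1) (k + 1) (joinTables h p t) := by
  obtain ⟨V, hV, hV', hpV⟩ := hp
  obtain ⟨W, hW, hW', htW⟩ := ht
  refine ⟨_, ?_, fun w => ?_, hpV.join htW⟩
  · refine List.Nodup.append (hW.map (List.cons_injective)) (hV.map List.cons_injective) ?_
    intro x hx hx'
    simp only [List.mem_map] at hx hx'
    obtain ⟨a, -, rfl⟩ := hx
    obtain ⟨b, -, hb⟩ := hx'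
    simp at hb
  · rcases w with _ | ⟨_ | _, w⟩ <;> simp [hV', hW']

theorem IsBallTable.zero {n h : ℕ} {t : ℕ × List ℕ} (ht : IsBallTable n 0 t) :
    IsBallTable (n + 1) 0 (t.1, noise h :: t.2) := by
  obtain ⟨W, hW, hW', t1, t2, t3⟩ := ht
  refine ⟨W.map (false :: ·), hW.map List.cons_injective, fun w => ?_, by simp [t1], by simp [t2],
    fun j => ?_⟩
  · rcases w with _ | ⟨_ | _, w⟩ <;> simp [hW']
  · simp only [List.map_cons, noise_testBit, t3, List.replicate_succ]
    by_cases hj : j < W.length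
    · simp [List.getD_eq_getElem?_getD, hj]
    · simp [List.getD_eq_getElem?_getD, List.getElem?_eq_none (not_lt.1 hj)]

theorem isBallTable_nextTablesList {n k : ℕ} (i : ℕ) (p : ℕ × List ℕ) (ts : List (ℕ × List ℕ))
    (hp : IsBallTable n k p)
    (hts : ∀ (m : ℕ) (hm : m < ts.length), IsBallTable n (k + 1 + m) ts[m]) :
    (nextTablesList i p ts).length = ts.length ∧
    ∀ (m : ℕ) (hm : m < (nextTablesList i p ts).length),
      IsBallTable (n + 1) (k + 1 + m) (nextTablesList i p ts)[m] := by
  induction ts generalizing k p with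
  | nil => exact ⟨rfl, fun m hm => absurd hm (by simp [nextTablesList])⟩
  | cons t ts ih =>
    have h0 := hts 0 (by simp)
    obtain ⟨h1, h2⟩ := ih t h0 fun m hm => by
      rw [show k + 1 + 1 + m = k + 1 + (m + 1) by omega]
      exact hts (m + 1) (by simpa using hm)
    refine ⟨by simp [nextTablesList, h1], fun m hm => ?_⟩
    rcases m with _ | m
    · exact hp.join h0
    · rw [show k + 1 + (m + 1) = k + 1 + 1 + m by omega]
      exact h2 m (by simpa [nextTablesList] using hm)

/-- The list `r` does not depend on the continuation, so facts about the tables transfer to every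
computation that is run on them. -/
theorem tables_spec (K n : ℕ) : ∃ r : List (ℕ × List ℕ),
    (∀ (α : Type) (f : List (ℕ × List ℕ) → α), tables K n f = f r) ∧ r.length = K + 1 ∧
    ∀ (k : ℕ) (hk : k < r.length), IsBallTable n k r[k] := by
  induction n with
  | zero =>
    -- In length 0 every ball consists of the empty word: one word and no columns.
    refine ⟨_, fun α f => rfl, by simp, fun k hk => ⟨[[]], by simp, fun w => ?_, ?_⟩⟩
    · rcases w with _ | ⟨b, w⟩ <;> simp
    · simp only [List.getElem_replicate]
      refine ⟨by simp, by simp, fun j => ?_⟩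
      rcases j with _ | j <;> simp
  | succ n ih =>
    obtain ⟨r, h1, h2, h3⟩ := ih
    obtain _ | ⟨t, ts⟩ := r
    · simp at h2
    have h0 := h3 0 (by simp)
    obtain ⟨h4, h5⟩ := isBallTable_nextTablesList n t ts h0 fun m hm => by
      rw [show 0 + 1 + m = m + 1 by omega]
      exact h3 (m + 1) (by simpa using hm)
    refine ⟨(t.1, noise (6 * n + 6) :: t.2) :: nextTablesList n t ts, fun α f => ?_, ?_, ?_⟩
    · simp [tables, h1, nextTables_eq]
    · simpa [h4] using h2
    · intro k hk
      rcases k with _ | k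
      · exact h0.zero
      · have := h5 k (by simpa using hk)
        rw [show 0 + 1 + k = k + 1 by omega] at this
        exact this

/-! ### Check bits and weight counters for all words of a table at once -/

def parityCol : List Bool → List ℕ → ℕ
  | b :: bs, m :: ms => bif b then m ^^^ parityCol bs ms else parityCol bs ms
  | _, _ => 0

def parityBit : List Bool → List Bool → Bool
  | b :: bs, m :: ms => (b && m) ^^ parityBit bs ms
  | _, _ => false

/-- XOR acts on every binary position separately, so the XOR of the selected columns carries at
position `j` the parity check of the `j`th word. -/
theorem parityCol_testBit (bs : List Bool) (ms : List ℕ) (j : ℕ) :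
    (parityCol bs ms).testBit j = parityBit bs (ms.map (·.testBit j)) := by
  induction bs generalizing ms with
  | nil => simp [parityCol, parityBit]
  | cons b bs ih =>
    cases ms with
    | nil => simp [parityCol, parityBit]
    | cons m ms => cases b <;> simp [parityCol, parityBit, ih]

def parityCols {α : Type} (ms : List ℕ) : List (List Bool) → (List ℕ → α) → α
  | r :: rs, f => force (parityCol r ms) fun v => parityCols ms rs fun vs => f (v :: vs)
  | [], f => f []

theorem parityCols_eq {α : Type} (ms : List ℕ) (M : List (List Bool)) (f : List ℕ → α) :
    parityCols ms M f = f (M.map (parityCol · ms)) := by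
  induction M generalizing f with
  | nil => rfl
  | cons r rs ih => simp [parityCols, ih]

/-- This adds a fixed vector to the check bits of all words. The mask confines the complement to
positions that hold a word. -/
def shiftCols {α : Type} (mask : ℕ) : List Bool → List ℕ → (List ℕ → α) → α
  | t :: ts, y :: ys, f =>
    force (bif t then y ^^^ mask else y) fun v => shiftCols mask ts ys fun vs => f (v :: vs)
  | _, _, f => f []

theorem shiftCols_eq {α : Type} (mask : ℕ) (τ : List Bool) (ys : List ℕ) (f : List ℕ → α) :
    shiftCols mask τ ys f =
      f (List.zipWith (fun (t : Bool) y => bif t then y ^^^ mask else y) τ ys) := by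
  induction τ generalizing ys f with
  | nil => rfl
  | cons t ts ih => cases ys <;> simp [shiftCols, ih]

/-- The expression `e ^^^ (x &&& (e ^^^ p))` selects `p` where `x` has a one and `e` elsewhere. With
`p` the preceding counter, the words with a one in `x` move up by one. -/
def muxCols {α : Type} (x : ℕ) : ℕ → List ℕ → (List ℕ → α) → α
  | _, [], f => f []
  | p, e :: es, f => force (e ^^^ (x &&& (e ^^^ p))) fun v => muxCols x e es fun vs => f (v :: vs)

def muxList (x : ℕ) : ℕ → List ℕ → List ℕ
  | _, [] => []
  | p, e :: es => (e ^^^ (x &&& (e ^^^ p))) :: muxList x e es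

theorem muxCols_eq {α : Type} (x p : ℕ) (es : List ℕ) (f : List ℕ → α) :
    muxCols x p es f = f (muxList x p es) := by
  induction es generalizing p f with
  | nil => rfl
  | cons e es ih => simp [muxCols, muxList, ih]

/-- Add the columns in the first list to the counters in the second list, where the bit of the
`q`th counter at a word says that the count is `q`. -/
def tally {α : Type} : List ℕ → List ℕ → (List ℕ → α) → α
  | [], e, f => f e
  | c :: cs, e, f => force (noise (c &&& (2 ^ 64 - 1))) fun p =>
      muxCols c p e fun e => tally cs e f

def tallyList : List ℕ → List ℕ → List ℕ
  | [], e => e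
  | c :: cs, e => tallyList cs (muxList c (noise (c &&& (2 ^ 64 - 1))) e)

theorem tally_eq {α : Type} (cs e : List ℕ) (f : List ℕ → α) :
    tally cs e f = f (tallyList cs e) := by
  induction cs generalizing e f with
  | nil => rfl
  | cons c cs ih => simp [tally, tallyList, muxCols_eq, ih]

/-- At the position `j`, the counters hold the value `c` (with `c` beyond the range for a dead
position). -/
def IsCount (j c : ℕ) (e : List ℕ) : Prop :=
  ∀ q (hq : q < e.length), (e[q]).testBit (64 + j) = decide (q = c)

theorem muxList_length (x p : ℕ) (es : List ℕ) : (muxList x p es).length = es.length := by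
  induction es generalizing p with
  | nil => rfl
  | cons e es ih => simp [muxList, ih]

theorem muxList_getElem (x p : ℕ) (es : List ℕ) (q : ℕ) (hq : q < (muxList x p es).length) :
    (muxList x p es)[q] = es[q]'(muxList_length x p es ▸ hq) ^^^
      (x &&& (es[q]'(muxList_length x p es ▸ hq) ^^^
        (p :: es)[q]'(by rw [muxList_length] at hq; simp; omega))) := by
  induction es generalizing p q with
  | nil => simp [muxList] at hq
  | cons e es ih =>
    rcases q with _ | q
    · simp [muxList]
    · simp only [muxList, List.getElem_cons_succ]
      exact ih e q (by simpa [muxList] using hq)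

/-- The value `p` enters below counter 0, so it must be zero at word positions. A count that passes
the last counter is lost, consistently with `IsCount` for values beyond the range. -/
theorem IsCount.mux {j c x p : ℕ} {e : List ℕ} (h : IsCount j c e)
    (hp : p.testBit (64 + j) = false) :
    IsCount j (c + (x.testBit (64 + j)).toNat) (muxList x p e) := by
  intro q hq
  have hq' : q < e.length := muxList_length x p e ▸ hq
  rw [muxList_getElem]
  simp only [Nat.testBit_xor, Nat.testBit_and, h q hq']
  rcases hx : x.testBit (64 + j)
  · simp
  · rcases q with _ | q
    · simp [hp]
    · simp [h q (by omega)]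

theorem tallyList_length (cs e : List ℕ) : (tallyList cs e).length = e.length := by
  induction cs generalizing e with
  | nil => rfl
  | cons c cs ih => simp [tallyList, ih, muxList_length]

theorem IsCount.tally {j c : ℕ} {cs e : List ℕ} (h : IsCount j c e) :
    IsCount j (c + (cs.map (fun c => c.testBit (64 + j))).count true) (tallyList cs e) := by
  induction cs generalizing e c with
  | nil => simpa [tallyList] using h
  | cons a cs ih =>
    have := ih (h.mux (x := a) (noise_testBit (a &&& (2 ^ 64 - 1)) j))
    rw [tallyList]
    convert this using 1
    rw [List.map_cons, List.count_cons]
    rcases a.testBit (64 + j) <;> simp; omega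

/-- The number of ones among the binary digits of the second argument, but at most `fuel`. -/
def pop : ℕ → ℕ → ℕ
  | 0, _ => 0
  | fuel + 1, e => Nat.casesOn e 0 fun m => 1 + pop fuel ((m + 1) &&& m)

/-- Subtracting one changes a number only from its lowest set bit downwards, so the conjunction
clears exactly that bit. The induction halves the number until it is odd. -/
theorem exists_lowest_bit (m : ℕ) : ∃ i, (m + 1).testBit i = true ∧
    ∀ j, ((m + 1) &&& m).testBit j = ((m + 1).testBit j && decide (j ≠ i)) := by
  induction m using Nat.strong_induction_on with
  | _ m ih =>
    rcases Nat.even_or_odd' m with ⟨k, rfl | rfl⟩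
    · refine ⟨0, by simp [Nat.testBit_zero], fun j => ?_⟩
      rcases j with _ | j
      · simp [Nat.testBit_zero]
      · rw [Nat.testBit_and, Nat.testBit_succ, Nat.testBit_succ (2 * k)]
        rw [show (2 * k + 1) / 2 = k by omega, show 2 * k / 2 = k by omega]
        simp
    · obtain ⟨i, h1, h2⟩ := ih k (by omega)
      refine ⟨i + 1, ?_, fun j => ?_⟩
      · rw [Nat.testBit_succ, show (2 * k + 1 + 1) / 2 = k + 1 by omega, h1]
      · rcases j with _ | j
        · simp only [Nat.testBit_zero]
          have : (2 * k + 1 + 1) % 2 = 0 := by omega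
          simp [this]
        · have := h2 j
          rw [Nat.testBit_and] at this ⊢
          rw [Nat.testBit_succ, Nat.testBit_succ, show (2 * k + 1 + 1) / 2 = k + 1 by omega,
            show (2 * k + 1) / 2 = k by omega, this]
          simp

/-- Each round clears one set bit, so the cost is the number of ones and not the length of the
number, which matters for sparse counters hundreds of thousands of bits long. -/
theorem pop_eq (fuel e N : ℕ) (he : ∀ j, N ≤ j → e.testBit j = false) :
    pop fuel e = min fuel ((Finset.range N).filter fun j => e.testBit j = true).card := by
  induction fuel generalizing e with
  | zero => simp [pop]
  | succ fuel ih =>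
    rcases e with _ | m
    · simp [pop]
    · obtain ⟨i, h1, h2⟩ := exists_lowest_bit m
      have hi : i < N := by
        by_contra h
        rw [he i (by omega)] at h1
        cases h1
      change 1 + pop fuel ((m + 1) &&& m) = _
      rw [ih _ fun j hj => by rw [h2, he j hj]; rfl]
      have : ((Finset.range N).filter fun j => ((m + 1) &&& m).testBit j = true) =
          ((Finset.range N).filter fun j => (m + 1).testBit j = true).erase i := by
        ext j
        simp [h2]
        tauto
      have hmem : i ∈ (Finset.range N).filter fun j => (m + 1).testBit j = true := by simp [hi, h1]
      have hpos := Finset.card_pos.2 ⟨i, hmem⟩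
      rw [this, Finset.card_erase_of_mem hmem]
      omega

theorem card_filter_range {α : Type} (W : List α) (d : α) (P : α → Bool) :
    ((Finset.range W.length).filter fun j => P (W.getD j d) = true).card = W.countP P := by
  have : W = (List.range W.length).map fun j => W.getD j d := by
    apply List.ext_getElem
    · simp
    · intro i h1 h2
      simp [h1]
  conv_rhs => rw [this]
  rw [List.countP_map, List.countP_eq_length_filter]
  simp only [Finset.card, Finset.filter_val, Finset.range_val, Multiset.range, Multiset.filter_coe,
    Multiset.coe_card, Bool.decide_eq_true]
  rfl

/-! ### Counting the words of a table by weight -/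

def initialCounters (mask : ℕ) : List ℕ :=
  (mask ||| noise 300) :: (List.range 10).map fun i => noise (301 + i)

theorem isCount_cons {j c a : ℕ} {l : List ℕ} (ha : a.testBit (64 + j) = decide (0 = c))
    (hl : ∀ x ∈ l, x.testBit (64 + j) = false) (hc : c = 0 ∨ l.length < c) :
    IsCount j c (a :: l) := by
  intro q hq
  rcases q with _ | q
  · exact ha
  · have hq' : q < l.length := by simpa using hq
    rw [List.getElem_cons_succ, hl _ (List.getElem_mem hq')]
    symm
    rw [decide_eq_false_iff_not]
    omega

/-- There are eleven counters, for 0 to 10, so the value 11 marks a position that no counter sees.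
Positions without a word start there and never return. -/
theorem isCount_initialCounters (N j : ℕ) :
    IsCount j (if j < N then 0 else 11) (initialCounters ((2 ^ N - 1) <<< 64)) := by
  refine isCount_cons ?_ (fun x hx => ?_) ?_
  · rw [Nat.testBit_or, noise_testBit, Nat.testBit_shiftLeft, Nat.testBit_two_pow_sub_one]
    by_cases hj : j < N <;> simp [hj]
  · obtain ⟨i, -, rfl⟩ := List.mem_map.1 hx
    exact noise_testBit _ _
  · rw [List.length_map, List.length_range]
    split_ifs <;> simp

/-- For each `q ≤ 10`, count the words in the table with `q` ones among the columns of the table and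
the columns `ys` together, at least `kill` of them in `ys`. -/
def countWords (mask kill : ℕ) (ys ms : List ℕ) : List ℕ :=
  tally ys (initialCounters mask) fun e =>
    tally ms (List.replicate kill 0 ++ e.drop kill) fun e => e.map fun x => pop 128 (x >>> 64)

/-- The order of the two tallies matters: the condition on the check bits is imposed when the
counters know the weight of the check bits alone. -/
theorem countWords_eq {n kill : ℕ} {t : ℕ × List ℕ} {W : List (List Bool)} (ht : IsTable n t W)
    (ys : List ℕ) (Y : List Bool → List Bool) (hk : kill ≤ 11)
    (hY : ∀ j (hj : j < W.length), ys.map (fun c => c.testBit (64 + j)) = Y W[j]) :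
    countWords ((2 ^ t.1 - 1) <<< 64) kill ys t.2 = (List.range 11).map fun q =>
      min 128 (W.countP fun w => decide (kill ≤ (Y w).count true) &&
        decide ((Y w).count true + w.count true = q)) := by
  obtain ⟨t1, t2, t3⟩ := ht
  simp only [countWords, tally_eq]
  set e₀ := initialCounters ((2 ^ t.1 - 1) <<< 64) with he₀
  have hl₀ : e₀.length = 11 := by simp [he₀, initialCounters]
  have h₀ : ∀ j, IsCount j (if j < t.1 then 0 else 11) e₀ := isCount_initialCounters t.1
  set e₁ := tallyList ys e₀ with he₁
  have hl₁ : e₁.length = 11 := by rw [he₁, tallyList_length, hl₀]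
  have h₁ : ∀ j, IsCount j _ e₁ := fun j => (h₀ j).tally
  set e₂ := List.replicate kill 0 ++ e₁.drop kill with he₂
  have hl₂ : e₂.length = 11 := by simp [he₂, hl₁]; omega
  -- Erasing the first `kill` counters sends the words with too few check ones to the dead value 11.
  have h₂ : ∀ j c, IsCount j c e₁ → IsCount j (if c < kill then 11 else c) e₂ := by
    intro j c h q hq
    by_cases hqk : q < kill
    · simp only [he₂]
      rw [List.getElem_append_left (by simpa using hqk)]
      simp only [List.getElem_replicate, Nat.zero_testBit]
      symm
      rw [decide_eq_false_iff_not]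
      split_ifs <;> omega
    · simp only [he₂]
      rw [List.getElem_append_right (by simpa using hqk)]
      have := h q (by omega)
      simp only [List.length_replicate, List.getElem_drop]
      simp only [show kill + (q - kill) = q by omega, this]
      congr 1
      rw [eq_iff_iff]
      split_ifs <;> omega
  have h₃ := fun j => (h₂ j _ (h₁ j)).tally (cs := t.2)
  have hl₃ : (tallyList t.2 e₂).length = 11 := by rw [tallyList_length, hl₂]
  apply List.ext_getElem
  · simp [hl₃]
  · intro q hq _
    have hq' : q < 11 := by simpa [hl₃] using hq
    simp only [List.getElem_map, List.getElem_range]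
    have h₄ := fun j => h₃ j q (by omega)
    -- Positions beyond the table are dead, so the popcount sees only words of `W`.
    have h₅ : ∀ j, W.length ≤ j →
        ((tallyList t.2 e₂)[q]'(by omega) >>> 64).testBit j = false := by
      intro j hj
      rw [Nat.testBit_shiftRight, h₄, decide_eq_false_iff_not]
      split_ifs <;> omega
    rw [pop_eq _ _ _ h₅]
    congr 1
    rw [← card_filter_range W (List.replicate n false)]
    congr 1
    apply Finset.filter_congr
    intro j hj
    have hj := Finset.mem_range.1 hj
    rw [Nat.testBit_shiftRight, h₄, hY j hj, t3, List.getD_eq_getElem _ _ hj,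
      if_pos (show j < t.1 by omega), Nat.zero_add]
    simp only [decide_eq_true_eq, Bool.and_eq_true]
    split_ifs <;> omega

/-! ### Words over the binary field -/

/-- The bits of a binary vector. -/
def bitsOf {n : ℕ} (a : Fin n → F2) : List Bool := List.ofFn fun i => decide (a i = 1)

theorem F2.eq_zero_or_one (a : F2) : a = 0 ∨ a = 1 := by
  revert a; decide

theorem F2.ne_zero_iff (a : F2) : a ≠ 0 ↔ a = 1 := by
  revert a; decide

theorem bitsOf_injective {n : ℕ} : Function.Injective (bitsOf (n := n)) := by
  intro a b h
  have := List.ofFn_injective h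
  funext i
  have := congrFun this i
  rcases F2.eq_zero_or_one (a i) with h1 | h1 <;> rcases F2.eq_zero_or_one (b i) with h2 | h2 <;>
    simp_all

theorem count_ofFn {n : ℕ} (f : Fin n → Bool) :
    (List.ofFn f).count true = (Finset.univ.filter fun i => f i = true).card := by
  induction n with
  | zero => simp
  | succ n ih =>
    rw [List.ofFn_succ, List.count_cons, ih, Fin.card_filter_univ_succ]
    cases f 0 <;> simp

theorem count_bitsOf {n : ℕ} (a : Fin n → F2) : (bitsOf a).count true = hammingNorm a := by
  rw [bitsOf, count_ofFn, hammingNorm]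
  simp only [decide_eq_true_eq, F2.ne_zero_iff]

/-- The element of the binary field given by a bit. -/
def bit (b : Bool) : F2 := if b then 1 else 0

theorem decide_add (a b : F2) : decide (a + b = 1) = (decide (a = 1) ^^ decide (b = 1)) := by
  revert a b; decide

theorem decide_bit_mul (c : Bool) (b : F2) : decide (bit c * b = 1) = (c && decide (b = 1)) := by
  revert b c; decide

theorem decide_bit (c : Bool) : decide (bit c = 1) = c := by
  revert c; decide

theorem parityBit_ofFn {n : ℕ} (r : Fin n → Bool) (a : Fin n → F2) :
    parityBit (List.ofFn r) (bitsOf a) = decide (∑ i, bit (r i) * a i = 1) := by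
  induction n with
  | zero => simp [parityBit, bitsOf]
  | succ n ih =>
    rw [Fin.sum_univ_succ, decide_add, decide_bit_mul, bitsOf, List.ofFn_succ, List.ofFn_succ,
      parityBit, ← ih]
    rfl

/-- A repetition-free list of the bit strings in a ball is in bijection, through `bitsOf`, with the
vectors of the ball. -/
theorem countP_eq_card {n k : ℕ} {W : List (List Bool)} (hW : W.Nodup)
    (hW' : ∀ w, w ∈ W ↔ w.length = n ∧ w.count true ≤ k) (P : List Bool → Bool) :
    W.countP P =
      (Finset.univ.filter fun a : Fin n → F2 => hammingNorm a ≤ k ∧ P (bitsOf a) = true).card := by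
  rw [List.countP_eq_length_filter, ← List.toFinset_card_of_nodup (hW.filter _)]
  symm
  refine Finset.card_bij (fun a _ => bitsOf a) ?_ (fun _ _ _ _ h => bitsOf_injective h) ?_
  · intro a ha
    simp only [Finset.mem_filter, Finset.mem_univ, true_and] at ha
    simp only [List.mem_toFinset, List.mem_filter, hW', count_bitsOf]
    exact ⟨⟨by simp [bitsOf], ha.1⟩, ha.2⟩
  · intro w hw
    simp only [List.mem_toFinset, List.mem_filter, hW'] at hw
    obtain ⟨⟨h1, h2⟩, h3⟩ := hw
    have hw : bitsOf (fun i : Fin n => bit (w[i])) = w := by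
      simp only [bitsOf, decide_bit]
      subst h1
      exact List.ofFn_getElem
    refine ⟨_, ?_, hw⟩
    simp only [Finset.mem_filter, Finset.mem_univ, true_and, hw]
    exact ⟨by rwa [← count_bitsOf, hw], h3⟩

/-! ### Counting the words of small weight of a code and of its shadow -/

/-- The rows of the matrix over the binary field with rows given as binary numbers. -/
def bitMatrix (rows : List ℕ) : Matrix (Fin 34) (Fin 34) F2 :=
  fun i k => bit ((rows.getD i 0).testBit k)

def bitRows (rows : List ℕ) : List (List Bool) :=
  rows.map fun r => (List.range 34).map r.testBit

def bitCols (rows : List ℕ) : List (List Bool) :=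
  (List.range 34).map fun k => rows.map (Nat.testBit · k)

theorem bitMatrix_apply (rows : List ℕ) (i k : Fin 34) :
    bitMatrix rows i k = bit ((rows.getD i 0).testBit k) := rfl

theorem bitRows_eq {rows : List ℕ} (h : rows.length = 34) : bitRows rows =
    List.ofFn fun i : Fin 34 => List.ofFn fun k : Fin 34 => (rows.getD i 0).testBit k := by
  apply List.ext_getElem
  · simp [bitRows, h]
  · intro i h1 h2
    have h3 : i < rows.length := by simpa [bitRows] using h1
    simp only [bitRows, List.getElem_map, List.getElem_ofFn, List.getD_eq_getElem _ _ h3]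
    apply List.ext_getElem
    · rw [List.length_map, List.length_range, List.length_ofFn]
    · intro k _ _
      simp only [List.getElem_map, List.getElem_range, List.getElem_ofFn]

theorem bitCols_eq {rows : List ℕ} (h : rows.length = 34) : bitCols rows =
    List.ofFn fun k : Fin 34 => List.ofFn fun i : Fin 34 => (rows.getD i 0).testBit k := by
  apply List.ext_getElem
  · simp [bitCols]
  · intro k h1 h2
    simp only [bitCols, List.getElem_map, List.getElem_range, List.getElem_ofFn]
    apply List.ext_getElem
    · rw [List.length_map, List.length_ofFn, h]
    · intro i h3 _
      have h3 : i < rows.length := by simpa using h3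
      simp only [List.getElem_map, List.getElem_ofFn, List.getD_eq_getElem _ _ h3]

theorem map_parityBit_ofFn {m n : ℕ} (M : Fin m → Fin n → Bool) (A : Matrix (Fin m) (Fin n) F2)
    (hA : ∀ i j, A i j = bit (M i j)) (a : Fin n → F2) :
    (List.ofFn fun i => List.ofFn (M i)).map (parityBit · (bitsOf a)) = bitsOf (A.mulVec a) := by
  rw [List.map_ofFn]
  conv_rhs => rw [bitsOf]
  congr 1
  funext i
  simp only [Function.comp_apply]
  rw [parityBit_ofFn]
  simp only [Matrix.mulVec, dotProduct, hA]

/-- Count the words in the table `t`, with the check bits given by `M`, and by `M` and `τ`. -/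
def ballCounts (kill : ℕ) (M : List (List Bool)) (τ : List Bool) (t : ℕ × List ℕ) :
    List ℕ × List ℕ :=
  force ((2 ^ t.1 - 1) <<< 64) fun mask => parityCols t.2 M fun ys =>
    (countWords mask kill ys t.2, shiftCols mask τ ys fun zs => countWords mask kill zs t.2)

/-- The number of vectors `a` of weight at most `k` such that `(a, f a)` has weight `q` and `f a` has
weight at least `kill`. -/
def ballCard {n : ℕ} (k kill : ℕ) (f : (Fin n → F2) → (Fin n → F2)) (q : ℕ) : ℕ :=
  (Finset.univ.filter fun a : Fin n → F2 =>
    hammingNorm a ≤ k ∧ kill ≤ hammingNorm (f a) ∧ hammingNorm (f a) + hammingNorm a = q).card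

/-- The linear count serves the code and the affine one its shadow, and both share the columns of
check bits. The cap 128 is the fuel of `pop` in `countWords`. -/
theorem ballCounts_eq {n k kill : ℕ} {t : ℕ × List ℕ} (ht : IsBallTable n k t) (hk : kill ≤ 11)
    (M : Fin n → Fin n → Bool) (τ : Fin n → F2) (A : Matrix (Fin n) (Fin n) F2)
    (hA : ∀ i j, A i j = bit (M i j)) :
    ballCounts kill (List.ofFn fun i => List.ofFn (M i)) (bitsOf τ) t =
      ((List.range 11).map fun q => min 128 (ballCard k kill A.mulVec q),
       (List.range 11).map fun q => min 128 (ballCard k kill (fun a => A.mulVec a + τ) q)) := by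
  obtain ⟨W, hW, hW', hT⟩ := ht
  have hbits := map_parityBit_ofFn M A hA
  have hcol : ∀ j (hj : j < W.length),
      ((List.ofFn fun i => List.ofFn (M i)).map (parityCol · t.2)).map
        (fun c => c.testBit (64 + j)) =
      (List.ofFn fun i => List.ofFn (M i)).map (parityBit · W[j]) := by
    intro j hj
    rw [List.map_map]
    congr 1
    funext r
    simp [parityCol_testBit, hT.2.2, hj]
  simp only [ballCounts, force_eq, parityCols_eq, shiftCols_eq]
  rw [countWords_eq hT _ (fun w => (List.ofFn fun i => List.ofFn (M i)).map (parityBit · w)) hk hcol,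
    countWords_eq hT _ (fun w => List.zipWith xor (bitsOf τ)
      ((List.ofFn fun i => List.ofFn (M i)).map (parityBit · w))) hk ?_]
  · congr 1
    · apply List.map_congr_left
      intro q _
      rw [countP_eq_card hW hW']
      simp only [hbits, count_bitsOf, Bool.and_eq_true, decide_eq_true_eq, ballCard]
    · apply List.map_congr_left
      intro q _
      rw [countP_eq_card hW hW']
      have : ∀ a : Fin n → F2,
          List.zipWith xor (bitsOf τ) (bitsOf (A.mulVec a)) = bitsOf (A.mulVec a + τ) := by
        intro a
        apply List.ext_getElem
        · simp [bitsOf]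
        · intro i h1 h2
          simp only [bitsOf, List.getElem_zipWith, List.getElem_ofFn, Pi.add_apply, decide_add]
          exact Bool.xor_comm _ _
      simp only [hbits, this, count_bitsOf, Bool.and_eq_true, decide_eq_true_eq, ballCard]
  · intro j hj
    rw [← hcol j hj]
    apply List.ext_getElem
    · simp [bitsOf]
    · intro i h1 h2
      have hj' : j < t.1 := by rw [hT.1]; exact hj
      simp only [List.getElem_map, List.getElem_zipWith]
      have hmask : ((2 ^ t.1 - 1) <<< 64).testBit (64 + j) = true := by
        simp [Nat.testBit_shiftLeft, Nat.testBit_two_pow_sub_one, hj']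
      generalize (bitsOf τ)[i]'_ = b
      cases b
      · rw [cond_false, Bool.false_xor]
      · rw [cond_true, Nat.testBit_xor, hmask, Bool.xor_comm]

/-- If the first half has weight at least `K + 2`, the second has weight at most `q - (K + 2) ≤ K`,
so one of the halves lies in a small ball and determines the other. The lower bound `K + 2` in the
second term prevents double counting. -/
theorem card_pairs_eq {n K q : ℕ} (hq : q ≤ 2 * K + 2) (f g : (Fin n → F2) → (Fin n → F2))
    (hfg : ∀ a b, b = f a ↔ a = g b) :
    (Finset.univ.filter fun x : (Fin n → F2) × (Fin n → F2) =>
      x.2 = f x.1 ∧ hammingNorm x.1 + hammingNorm x.2 = q).card =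
    ballCard (K + 1) 0 f q + ballCard K (K + 2) g q := by
  rw [← Finset.card_filter_add_card_filter_not (p := fun x => hammingNorm x.1 ≤ K + 1)]
  simp only [ballCard]
  congr 1
  · refine Finset.card_bij (fun x _ => x.1) ?_ ?_ ?_
    · rintro ⟨a, b⟩ h
      simp only [Finset.mem_filter, Finset.mem_univ, true_and] at h ⊢
      obtain ⟨⟨rfl, h1⟩, h2⟩ := h
      omega
    · rintro ⟨a, b⟩ h ⟨a', b'⟩ h' rfl
      simp only [Finset.mem_filter, Finset.mem_univ, true_and] at h h'
      simp [h.1.1, h'.1.1]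
    · intro a h
      simp only [Finset.mem_filter, Finset.mem_univ, true_and] at h
      refine ⟨(a, f a), ?_, rfl⟩
      simp only [Finset.mem_filter, Finset.mem_univ, true_and]
      omega
  · refine Finset.card_bij (fun x _ => x.2) ?_ ?_ ?_
    · rintro ⟨a, b⟩ h
      simp only [Finset.mem_filter, Finset.mem_univ, true_and] at h ⊢
      obtain ⟨⟨h0, h1⟩, h2⟩ := h
      rw [hfg] at h0
      rw [← h0]
      omega
    · rintro ⟨a, b⟩ h ⟨a', b'⟩ h' rfl
      simp only [Finset.mem_filter, Finset.mem_univ, true_and, hfg] at h h'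
      simp [h.1.1, h'.1.1]
    · intro b h
      simp only [Finset.mem_filter, Finset.mem_univ, true_and] at h
      refine ⟨(g b, b), ?_, rfl⟩
      simp only [Finset.mem_filter, Finset.mem_univ, true_and]
      exact ⟨⟨(hfg _ _).2 rfl, by omega⟩, by omega⟩

/-- Half the weight of each row of `(I | M)`, modulo two. -/
def halfWeights (rows : List ℕ) : List Bool :=
  rows.map fun r => Nat.beq ((1 + pop 64 r) / 2 % 2) 1

/-- The radius-5 ball runs over the information half `a`, with check part `Mᵀ a`, or `Mᵀ a + Mᵀ σ`
for the shadow. The radius-4 ball runs over the redundancy half `b`, with `M b` or `M b + σ`,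
restricted to weight at least 6. -/
def tablesGive (rows L S : List ℕ) (t₄ t₅ : ℕ × List ℕ) : Bool :=
  let σ := halfWeights rows
  let p := ballCounts 0 (bitCols rows) ((bitCols rows).map (parityBit · σ)) t₅
  let p' := ballCounts 6 (bitRows rows) σ t₄
  (List.zipWith (· + ·) p.1 p'.1 == L) && (List.zipWith (· + ·) p.2 p'.2 == S)

/-- The numbers of words of weight `0, …, 10` in the code with the generator matrix `(I | M)` and in
its shadow are those listed. -/
def lightCountsAre (rows L S : List ℕ) : Bool :=
  tables 5 34 fun r => tablesGive rows L S (r.getD 4 (0, [])) (r.getD 5 (0, []))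

/-- A sum of capped counts below 128 has no summand at the cap, so the counts are exact. -/
theorem getD_of_zipWith_eq {f g : ℕ → ℕ} {L : List ℕ}
    (h : List.zipWith (· + ·) ((List.range 11).map fun q => min 128 (f q))
      ((List.range 11).map fun q => min 128 (g q)) = L)
    (hL : ∀ v ∈ L, v < 128) {q : ℕ} (hq : q < 11) : f q + g q = L.getD q 0 := by
  subst h
  have h1 : q < (List.zipWith (· + ·) ((List.range 11).map fun q => min 128 (f q))
      ((List.range 11).map fun q => min 128 (g q))).length := by simpa using hq
  have h2 := hL _ (List.getElem_mem h1)
  rw [List.getD_eq_getElem _ _ h1]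
  simp only [List.getElem_zipWith, List.getElem_map, List.getElem_range] at h2 ⊢
  omega

theorem exists_tables_of_lightCountsAre {rows L S : List ℕ}
    (h : lightCountsAre rows L S = true) :
    ∃ t₄ t₅ : ℕ × List ℕ, IsBallTable 34 4 t₄ ∧ IsBallTable 34 5 t₅ ∧
      List.zipWith (· + ·)
        (ballCounts 0 (bitCols rows) ((bitCols rows).map (parityBit · (halfWeights rows))) t₅).1
        (ballCounts 6 (bitRows rows) (halfWeights rows) t₄).1 = L ∧
      List.zipWith (· + ·)
        (ballCounts 0 (bitCols rows) ((bitCols rows).map (parityBit · (halfWeights rows))) t₅).2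
        (ballCounts 6 (bitRows rows) (halfWeights rows) t₄).2 = S := by
  obtain ⟨r, h1, h2, h3⟩ := tables_spec 5 34
  have h := (h1 _ _).symm.trans h
  rw [tablesGive, Bool.and_eq_true, beq_iff_eq, beq_iff_eq] at h
  refine ⟨_, _, ?_, ?_, h.1, h.2⟩
  · rw [List.getD_eq_getElem _ _ (by omega)]
    exact h3 4 _
  · rw [List.getD_eq_getElem _ _ (by omega)]
    exact h3 5 _

theorem transpose_mul_self {ι R : Type} [Fintype ι] [DecidableEq ι] [CommRing R]
    {A : Matrix ι ι R} (h : A * A.transpose = 1) : A.transpose * A = 1 :=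
  mul_eq_one_comm.1 h

theorem card_of_lightCountsAre {rows L S : List ℕ} (hrows : rows.length = 34)
    (h : lightCountsAre rows L S = true) (hL : ∀ v ∈ L, v < 128) (hS : ∀ v ∈ S, v < 128)
    (hA : bitMatrix rows * (bitMatrix rows).transpose = 1) (σ : Fin 34 → F2)
    (hσ : bitsOf σ = halfWeights rows) {q : ℕ} (hq : q < 11) :
    (Finset.univ.filter fun x : (Fin 34 → F2) × (Fin 34 → F2) =>
      x.1 = (bitMatrix rows).mulVec x.2 ∧ hammingNorm x.1 + hammingNorm x.2 = q).card =
        L.getD q 0 ∧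
    (Finset.univ.filter fun x : (Fin 34 → F2) × (Fin 34 → F2) =>
      x.1 = (bitMatrix rows).mulVec x.2 + σ ∧ hammingNorm x.1 + hammingNorm x.2 = q).card =
        S.getD q 0 := by
  set A := bitMatrix rows with hAdef
  have hA' : A.transpose * A = 1 := transpose_mul_self hA
  have hneg : ∀ v : Fin 34 → F2, v + v = 0 := fun v => by
    funext i
    exact CharTwo.add_self_eq_zero _
  -- Since `M` is orthogonal, `a = M b + v` is solved by `b = Mᵀ a + Mᵀ v`. The vector `v = 0` gives
  -- the code and `v = σ` the shadow.
  have hfg : ∀ v a b : Fin 34 → F2,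
      b = A.transpose.mulVec a + A.transpose.mulVec v ↔ a = A.mulVec b + v := by
    intro v a b
    rw [← Matrix.mulVec_add]
    constructor
    · rintro rfl
      rw [Matrix.mulVec_mulVec, hA, Matrix.one_mulVec, add_assoc, hneg, add_zero]
    · rintro rfl
      rw [add_assoc, hneg, add_zero, Matrix.mulVec_mulVec, hA', Matrix.one_mulVec]
  have hcol : (bitCols rows).map (parityBit · (halfWeights rows)) =
      bitsOf (A.transpose.mulVec σ) := by
    rw [← hσ, bitCols_eq hrows]
    exact map_parityBit_ofFn (fun k i : Fin 34 => (rows.getD i 0).testBit k) A.transpose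
      (fun i j => bitMatrix_apply rows j i) σ
  obtain ⟨t₄, t₅, h4, h5, ha, hb⟩ := exists_tables_of_lightCountsAre h
  rw [hcol, bitCols_eq hrows, bitRows_eq hrows, ← hσ,
    ballCounts_eq h5 (by norm_num) (fun k i : Fin 34 => (rows.getD i 0).testBit k)
      (A.transpose.mulVec σ) A.transpose (fun i j => bitMatrix_apply rows j i),
    ballCounts_eq h4 (by norm_num) (fun i k : Fin 34 => (rows.getD i 0).testBit k) σ A
      (fun i j => bitMatrix_apply rows i j)] at ha hb
  have hf := hfg 0
  simp only [Matrix.mulVec_zero, add_zero] at hf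
  have e1 := card_pairs_eq (K := 4) (q := q) (by omega) _ _ hf
  have e2 := card_pairs_eq (K := 4) (q := q) (by omega) _ _ (hfg σ)
  rw [← getD_of_zipWith_eq ha hL hq, ← getD_of_zipWith_eq hb hS hq]
  constructor
  · rw [← e1]
    exact congrArg _ (Finset.filter_congr fun x _ => and_congr_left' (hf _ _).symm)
  · rw [← e2]
    exact congrArg _ (Finset.filter_congr fun x _ => and_congr_left' (hfg _ _ _).symm)

/-! ### Self-dual codes -/

section SelfDual

variable {R : Type} [CommRing R] {n : ℕ}

theorem mem_dualCode {C : Code R n} {x : Fin n → R} : x ∈ dualCode C ↔ ∀ y ∈ C, x ⬝ᵥ y = 0 :=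
  Iff.rfl

theorem IsSelfDual.mem_iff {C : Code R n} (hC : IsSelfDual C) {x : Fin n → R} :
    x ∈ C ↔ ∀ y ∈ C, x ⬝ᵥ y = 0 := by
  conv_lhs => rw [← hC]
  exact mem_dualCode

theorem IsSelfDual.dotProduct_eq_zero {C : Code R n} (hC : IsSelfDual C) {x y : Fin n → R}
    (hx : x ∈ C) (hy : y ∈ C) : x ⬝ᵥ y = 0 := hC.mem_iff.1 hx y hy

theorem isSelfDual_of_forall {C : Code R n} (h₁ : ∀ x ∈ C, ∀ y ∈ C, x ⬝ᵥ y = 0)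
    (h₂ : ∀ x, (∀ y ∈ C, x ⬝ᵥ y = 0) → x ∈ C) : IsSelfDual C :=
  le_antisymm (fun x hx => h₂ x hx) (fun x hx y hy => h₁ x hx y hy)

theorem mem_dualCode_span {s : Set (Fin n → R)} {x : Fin n → R} :
    x ∈ dualCode (Submodule.span R s) ↔ ∀ y ∈ s, x ⬝ᵥ y = 0 := by
  refine ⟨fun h y hy => h y (Submodule.subset_span hy), fun h y hy => ?_⟩
  induction hy using Submodule.span_induction with
  | mem y hy => exact h y hy
  | zero => exact dotProduct_zero x
  | add y z _ _ hy hz => rw [dotProduct_add, hy, hz, add_zero]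
  | smul a y _ hy => rw [dotProduct_smul, hy, smul_zero]

theorem mem_dualCode_rowCode {ι : Type} {G : Matrix ι (Fin n) R} {x : Fin n → R} :
    x ∈ dualCode (rowCode G) ↔ ∀ i, x ⬝ᵥ G i = 0 := by
  rw [rowCode, mem_dualCode_span]
  exact Set.forall_mem_range

theorem isSelfDual_rowCode {ι : Type} {G : Matrix ι (Fin n) R} (h₁ : ∀ i j, G i ⬝ᵥ G j = 0)
    (h₂ : ∀ x, (∀ i, x ⬝ᵥ G i = 0) → x ∈ rowCode G) : IsSelfDual (rowCode G) := by
  refine le_antisymm (fun x hx => h₂ x (mem_dualCode_rowCode.1 hx)) ?_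
  refine Submodule.span_le.2 ?_
  rintro _ ⟨i, rfl⟩
  exact mem_dualCode_rowCode.2 (h₁ i)

section Systematic

variable {ι : Type} [Fintype ι] [DecidableEq ι]

/-- The generator matrix `(I | M)`. -/
def systematic (e : ι ⊕ ι ≃ Fin n) (M : Matrix ι ι R) : Matrix ι (Fin n) R :=
  (Matrix.fromCols 1 M).submatrix id e.symm

theorem dotProduct_systematic (e : ι ⊕ ι ≃ Fin n) (M : Matrix ι ι R) (x : Fin n → R) (i : ι) :
    x ⬝ᵥ systematic e M i = x (e (Sum.inl i)) + ∑ j, M i j * x (e (Sum.inr j)) := by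
  rw [dotProduct, ← e.sum_comp, Fintype.sum_sum_type]
  simp [systematic, Matrix.one_apply, mul_comm]

/-- Rows `i`, `j` of `(I | M)` have inner product `(I + M Mᵀ)ᵢⱼ = 0`. Conversely, orthogonality of
`x = (a, b)` to the rows says `a = -M b`. A one-sided inverse of a square matrix is two-sided, so
`Mᵀ M = -1` and `b = Mᵀ a`, which makes `x` the combination of the rows with coefficients `a`. -/
theorem isSelfDual_systematic (e : ι ⊕ ι ≃ Fin n) (M : Matrix ι ι R)
    (hM : M * M.transpose = -1) : IsSelfDual (rowCode (systematic e M)) := by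
  refine isSelfDual_rowCode (fun i j => ?_) (fun x hx => ?_)
  · rw [dotProduct_systematic]
    have := congrFun (congrFun hM j) i
    rw [Matrix.mul_apply] at this
    simp only [systematic, Matrix.submatrix_apply, id, Equiv.symm_apply_apply,
      Matrix.fromCols_apply_inl, Matrix.fromCols_apply_inr]
    simp only [Matrix.transpose_apply] at this
    rw [this, Matrix.neg_apply, Matrix.one_apply, Matrix.one_apply]
    by_cases h : i = j <;> simp [h, eq_comm]
  · have hM' : M.transpose * M = -1 := by
      have : (-M.transpose) * M = 1 := by
        rw [mul_eq_one_comm, Matrix.mul_neg, hM, neg_neg]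
      rw [← neg_neg (M.transpose * M), ← Matrix.neg_mul, this]
    have hx' : ∀ i, x (e (Sum.inl i)) = -∑ j, M i j * x (e (Sum.inr j)) := fun i => by
      have := hx i
      rw [dotProduct_systematic] at this
      exact eq_neg_of_add_eq_zero_left this
    have hxr : ∀ j, x (e (Sum.inr j)) = ∑ i, x (e (Sum.inl i)) * M i j := by
      intro j
      have h1 : (fun i => x (e (Sum.inl i))) = -(M.mulVec fun j => x (e (Sum.inr j))) := by
        funext i
        rw [hx' i]
        rfl
      have h2 : M.transpose.mulVec (fun i => x (e (Sum.inl i))) = fun j => x (e (Sum.inr j)) := by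
        rw [h1, Matrix.mulVec_neg, Matrix.mulVec_mulVec, hM', Matrix.neg_mulVec, neg_neg,
          Matrix.one_mulVec]
      rw [← congrFun h2 j]
      simp [Matrix.mulVec, dotProduct, mul_comm]
    have : x = ∑ i, x (e (Sum.inl i)) • systematic e M i := by
      funext k
      obtain ⟨k, rfl⟩ := e.surjective k
      rcases k with k | k
      · simp [systematic, Matrix.one_apply]
      · simp [systematic, hxr]
    rw [this]
    exact Submodule.sum_mem _ fun i _ =>
      Submodule.smul_mem _ _ (Submodule.subset_span ⟨i, rfl⟩)

end Systematic

/-! ### The extension construction -/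

theorem vecCons_dotProduct_vecCons {a b : R} {x y : Fin n → R} :
    Matrix.vecCons a x ⬝ᵥ Matrix.vecCons b y = a * b + x ⬝ᵥ y := by
  simp

/-- In characteristic two `(p, q, z) = (p + cq)(1, 0, X) + (y, cy, r)` with `r = z + (p + cq)X`:
from `⟨X, X⟩ = 1` and `⟨z, X⟩ = p` one gets `y = cq`, and `c² = 1` gives `cy = q`. -/
theorem mem_extendCode_of {C : Code R n} (h2 : (1 : R) + 1 = 0) {c : R} (hc : c ^ 2 = 1)
    {X : Fin n → R} (hX : X ⬝ᵥ X = 1) {p q : R} {z : Fin n → R} (hp : p + z ⬝ᵥ X = 0)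
    (hz : z + (p + c * q) • X ∈ C) :
    Matrix.vecCons p (Matrix.vecCons q z) ∈ extendCode C c X := by
  have hneg : ∀ a : R, a + a = 0 := fun a => by rw [← two_mul, ← one_add_one_eq_two, h2, zero_mul]
  have hp' : z ⬝ᵥ X = p := by linear_combination hp - hneg p
  have h1 : Matrix.vecCons 1 (Matrix.vecCons 0 X) ∈ extendCode C c X :=
    Submodule.subset_span ⟨none, rfl⟩
  have h3 : Matrix.vecCons ((z + (p + c * q) • X) ⬝ᵥ X) (Matrix.vecCons
      (c * ((z + (p + c * q) • X) ⬝ᵥ X)) (z + (p + c * q) • X)) ∈ extendCode C c X :=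
    Submodule.subset_span ⟨some ⟨_, hz⟩, rfl⟩
  have := Submodule.add_mem _ (Submodule.smul_mem _ (p + c * q) h1) h3
  convert this using 1
  rw [add_dotProduct, smul_dotProduct, hX, hp']
  simp only [Matrix.smul_cons, Matrix.add_cons, Matrix.head_cons, Matrix.tail_cons, smul_eq_mul,
    mul_one, mul_zero, zero_add]
  congr 1
  · linear_combination -hneg p - hneg (c * q)
  · congr 1
    · linear_combination (-q) * hc - c * hneg p
    · funext i
      simp only [Pi.add_apply, Pi.smul_apply, smul_eq_mul]
      linear_combination -hneg ((p + c * q) * X i)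

/-- The two new coordinates contribute `(1 + c²) yᵢ yⱼ = 0` to products of lower rows, and the first
row is orthogonal to everything because `⟨X, X⟩ = 1`. A vector orthogonal to all rows satisfies the
hypotheses of `mem_extendCode_of`, as `C` equals its dual. -/
theorem isSelfDual_extendCode {C : Code R n} (h2 : (1 : R) + 1 = 0) (hC : IsSelfDual C) {c : R}
    (hc : c ^ 2 = 1) {X : Fin n → R} (hX : X ⬝ᵥ X = 1) : IsSelfDual (extendCode C c X) := by
  have hneg : ∀ a : R, a + a = 0 := fun a => by rw [← two_mul, ← one_add_one_eq_two, h2, zero_mul]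
  refine isSelfDual_rowCode ?_ ?_
  · rintro (_ | ⟨r, hr⟩) (_ | ⟨s, hs⟩)
    · simp only [extensionMatrix, vecCons_dotProduct_vecCons, hX]
      linear_combination h2
    · simp only [extensionMatrix, vecCons_dotProduct_vecCons]
      rw [dotProduct_comm X s]
      linear_combination hneg (s ⬝ᵥ X)
    · simp only [extensionMatrix, vecCons_dotProduct_vecCons]
      linear_combination hneg (r ⬝ᵥ X)
    · simp only [extensionMatrix, vecCons_dotProduct_vecCons, hC.dotProduct_eq_zero hr hs]
      linear_combination (r ⬝ᵥ X) * (s ⬝ᵥ X) * hc + hneg ((r ⬝ᵥ X) * (s ⬝ᵥ X))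
  · intro x hx
    have hx' : x = Matrix.vecCons (x 0) (Matrix.vecCons (x 1) fun i => x i.succ.succ) := by
      funext i
      refine Fin.cases rfl (fun i => Fin.cases rfl (fun i => rfl) i) i
    set p := x 0
    set q := x 1
    set z : Fin n → R := fun i => x i.succ.succ
    rw [hx'] at hx ⊢
    have h0 := hx none
    simp only [extensionMatrix, vecCons_dotProduct_vecCons, mul_one, mul_zero, zero_add] at h0
    refine mem_extendCode_of h2 hc hX h0 ?_
    rw [hC.mem_iff]
    intro r hr
    have h1 := hx (some ⟨r, hr⟩)
    simp only [extensionMatrix, vecCons_dotProduct_vecCons] at h1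
    rw [add_dotProduct, smul_dotProduct, smul_eq_mul, dotProduct_comm X r]
    linear_combination h1

/-! ### The neighbor construction -/

theorem mem_dualCode_span_singleton {x y : Fin n → R} :
    y ∈ dualCode (Submodule.span R {x}) ↔ y ⬝ᵥ x = 0 := by
  rw [mem_dualCode_span]
  simp

theorem mem_neighborCode_of_mem {C : Code R n} {x y : Fin n → R} (h : y ∈ C) (hx : y ⬝ᵥ x = 0) :
    y ∈ neighborCode C x :=
  Submodule.mem_sup_left ⟨mem_dualCode_span_singleton.2 hx, h⟩

theorem self_mem_neighborCode {C : Code R n} {x : Fin n → R} : x ∈ neighborCode C x :=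
  Submodule.mem_sup_right (Submodule.mem_span_singleton_self x)

theorem mem_neighborCode {C : Code R n} {x y : Fin n → R} :
    y ∈ neighborCode C x ↔ ∃ z ∈ C, z ⬝ᵥ x = 0 ∧ ∃ t : R, y = z + t • x := by
  rw [neighborCode, Submodule.mem_sup]
  constructor
  · rintro ⟨z, hz, w, hw, rfl⟩
    obtain ⟨t, rfl⟩ := Submodule.mem_span_singleton.1 hw
    exact ⟨z, hz.2, mem_dualCode_span_singleton.1 hz.1, t, rfl⟩
  · rintro ⟨z, hz, hzx, t, rfl⟩
    exact ⟨z, ⟨mem_dualCode_span_singleton.2 hzx, hz⟩, t • x,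
      Submodule.smul_mem _ _ (Submodule.mem_span_singleton_self x), rfl⟩

end SelfDual

section Field

variable {F : Type} [Field F] {n : ℕ}

/-- Orthogonality within the neighbor is immediate. For maximality, a vector `v` orthogonal to the
neighbor is corrected by a multiple of `x` to lie in the dual of `C`, which is `C`. A word `c ∈ C`
not orthogonal to `x` fixes the multiple. -/
theorem isSelfDual_neighborCode {C : Code F n} (hC : IsSelfDual C) {x : Fin n → F}
    (hx : x ⬝ᵥ x = 0) (hxC : x ∉ C) : IsSelfDual (neighborCode C x) := by
  refine isSelfDual_of_forall ?_ ?_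
  · intro y hy z hz
    obtain ⟨y, hy', hyx, s, rfl⟩ := mem_neighborCode.1 hy
    obtain ⟨z, hz', hzx, t, rfl⟩ := mem_neighborCode.1 hz
    simp [add_dotProduct, dotProduct_add, hC.dotProduct_eq_zero hy' hz', hyx, hx,
      dotProduct_comm x z, hzx]
  · intro v hv
    rw [hC.mem_iff] at hxC
    push Not at hxC
    obtain ⟨c, hc, hxc⟩ := hxC
    have hcx : c ⬝ᵥ x ≠ 0 := by rwa [dotProduct_comm]
    set t := (v ⬝ᵥ c) / (c ⬝ᵥ x) with ht
    have hvx : v ⬝ᵥ x = 0 := hv x self_mem_neighborCode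
    refine mem_neighborCode.2 ⟨v - t • x, ?_, ?_, t, by simp⟩
    · rw [hC.mem_iff]
      intro y hy
      -- Every `y ∈ C` becomes orthogonal to `x` after subtracting a multiple of `c`.
      have h1 := hv (y - ((y ⬝ᵥ x) / (c ⬝ᵥ x)) • c) (mem_neighborCode_of_mem
        (Submodule.sub_mem _ hy (Submodule.smul_mem _ _ hc)) (by
          rw [sub_dotProduct, smul_dotProduct, smul_eq_mul, div_mul_cancel₀ _ hcx, sub_self]))
      rw [dotProduct_sub, dotProduct_smul, smul_eq_mul] at h1
      rw [sub_dotProduct, smul_dotProduct, smul_eq_mul, dotProduct_comm x y, ht]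
      rw [sub_eq_zero] at h1 ⊢
      rw [h1]
      ring
    · rw [sub_dotProduct, smul_dotProduct, hx, hvx]
      simp

/-- The dot product identifies the dual code, here `C` itself, with the annihilator of `C`. -/
theorem IsSelfDual.two_mul_finrank {C : Code F n} (hC : IsSelfDual C) :
    2 * Module.finrank F C = n := by
  have h1 : C.map (dotProductEquiv F (Fin n)).toLinearMap = C.dualAnnihilator := by
    ext f
    obtain ⟨x, rfl⟩ := (dotProductEquiv F (Fin n)).surjective f
    rw [Submodule.mem_dualAnnihilator, Submodule.mem_map_equiv, LinearEquiv.symm_apply_apply,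
      hC.mem_iff]
    rfl
  have h2 := Subspace.finrank_add_finrank_dualAnnihilator_eq C
  rw [← h1, LinearEquiv.finrank_map_eq, Module.finrank_fin_fun] at h2
  omega

theorem areNeighbors_neighborCode {C : Code F n} (hC : IsSelfDual C) {x : Fin n → F}
    (hx : x ⬝ᵥ x = 0) (hxC : x ∉ C) : AreNeighbors C (neighborCode C x) := by
  have hD := isSelfDual_neighborCode hC hx hxC
  have h1 : Module.finrank F (C ⊓ neighborCode C x : Code F n) + 1 = Module.finrank F C := by
    let f : C →ₗ[F] F :=
      { toFun := fun y => (y : Fin n → F) ⬝ᵥ x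
        map_add' := fun y z => add_dotProduct _ _ _
        map_smul' := fun t y => smul_dotProduct _ _ _ }
    have hf : f ≠ 0 := by
      intro h
      refine hxC (hC.mem_iff.2 fun y hy => ?_)
      rw [dotProduct_comm]
      exact congrArg (fun g : C →ₗ[F] F => g ⟨y, hy⟩) h
    -- The intersection is the kernel of a nonzero functional on `C`, because the neighbor is
    -- self-dual and contains `x`.
    have hker : f.ker.map C.subtype = C ⊓ neighborCode C x := by
      ext y
      constructor
      · rintro ⟨⟨y, hy⟩, hyx, rfl⟩
        exact ⟨hy, mem_neighborCode_of_mem hy hyx⟩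
      · rintro ⟨hy, hyD⟩
        exact ⟨⟨y, hy⟩, hD.dotProduct_eq_zero hyD self_mem_neighborCode, rfl⟩
    rw [← hker, Submodule.finrank_map_subtype_eq, ← LinearMap.finrank_range_add_finrank_ker f,
      LinearMap.range_eq_top.2 (LinearMap.surjective hf), finrank_top, Module.finrank_self, add_comm]
  have h2 := hC.two_mul_finrank
  have h3 := hD.two_mul_finrank
  exact ⟨hC, hD, h1, by omega⟩

end Field

/-! ### The Gray maps -/

theorem F2u.fst_dotProduct {n : ℕ} (x y : Fin n → F2u) :
    (x ⬝ᵥ y).fst = ∑ i, (x i).fst * (y i).fst := by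
  rw [dotProduct, TrivSqZeroExt.fst_sum]
  rfl

theorem F2u.snd_dotProduct {n : ℕ} (x y : Fin n → F2u) :
    (x ⬝ᵥ y).snd = ∑ i, ((x i).fst * (y i).snd + (x i).snd * (y i).fst) := by
  rw [dotProduct, TrivSqZeroExt.snd_sum]
  refine Finset.sum_congr rfl fun i _ => ?_
  rw [TrivSqZeroExt.snd_mul, smul_eq_mul, op_smul_eq_mul]

theorem F2.add_self (a : F2) : a + a = 0 := CharTwo.add_self_eq_zero a

theorem grayPhi_dotProduct {n : ℕ} (x y : Fin n → F2u) :
    grayPhi n x ⬝ᵥ grayPhi n y = (x ⬝ᵥ y).fst + (x ⬝ᵥ y).snd := by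
  rw [F2u.fst_dotProduct, F2u.snd_dotProduct, dotProduct, Fin.sum_univ_add, ← Finset.sum_add_distrib,
    ← Finset.sum_add_distrib]
  refine Finset.sum_congr rfl fun i _ => ?_
  simp only [grayPhi, LinearMap.coe_mk, AddHom.coe_mk, Fin.append_left, Fin.append_right]
  linear_combination F2.add_self ((x i).snd * (y i).snd)

/-- The inverse of the Gray map. -/
def grayPhiInv {n : ℕ} (y : Fin (n + n) → F2) (i : Fin n) : F2u :=
  TrivSqZeroExt.inl (y (Fin.castAdd n i) + y (Fin.natAdd n i)) +
    TrivSqZeroExt.inr (y (Fin.castAdd n i))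

theorem grayPhi_grayPhiInv {n : ℕ} (y : Fin (n + n) → F2) : grayPhi n (grayPhiInv y) = y := by
  funext i
  refine Fin.addCases (fun i => ?_) (fun i => ?_) i
  · simp only [grayPhi, LinearMap.coe_mk, AddHom.coe_mk, Fin.append_left, grayPhiInv,
      TrivSqZeroExt.snd_add, TrivSqZeroExt.snd_inl, TrivSqZeroExt.snd_inr, zero_add]
  · simp only [grayPhi, LinearMap.coe_mk, AddHom.coe_mk, Fin.append_right, grayPhiInv,
      TrivSqZeroExt.snd_add, TrivSqZeroExt.snd_inl, TrivSqZeroExt.snd_inr, zero_add,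
      TrivSqZeroExt.fst_add, TrivSqZeroExt.fst_inl, TrivSqZeroExt.fst_inr, add_zero]
    linear_combination F2.add_self (y (Fin.castAdd n i))

theorem mem_binaryImage {n : ℕ} {C : Code F2u n} {y : Fin (n + n) → F2} :
    y ∈ binaryImage C ↔ ∃ v ∈ C, grayPhi n v = y := by
  simp [binaryImage, Submodule.mem_map]

/-- Binary orthogonality only kills the sum of the two components of `⟨x, w⟩`. Testing against `u w`
as well isolates the first component, so both vanish. -/
theorem isSelfDual_binaryImage {n : ℕ} {C : Code F2u n} (hC : IsSelfDual C) :
    IsSelfDual (binaryImage C) := by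
  refine isSelfDual_of_forall ?_ ?_
  · intro x hx y hy
    obtain ⟨v, hv, rfl⟩ := mem_binaryImage.1 hx
    obtain ⟨w, hw, rfl⟩ := mem_binaryImage.1 hy
    rw [grayPhi_dotProduct, hC.dotProduct_eq_zero hv hw]
    simp
  · intro x hx
    refine mem_binaryImage.2 ⟨grayPhiInv x, ?_, grayPhi_grayPhiInv x⟩
    rw [← grayPhi_grayPhiInv x] at hx
    rw [hC.mem_iff]
    intro w hw
    have h1 := hx _ (mem_binaryImage.2 ⟨w, hw, rfl⟩)
    have h2 := hx _ (mem_binaryImage.2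
      ⟨(TrivSqZeroExt.inr 1 : F2u) • w, Submodule.smul_mem _ _ hw, rfl⟩)
    rw [grayPhi_dotProduct] at h1 h2
    rw [dotProduct_smul] at h2
    have h3 : (grayPhiInv x ⬝ᵥ w).fst = 0 := by simpa using h2
    refine TrivSqZeroExt.ext h3 ?_
    rw [h3, zero_add] at h1
    exact h1

theorem F4u.im_dotProduct {n : ℕ} (x y : Fin n → F4u) :
    (x ⬝ᵥ y).im = ∑ i, (x i * y i).im := by
  let f : F4u →+ F2u := ⟨⟨fun z => z.im, rfl⟩, fun _ _ => rfl⟩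
  exact map_sum f (fun i => x i * y i) Finset.univ

theorem F2u.add_self (a : F2u) : a + a = 0 :=
  TrivSqZeroExt.ext (F2.add_self _) (F2.add_self _)

/-- In `(r + s)(r' + s') + r r'` the term `r r'` cancels, leaving the coefficient of `ω` in `(r +
sω)(r' + s'ω)`. -/
theorem grayPsi_dotProduct {n : ℕ} (x y : Fin n → F4u) :
    grayPsi n x ⬝ᵥ grayPsi n y = (x ⬝ᵥ y).im := by
  rw [F4u.im_dotProduct, dotProduct, Fin.sum_univ_add, ← Finset.sum_add_distrib]
  refine Finset.sum_congr rfl fun i _ => ?_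
  simp only [grayPsi, LinearMap.coe_mk, AddHom.coe_mk, Fin.append_left, Fin.append_right,
    QuadraticAlgebra.im_mul]
  linear_combination F2u.add_self ((x i).re * (y i).re)

/-- The inverse of the Gray map. -/
def grayPsiInv {n : ℕ} (y : Fin (n + n) → F2u) (i : Fin n) : F4u :=
  ⟨y (Fin.natAdd n i), y (Fin.castAdd n i) + y (Fin.natAdd n i)⟩

theorem grayPsi_grayPsiInv {n : ℕ} (y : Fin (n + n) → F2u) : grayPsi n (grayPsiInv y) = y := by
  funext i
  refine Fin.addCases (fun i => ?_) (fun i => ?_) i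
  · simp only [grayPsi, LinearMap.coe_mk, AddHom.coe_mk, Fin.append_left, grayPsiInv]
    linear_combination F2u.add_self (y (Fin.natAdd n i))
  · simp only [grayPsi, LinearMap.coe_mk, AddHom.coe_mk, Fin.append_right, grayPsiInv]

theorem mem_psiImage {n : ℕ} {C : Code F4u n} {y : Fin (n + n) → F2u} :
    y ∈ psiImage C ↔ ∃ v ∈ C, grayPsi n v = y := by
  simp [psiImage, Submodule.mem_map]

theorem isSelfDual_psiImage {n : ℕ} {C : Code F4u n} (hC : IsSelfDual C) :
    IsSelfDual (psiImage C) := by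
  refine isSelfDual_of_forall ?_ ?_
  · intro x hx y hy
    obtain ⟨v, hv, rfl⟩ := mem_psiImage.1 hx
    obtain ⟨w, hw, rfl⟩ := mem_psiImage.1 hy
    rw [grayPsi_dotProduct, hC.dotProduct_eq_zero hv hw]
    rfl
  · intro x hx
    refine mem_psiImage.2 ⟨grayPsiInv x, ?_, grayPsi_grayPsiInv x⟩
    rw [← grayPsi_grayPsiInv x] at hx
    rw [hC.mem_iff]
    intro w hw
    have h1 := hx _ (mem_psiImage.2 ⟨w, hw, rfl⟩)
    -- Testing against `ω w` gives `re + im` of the inner product, so both parts vanish.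
    have h2 := hx _ (mem_psiImage.2
      ⟨(⟨0, 1⟩ : F4u) • w, Submodule.smul_mem _ _ hw, rfl⟩)
    rw [grayPsi_dotProduct] at h1 h2
    rw [dotProduct_smul, smul_eq_mul, QuadraticAlgebra.im_mul] at h2
    refine QuadraticAlgebra.ext ?_ h1
    rw [h1] at h2
    simpa using h2

/-! ### The MacWilliams identities -/

/-- The nontrivial character of the binary field. -/
def chi (a : F2) : ℤ := if a = 0 then 1 else -1

theorem chi_add (a b : F2) : chi (a + b) = chi a * chi b := by
  revert a b; decide

theorem chi_sum {ι : Type} (s : Finset ι) (f : ι → F2) :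
    chi (∑ i ∈ s, f i) = ∏ i ∈ s, chi (f i) := by
  classical
  induction s using Finset.induction_on with
  | empty => simp [chi]
  | insert i s hi ih => rw [Finset.sum_insert hi, Finset.prod_insert hi, chi_add, ih]

/-- The value at `w` of the Krawtchouk polynomial of degree `k` for the length `n`. -/
noncomputable def krawtchouk (n k w : ℕ) : ℤ :=
  ((1 - X : ℤ[X]) ^ w * (1 + X) ^ (n - w)).coeff k

theorem F2.sum_univ {A : Type*} [AddCommMonoid A] (f : F2 → A) : ∑ a, f a = f 0 + f 1 :=
  Fin.sum_univ_two f

/-- The generating function in the weight of `y` factors over the coordinates, with the factor `1 -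
X` where `x` is nonzero and `1 + X` elsewhere. -/
theorem sum_chi_dotProduct {n : ℕ} (x : Fin n → F2) (k : ℕ) :
    ∑ y : Fin n → F2, (if hammingNorm y = k then chi (x ⬝ᵥ y) else 0) =
      krawtchouk n k (hammingNorm x) := by
  have h1 : ∑ y : Fin n → F2, (C (chi (x ⬝ᵥ y)) * X ^ hammingNorm y : ℤ[X]) =
      (1 - X) ^ hammingNorm x * (1 + X) ^ (n - hammingNorm x) := by
    have h2 : ∀ y : Fin n → F2, (C (chi (x ⬝ᵥ y)) * X ^ hammingNorm y : ℤ[X]) =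
        ∏ i, (C (chi (x i * y i)) * if y i ≠ 0 then X else 1) := by
      intro y
      rw [dotProduct, chi_sum, map_prod, Finset.prod_mul_distrib, hammingNorm,
        Finset.prod_ite, Finset.prod_const, Finset.prod_const_one, mul_one]
    have h3 : ∀ i, ∑ a : F2, (C (chi (x i * a)) * if a ≠ 0 then X else 1 : ℤ[X]) =
        if x i ≠ 0 then 1 - X else 1 + X := by
      intro i
      rw [F2.sum_univ]
      rcases F2.eq_zero_or_one (x i) with h | h <;> rw [h] <;>
        simp [chi, sub_eq_add_neg]
    simp_rw [h2]
    have h4 := Finset.prod_univ_sum (fun _ : Fin n => (Finset.univ : Finset F2))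
      (fun i a => (C (chi (x i * a)) * if a ≠ 0 then X else 1 : ℤ[X]))
    rw [Fintype.piFinset_univ] at h4
    rw [← h4]
    simp_rw [h3]
    rw [Finset.prod_ite, Finset.prod_const, Finset.prod_const]
    congr 2
    have := Finset.card_filter_add_card_filter_not (s := (Finset.univ : Finset (Fin n)))
      (p := fun i => x i ≠ 0)
    rw [Finset.card_univ, Fintype.card_fin] at this
    rw [hammingNorm]
    omega
  rw [krawtchouk, ← h1, finsetSum_coeff]
  refine Finset.sum_congr rfl fun y _ => ?_
  rw [coeff_C_mul, coeff_X_pow]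
  by_cases h : hammingNorm y = k
  · simp [h]
  · simp [h, Ne.symm h]

-- Translating by a word on which the character is `-1` changes the sign of the sum.
open Classical in
theorem sum_chi_linearMap {n : ℕ} (C : Code F2 n) (f : C →ₗ[F2] F2) :
    ∑ c : C, chi (f c) = if f = 0 then (Nat.card C : ℤ) else 0 := by
  split_ifs with h
  · simp [h, chi]
  · obtain ⟨c₀, hc₀⟩ : ∃ c, f c ≠ 0 := by
      by_contra h'
      push Not at h'
      exact h (LinearMap.ext h')
    have h1 : ∑ c : C, chi (f c) = ∑ c : C, chi (f (c + c₀)) :=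
      (Equiv.sum_comp (Equiv.addRight c₀) fun c => chi (f c)).symm
    have h2 : chi (f c₀) = -1 := by simp [chi, hc₀]
    simp only [map_add, chi_add, h2, mul_neg, mul_one, Finset.sum_neg_distrib] at h1
    omega

-- Expanding the Krawtchouk value as a character sum and exchanging the sums leaves, for each `y`,
-- the sum of the character `f + ⟨·, y⟩` over `C`, which vanishes unless the functional does. The
-- case `f = 0` concerns the dual code, and `f` the half weight concerns the shadow.
open Classical in
theorem macWilliams {n : ℕ} (C : Code F2 n) (f : C →ₗ[F2] F2) (k : ℕ) :
    ∑ c : C, chi (f c) * krawtchouk n k (hammingNorm (c : Fin n → F2)) =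
      Nat.card C * (Finset.univ.filter fun y : Fin n → F2 =>
        (∀ c : C, f c = (c : Fin n → F2) ⬝ᵥ y) ∧ hammingNorm y = k).card := by
  simp_rw [← sum_chi_dotProduct, Finset.mul_sum]
  rw [Finset.sum_comm, Finset.card_filter]
  push_cast
  rw [Finset.mul_sum]
  refine Finset.sum_congr rfl fun y _ => ?_
  by_cases h : hammingNorm y = k
  · simp only [h, if_true, and_true]
    let g : C →ₗ[F2] F2 :=
      { toFun := fun c => (c : Fin n → F2) ⬝ᵥ y
        map_add' := fun a b => add_dotProduct _ _ _
        map_smul' := fun t a => smul_dotProduct _ _ _ }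
    have h1 := sum_chi_linearMap C (f + g)
    have h2 : f + g = 0 ↔ ∀ c : C, f c = (c : Fin n → F2) ⬝ᵥ y := by
      rw [LinearMap.ext_iff]
      refine forall_congr' fun c => ?_
      change f c + (c : Fin n → F2) ⬝ᵥ y = 0 ↔ _
      rw [CharTwo.add_eq_zero]
    simp only [h2] at h1
    rw [mul_ite, mul_one, mul_zero, ← h1]
    exact Finset.sum_congr rfl fun c _ => (chi_add _ _).symm
  · simp [h]

/-! ### Weights in self-dual binary codes -/

theorem hammingNorm_add {n : ℕ} (a b : Fin n → F2) :
    hammingNorm (a + b) + 2 * (Finset.univ.filter fun i => a i * b i ≠ 0).card =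
      hammingNorm a + hammingNorm b := by
  simp only [hammingNorm, Finset.card_filter, Finset.mul_sum, ← Finset.sum_add_distrib]
  refine Finset.sum_congr rfl fun i _ => ?_
  have : ∀ s t : F2, (if s + t ≠ 0 then 1 else 0) + 2 * (if s * t ≠ 0 then 1 else 0) =
      (if s ≠ 0 then 1 else 0) + (if t ≠ 0 then 1 else 0) := by decide
  exact this (a i) (b i)

theorem natCast_card_filter {n : ℕ} (a : Fin n → F2) :
    (((Finset.univ.filter fun i => a i ≠ 0).card : ℕ) : F2) = ∑ i, a i := by
  rw [Finset.card_filter]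
  push_cast
  refine Finset.sum_congr rfl fun i _ => ?_
  rcases F2.eq_zero_or_one (a i) with h | h <;> simp [h]

theorem IsSelfDual.even_card {n : ℕ} {C : Code F2 n} (hC : IsSelfDual C) {a b : Fin n → F2}
    (ha : a ∈ C) (hb : b ∈ C) : Even (Finset.univ.filter fun i => a i * b i ≠ 0).card := by
  rw [even_iff_two_dvd, ← ZMod.natCast_eq_zero_iff, natCast_card_filter fun i => a i * b i]
  exact hC.dotProduct_eq_zero ha hb

theorem IsSelfDual.even_hammingNorm {n : ℕ} {C : Code F2 n} (hC : IsSelfDual C) {a : Fin n → F2}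
    (ha : a ∈ C) : Even (hammingNorm a) := by
  have := hC.even_card ha ha
  simpa [hammingNorm] using this

/-- Half the weight modulo two, a linear functional on a self-dual binary code. -/
def IsSelfDual.halfWeight {n : ℕ} {C : Code F2 n} (hC : IsSelfDual C) : C →ₗ[F2] F2 where
  toFun c := ((hammingNorm (c : Fin n → F2) / 2 : ℕ) : F2)
  -- Half weights add up to `|a ∩ b|`, which is even because `⟨a, b⟩ = 0`.
  map_add' a b := by
    have h1 := hammingNorm_add (a : Fin n → F2) b
    obtain ⟨i, hi⟩ := hC.even_card a.2 b.2
    obtain ⟨j, hj⟩ := hC.even_hammingNorm a.2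
    obtain ⟨k, hk⟩ := hC.even_hammingNorm b.2
    have : hammingNorm ((a + b : C) : Fin n → F2) / 2 + 2 * i =
        hammingNorm (a : Fin n → F2) / 2 + hammingNorm (b : Fin n → F2) / 2 := by
      rw [Submodule.coe_add]
      omega
    have := congrArg (Nat.cast : ℕ → F2) this
    push_cast at this
    rw [show (2 : F2) = 0 from rfl, zero_mul, add_zero] at this
    exact this
  map_smul' t a := by
    rcases F2.eq_zero_or_one t with h | h <;> simp [h]

theorem IsSelfDual.ones_mem {n : ℕ} {C : Code F2 n} (hC : IsSelfDual C) :
    (fun _ => 1 : Fin n → F2) ∈ C := by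
  rw [hC.mem_iff]
  intro y hy
  have h1 := hC.dotProduct_eq_zero hy hy
  rw [dotProduct] at h1 ⊢
  rw [← h1]
  refine Finset.sum_congr rfl fun i _ => ?_
  have : ∀ t : F2, 1 * t = t * t := by decide
  exact this (y i)

open Classical in
/-- The number of codewords of weight `w`. -/
noncomputable def weightCount {n : ℕ} (C : Code F2 n) (w : ℕ) : ℕ :=
  (Finset.univ.filter fun x : Fin n → F2 => x ∈ C ∧ hammingNorm x = w).card

/-- Adding the all-one word is a bijection of `C` that complements supports. -/
theorem IsSelfDual.weightCount_sub {n : ℕ} {C : Code F2 n} (hC : IsSelfDual C) {w : ℕ}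
    (hw : w ≤ n) : weightCount C (n - w) = weightCount C w := by
  have h1 : ∀ x : Fin n → F2, hammingNorm (x + fun _ => 1) + hammingNorm x = n := by
    intro x
    simp only [hammingNorm, Finset.card_filter, ← Finset.sum_add_distrib, Pi.add_apply]
    have : ∀ t : F2, (if t + 1 ≠ 0 then 1 else 0) + (if t ≠ 0 then 1 else 0) = 1 := by decide
    rw [Finset.sum_congr rfl fun i _ => this (x i)]
    simp
  have h2 : ∀ x : Fin n → F2, x + (fun _ => 1) + (fun _ => 1) = x := fun x => by
    rw [add_assoc]
    refine add_eq_left.2 (funext fun i => F2.add_self _)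
  refine Finset.card_bij (fun x _ => x + fun _ => 1) ?_ (fun _ _ _ _ h => add_right_cancel h) ?_
  · intro x hx
    simp only [Finset.mem_filter, Finset.mem_univ, true_and] at hx ⊢
    refine ⟨Submodule.add_mem _ hx.1 hC.ones_mem, ?_⟩
    have := h1 x
    omega
  · intro x hx
    simp only [Finset.mem_filter, Finset.mem_univ, true_and] at hx
    refine ⟨x + fun _ => 1, ?_, h2 x⟩
    simp only [Finset.mem_filter, Finset.mem_univ, true_and]
    refine ⟨Submodule.add_mem _ hx.1 hC.ones_mem, ?_⟩
    have := h1 x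
    omega

theorem IsSelfDual.weightCount_odd {n : ℕ} {C : Code F2 n} (hC : IsSelfDual C) {w : ℕ}
    (hw : ¬ Even w) : weightCount C w = 0 := by
  classical
  rw [weightCount, Finset.card_eq_zero, Finset.filter_eq_empty_iff]
  rintro x - ⟨hx, rfl⟩
  exact hw (hC.even_hammingNorm hx)

-- The values lie in a general ring so that one statement covers the Krawtchouk sums over `ℤ` and
-- the weight enumerator over `ℤ[X]`.
open Classical in
theorem sum_code_eq {n : ℕ} {A : Type} [CommRing A] (C : Code F2 n) (F : ℕ → A) :
    ∑ c : C, F (hammingNorm (c : Fin n → F2)) =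
      ∑ w ∈ Finset.range (n + 1), (weightCount C w : A) * F w := by
  have h1 : ∑ c : C, F (hammingNorm (c : Fin n → F2)) =
      ∑ x ∈ Finset.univ.filter (fun x : Fin n → F2 => x ∈ C), F (hammingNorm x) :=
    (Finset.sum_subtype _ (fun x => by simp) fun x => F (hammingNorm x)).symm
  rw [h1, ← Finset.sum_fiberwise_of_maps_to (t := Finset.range (n + 1))
    (g := fun x : Fin n → F2 => hammingNorm x)]
  · refine Finset.sum_congr rfl fun w _ => ?_
    rw [Finset.filter_filter, Finset.sum_congr rfl (g := fun _ => F w), Finset.sum_const,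
      nsmul_eq_mul, weightCount]
    intro x hx
    rw [(Finset.mem_filter.1 hx).2.2]
  · intro x _
    rw [Finset.mem_range, Nat.lt_succ_iff]
    exact hammingNorm_le_card_fintype.trans_eq (Fintype.card_fin n)

theorem weightEnumerator_eq {n : ℕ} (D : Code F2 n) :
    weightEnumerator D = ∑ w ∈ Finset.range (n + 1), C (weightCount D w : ℤ) * X ^ w := by
  classical
  have h := sum_code_eq D fun w => (X ^ w : ℤ[X])
  rw [weightEnumerator, ← Finset.sum_filter]
  refine Eq.trans ?_ (h.trans ?_)
  · rw [Finset.sum_subtype]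
    intro x
    simp
  · simp

/-! ### The twelve linear equations in length 68 -/

theorem krawtchouk_eq_sum (n k w : ℕ) : krawtchouk n k w =
    ∑ j ∈ Finset.range (k + 1), (-1) ^ j * (w.choose j : ℤ) * ((n - w).choose (k - j) : ℤ) := by
  have h : ∀ j, ((1 - X : ℤ[X]) ^ w).coeff j = (-1) ^ j * (w.choose j : ℤ) := by
    intro j
    have : (1 - X : ℤ[X]) ^ w = ((1 + X) ^ w).comp (C (-1) * X) := by
      simp [sub_eq_add_neg]
    rw [this, comp_C_mul_X_coeff, coeff_one_add_X_pow, mul_comm]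
  rw [krawtchouk, coeff_mul, Finset.Nat.sum_antidiagonal_eq_sum_range_succ
    (fun i j => ((1 - X : ℤ[X]) ^ w).coeff i * ((1 + X : ℤ[X]) ^ (n - w)).coeff j)]
  refine Finset.sum_congr rfl fun j _ => ?_
  rw [h, coeff_one_add_X_pow]

theorem IsSelfDual.natCard {n : ℕ} {C : Code F2 n} (hC : IsSelfDual C) {m : ℕ} (hn : n = 2 * m) :
    Nat.card C = 2 ^ m := by
  have h := hC.two_mul_finrank
  have : Module.finrank F2 C = m := by omega
  rw [Module.natCard_eq_pow_finrank (K := F2), this, Nat.card_zmod]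

/-- The MacWilliams identity for a self-dual code. -/
theorem IsSelfDual.sum_weightCount_mul_krawtchouk {n : ℕ} {C : Code F2 n} (hC : IsSelfDual C)
    (k : ℕ) : ∑ w ∈ Finset.range (n + 1), (weightCount C w : ℤ) * krawtchouk n k w =
      Nat.card C * weightCount C k := by
  classical
  rw [← sum_code_eq C (krawtchouk n k)]
  have h := macWilliams C 0 k
  rw [weightCount]
  refine Eq.trans (Finset.sum_congr rfl fun c _ => ?_) (h.trans ?_)
  · simp [chi]
  · congr 3
    ext y
    rw [Finset.mem_filter, Finset.mem_filter, hC.mem_iff]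
    refine and_congr_right fun _ => and_congr_left fun _ => ?_
    constructor
    · intro h c hc
      rw [dotProduct_comm]
      exact (h ⟨c, hc⟩).symm
    · intro h c
      rw [LinearMap.zero_apply, dotProduct_comm, h c c.2]

open Classical in
/-- The vectors of weight `k` in the shadow of a self-dual code. -/
noncomputable def IsSelfDual.shadowCount {n : ℕ} {C : Code F2 n} (hC : IsSelfDual C) (k : ℕ) : ℕ :=
  (Finset.univ.filter fun y : Fin n → F2 =>
    (∀ c : C, hC.halfWeight c = (c : Fin n → F2) ⬝ᵥ y) ∧ hammingNorm y = k).card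

theorem IsSelfDual.sum_weightCount_mul_chi_mul_krawtchouk {n : ℕ} {C : Code F2 n}
    (hC : IsSelfDual C) (k : ℕ) :
    ∑ w ∈ Finset.range (n + 1), (weightCount C w : ℤ) * (chi (w / 2 : ℕ) * krawtchouk n k w) =
      Nat.card C * hC.shadowCount k := by
  classical
  rw [← sum_code_eq C fun w => chi (w / 2 : ℕ) * krawtchouk n k w]
  exact macWilliams C hC.halfWeight k

theorem chi_natCast (m : ℕ) : chi m = (-1) ^ m := by
  rcases Nat.even_or_odd m with h | h
  · rw [h.neg_one_pow, chi, if_pos]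
    rwa [ZMod.natCast_eq_zero_iff, ← even_iff_two_dvd]
  · rw [h.neg_one_pow, chi, if_neg]
    rwa [ZMod.natCast_eq_zero_iff, ← even_iff_two_dvd, Nat.not_even_iff_odd]

/-- The weight distribution of a self-dual code of length `68` and minimum distance at least `12`,
in terms of the numbers of codewords of weights `12, 14, …, 34`. -/
def weightList (a : ℕ → ℤ) : List ℤ :=
  [1, 0, 0, 0, 0, 0, 0, 0, 0, 0, 0, 0, a 12, 0, a 14, 0, a 16, 0, a 18, 0, a 20, 0, a 22, 0, a 24, 0, a 26, 0, a 28, 0, a 30, 0, a 32, 0, a 34, 0, a 32, 0, a 30, 0, a 28, 0, a 26, 0, a 24, 0, a 22, 0, a 20, 0, a 18, 0, a 16, 0, a 14, 0, a 12, 0, 0, 0, 0, 0, 0, 0, 0, 0, 0, 0, 1]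

set_option maxRecDepth 10000 in
theorem IsSelfDual.weightCount_eq_getD {C : Code F2 68} (hC : IsSelfDual C)
    (h0 : weightCount C 0 = 1) (h : ∀ w ∈ Finset.Ioo 0 11, weightCount C w = 0) :
    ∀ w ∈ Finset.range 69,
      (weightCount C w : ℤ) = (weightList fun v => (weightCount C v : ℤ)).getD w 0 := by
  have e : ∀ w, ¬ Even w → (weightCount C w : ℤ) = 0 := fun w hw => by
    rw [hC.weightCount_odd hw, Nat.cast_zero]
  have e' : ∀ w ∈ Finset.range 35, ∀ t : ℤ, (weightCount C w : ℤ) = t →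
      (weightCount C (68 - w) : ℤ) = t := fun w hw t ht => by
    rw [hC.weightCount_sub (by have := Finset.mem_range.1 hw; omega), ht]
  have h1 : ∀ w ∈ Finset.range 35,
      (weightCount C w : ℤ) = (weightList fun v => (weightCount C v : ℤ)).getD w 0 := by
    intro w hw
    rw [Finset.mem_range] at hw
    by_cases hev : Even w
    · rcases Nat.lt_or_ge w 11 with h11 | h11
      · rcases Nat.eq_zero_or_pos w with rfl | hpos
        · rw [h0]; rfl
        · rw [h w (Finset.mem_Ioo.2 ⟨hpos, h11⟩)]
          interval_cases w <;> rfl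
      · interval_cases w <;> first | rfl | exact absurd hev (by decide)
    · rw [e w hev]
      interval_cases w <;> first | rfl | exact absurd (by decide) hev
  intro w hw
  rw [Finset.mem_range] at hw
  rcases Nat.lt_or_ge w 35 with h35 | h35
  · exact h1 w (Finset.mem_range.2 h35)
  · have h2 := e' (68 - w) (Finset.mem_range.2 (by omega)) _ (h1 (68 - w) (Finset.mem_range.2 (by omega)))
    rw [show 68 - (68 - w) = w by omega] at h2
    rw [h2]
    clear h2 e' h1 e
    interval_cases w <;> rfl

/-- The values `K_{2k}(w)` for the length `68` and `w = 0, 12, 14, …, 34`. -/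
def krawtchoukTable : List (List ℤ) :=
  [[1, 1, 1, 1, 1, 1, 1, 1, 1, 1, 1, 1, 1],
    [2278, 934, 766, 614, 478, 358, 254, 166, 94, 38, -2, -26, -34],
    [814385, 124465, 80561, 48945, 27185, 13105, 4785, 561, -975, -975, -335, 305, 561],
    [109453344, 5492256, 2629536, 1080352, 333984, 37920, -36960, -27104, -2912, 8736, 6048, -2016, -5984],
    [7392009768, 101275944, 31200936, 5813288, -692952, -962520, -188760, 159016, 99112, -34008, -56664, 6696, 46376],
    [290752384208, 790964944, 87800336, -28088112, -14003952, 1016016, 2501136, 29392, -727792, -33072, 352784, 9424, -278256]]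

/-- Krawtchouk polynomials of even degree are symmetric under `w ↦ 68 - w`, so one table serves both
ends of the distribution. -/
theorem krawtchouk_eq_getD : ∀ k ∈ Finset.range 6, krawtchouk 68 (2 * k) 0 =
      (krawtchoukTable.getD k []).getD 0 0 ∧ krawtchouk 68 (2 * k) 68 =
      (krawtchoukTable.getD k []).getD 0 0 ∧ ∀ i ∈ Finset.range 12,
      krawtchouk 68 (2 * k) (12 + 2 * i) = (krawtchoukTable.getD k []).getD (i + 1) 0 ∧
      krawtchouk 68 (2 * k) (56 - 2 * i) = (krawtchoukTable.getD k []).getD (i + 1) 0 := by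
  simp only [krawtchouk_eq_sum]
  decide +kernel

theorem sum_weightList (a F : ℕ → ℤ) (l : ℕ → ℤ) (h0 : F 0 = l 0) (h68 : F 68 = l 0)
    (h : ∀ i ∈ Finset.range 12, F (12 + 2 * i) = l (i + 1) ∧
      F (56 - 2 * i) = l (i + 1)) :
    ∑ w ∈ Finset.range 69, (weightList a).getD w 0 * F w =
      2 * l 0 + 2 * ∑ i ∈ Finset.range 11, a (12 + 2 * i) * l (i + 1) +
        a 34 * l 12 := by
  simp only [Finset.mem_range] at h
  have e := fun i hi => (h i hi).1
  have e' := fun i hi => (h i hi).2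
  simp only [weightList, Finset.sum_range_succ, Finset.sum_range_zero, List.getD_cons_zero,
    List.getD_cons_succ, zero_mul, zero_add, add_zero, one_mul]
  rw [h0, h68, e 0 (by decide), e 1 (by decide), e 2 (by decide), e 3 (by decide), e 4 (by decide), e 5 (by decide), e 6 (by decide), e 7 (by decide), e 8 (by decide), e 9 (by decide), e 10 (by decide), e 11 (by decide),
    e' 0 (by decide), e' 1 (by decide), e' 2 (by decide), e' 3 (by decide), e' 4 (by decide), e' 5 (by decide), e' 6 (by decide), e' 7 (by decide), e' 8 (by decide), e' 9 (by decide), e' 10 (by decide)]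
  ring

/-- The sign `(-1)^(w/2)` tells `w ≡ 0` from `w ≡ 2` modulo 4. Sums of corresponding equations
therefore involve only `a 12, a 16, …, a 32`, and differences only `a 14, a 18, …, a 34`: two
systems of size 6. The form `b - 14 * g` of the tenth shadow number makes `a 12` independent of `g`.
-/
theorem weightList_solve (a : ℕ → ℤ) (b g : ℤ)
    (h : ∀ k ∈ Finset.range 6, ∑ w ∈ Finset.range 69, (weightList a).getD w 0 *
      krawtchouk 68 (2 * k) w = 2 ^ 34 * if k = 0 then 1 else 0)
    (h' : ∀ k ∈ Finset.range 6, ∑ w ∈ Finset.range 69, (weightList a).getD w 0 *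
      (chi (w / 2 : ℕ) * krawtchouk 68 (2 * k) w) =
        2 ^ 34 * if k = 3 then g else if k = 5 then b - 14 * g else 0) :
    a 12 = 442 + 4 * b ∧
    a 14 = 14960 - 8 * b - 256 * g ∧
    a 16 = 174471 - 36 * b + 2048 * g ∧
    a 18 = 1478048 + 80 * b - 5632 * g ∧
    a 20 = 9546537 + 140 * b + 2048 * g ∧
    a 22 = 46699952 - 360 * b + 21248 * g ∧
    a 24 = 175078410 - 300 * b - 40960 * g ∧
    a 26 = 509477760 + 960 * b - 2048 * g ∧
    a 28 = 1160564636 + 360 * b + 90112 * g ∧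
    a 30 = 2081169376 - 1680 * b - 86528 * g ∧
    a 32 = 2949602799 - 168 * b - 53248 * g ∧
    a 34 = 3312254400 + 2016 * b + 146432 * g := by
  have e : ∀ k ∈ Finset.range 6,
      2 * (krawtchoukTable.getD k []).getD 0 0 + 2 * ∑ i ∈ Finset.range 11, a (12 + 2 * i) *
        (krawtchoukTable.getD k []).getD (i + 1) 0 + a 34 * (krawtchoukTable.getD k []).getD 12 0 =
      2 ^ 34 * if k = 0 then 1 else 0 := fun k hk => by
    obtain ⟨t0, t68, t⟩ := krawtchouk_eq_getD k hk
    rw [← h k hk, sum_weightList a _ (fun i => (krawtchoukTable.getD k []).getD i 0) t0 t68 t]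
  have e' : ∀ k ∈ Finset.range 6,
      2 * (krawtchoukTable.getD k []).getD 0 0 + 2 * ∑ i ∈ Finset.range 11, a (12 + 2 * i) *
        ((-1) ^ i * (krawtchoukTable.getD k []).getD (i + 1) 0) +
        a 34 * -(krawtchoukTable.getD k []).getD 12 0 =
      2 ^ 34 * if k = 3 then g else if k = 5 then b - 14 * g else 0 := fun k hk => by
    obtain ⟨t0, t68, t⟩ := krawtchouk_eq_getD k hk
    -- At index 0 the truncated exponent gives the sign `+1` of the weights 0 and 68. At index `i +
    -- 1` the sign is that of the weights `12 + 2i` and `56 - 2i`.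
    rw [← h' k hk, sum_weightList a _ 
      (fun i => (-1) ^ (i - 1) * (krawtchoukTable.getD k []).getD i 0)]
    · simp
    · simp [t0, chi]
    · rw [t68, chi_natCast]
      simp
    · intro i hi
      have hi' := Finset.mem_range.1 hi
      obtain ⟨t1, t2⟩ := t i hi
      have h1 : (12 + 2 * i) / 2 = i + 2 * 3 := by omega
      have h2 : (56 - 2 * i) / 2 = i + 2 * (14 - i) := by omega
      rw [t1, t2, chi_natCast, chi_natCast, h1, h2, pow_add, pow_add, pow_mul (-1) 2, pow_mul (-1) 2]
      simp
  clear h h'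
  simp only [Finset.mem_range] at e e'
  have e0 := e 0 (by decide)
  have e0' := e' 0 (by decide)
  have e1 := e 1 (by decide)
  have e1' := e' 1 (by decide)
  have e2 := e 2 (by decide)
  have e2' := e' 2 (by decide)
  have e3 := e 3 (by decide)
  have e3' := e' 3 (by decide)
  have e4 := e 4 (by decide)
  have e4' := e' 4 (by decide)
  have e5 := e 5 (by decide)
  have e5' := e' 5 (by decide)
  clear e e'
  simp only [krawtchoukTable, Finset.sum_range_succ, Finset.sum_range_zero, List.getD_cons_zero,
    List.getD_cons_succ, Nat.reduceMul, Nat.reduceAdd] at e0 e0' e1 e1' e2 e2' e3 e3' e4 e4' e5 e5'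
  simp only [reduceIte, Nat.reduceEqDiff] at e0 e0' e1 e1' e2 e2' e3 e3' e4 e4' e5 e5'
  refine ⟨?_, ?_, ?_, ?_, ?_, ?_, ?_, ?_, ?_, ?_, ?_, ?_⟩
  -- The multipliers in each combination are a row of the inverse of the relevant block of size 6,
  -- scaled to integers. The cancelled constant is the resulting power of two in front of the
  -- unknown.
  · refine mul_left_cancel₀ (show (4294967296 : ℤ) ≠ 0 by decide) ?_
    linear_combination 182 * (e0 + e0') + 104 * (e1 + e1') + 26 * (e2 + e2') + 14 * (e3 + e3') + 2 * (e4 + e4') + 1 * (e5 + e5')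
  · refine mul_left_cancel₀ (show (2147483648 : ℤ) ≠ 0 by decide) ?_
    linear_combination 1870 * (e0 - e0') + 616 * (e1 - e1') + 194 * (e2 - e2') + 46 * (e3 - e3') + 10 * (e4 - e4') + 1 * (e5 - e5')
  · refine mul_left_cancel₀ (show (4294967296 : ℤ) ≠ 0 by decide) ?_
    linear_combination 43098 * (e0 + e0') + 11352 * (e1 + e1') + 2646 * (e2 + e2') + 386 * (e3 + e3') + 46 * (e4 + e4') + (-9) * (e5 + e5')
  · refine mul_left_cancel₀ (show (1073741824 : ℤ) ≠ 0 by decide) ?_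
    linear_combination 92378 * (e0 - e0') + 19448 * (e1 - e1') + 3030 * (e2 - e2') + 282 * (e3 - e3') + (-18) * (e4 - e4') + (-5) * (e5 - e5')
  · refine mul_left_cancel₀ (show (4294967296 : ℤ) ≠ 0 by decide) ?_
    linear_combination 2388386 * (e0 + e0') + 376376 * (e1 + e1') + 38094 * (e2 + e2') + 1002 * (e3 + e3') + (-378) * (e4 + e4') + 35 * (e5 + e5')
  · refine mul_left_cancel₀ (show (2147483648 : ℤ) ≠ 0 by decide) ?_
    linear_combination 5837494 * (e0 - e0') + 650312 * (e1 - e1') + 34842 * (e2 - e2') + (-2026) * (e3 - e3') + (-62) * (e4 - e4') + 45 * (e5 - e5')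
  · refine mul_left_cancel₀ (show (4294967296 : ℤ) ≠ 0 by decide) ?_
    linear_combination 43766190 * (e0 + e0') + 3187080 * (e1 + e1') + 31074 * (e2 + e2') + (-11290) * (e3 + e3') + 1130 * (e4 + e4') + (-75) * (e5 + e5')
  · refine mul_left_cancel₀ (show (268435456 : ℤ) ≠ 0 by decide) ?_
    linear_combination 7960590 * (e0 - e0') + 328680 * (e1 - e1') + (-9726) * (e2 - e2') + (-178) * (e3 - e3') + 74 * (e4 - e4') + (-15) * (e5 - e5')
  · refine mul_left_cancel₀ (show (2147483648 : ℤ) ≠ 0 by decide) ?_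
    linear_combination 145072510 * (e0 + e0') + 2421320 * (e1 + e1') + (-174318) * (e2 + e2') + 11894 * (e3 + e3') + (-806) * (e4 + e4') + 45 * (e5 + e5')
  · refine mul_left_cancel₀ (show (1073741824 : ℤ) ≠ 0 by decide) ?_
    linear_combination 130073086 * (e0 - e0') + (-115544) * (e1 - e1') + (-52078) * (e2 - e2') + 6878 * (e3 - e3') + (-742) * (e4 - e4') + 105 * (e5 - e5')
  · refine mul_left_cancel₀ (show (2147483648 : ℤ) ≠ 0 by decide) ?_
    linear_combination 368699474 * (e0 + e0') + (-4208776) * (e1 + e1') + 138398 * (e2 + e2') + (-6950) * (e3 + e3') + 406 * (e4 + e4') + (-21) * (e5 + e5')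
  · refine mul_left_cancel₀ (show (536870912 : ℤ) ≠ 0 by decide) ?_
    linear_combination 103507950 * (e0 - e0') + (-1544088) * (e1 - e1') + 70434 * (e2 - e2') + (-5458) * (e3 - e3') + 490 * (e4 - e4') + (-63) * (e5 - e5')

/-! ### Weight enumerators of extremal self-dual codes of length `68` -/

/-- An extremal self-dual `[68, 34, 12]` code with weight enumerator `W_{68,2}(β, γ)`. -/
def IsExtremal68 (C : Code F2 68) (β γ : ℤ) : Prop :=
  IsExtremal C ∧ Module.finrank F2 C = 34 ∧ HasMinDist C 12 ∧ weightEnumerator C = W682 β γ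

theorem hasMinDist_of_weightCount {n d : ℕ} {C : Code F2 n} (hd : weightCount C d ≠ 0) (hd0 : d ≠ 0)
    (h : ∀ w ∈ Finset.Ioo 0 d, weightCount C w = 0) : HasMinDist C d := by
  classical
  constructor
  · obtain ⟨x, hx⟩ := Finset.card_ne_zero.1 hd
    simp only [Finset.mem_filter, Finset.mem_univ, true_and] at hx
    refine ⟨x, hx.1, ?_, hx.2⟩
    rintro rfl
    exact hd0 (hx.2.symm.trans hammingNorm_zero)
  · rintro w ⟨x, hx, hx0, rfl⟩
    by_contra hlt
    have := h (hammingNorm x) (Finset.mem_Ioo.2 ⟨hammingNorm_pos_iff.2 hx0, by omega⟩)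
    rw [weightCount, Finset.card_eq_zero, Finset.filter_eq_empty_iff] at this
    exact this (Finset.mem_univ x) ⟨hx, rfl⟩

/-- The counts of light words are the right-hand sides of `weightList_solve`. The bound `14 * γ ≤ β`
keeps the natural subtraction faithful, and weight 12 is attained because `442 + 4β` is positive. -/
theorem isExtremal68_of_counts {C : Code F2 68} (hC : IsSelfDual C) {β γ : ℕ} (hβ : 14 * γ ≤ β)
    (hA : ∀ q < 11, weightCount C q = [1, 0, 0, 0, 0, 0, 0, 0, 0, 0, 0].getD q 0)
    (hB : ∀ q < 11,
      hC.shadowCount q = [0, 0, 0, 0, 0, 0, γ, 0, 0, 0, β - 14 * γ].getD q 0) :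
    IsExtremal68 C β γ := by
  have h0 : weightCount C 0 = 1 := hA 0 (by decide)
  have hz : ∀ w ∈ Finset.Ioo 0 11, weightCount C w = 0 := by
    intro w hw
    rw [Finset.mem_Ioo] at hw
    rw [hA w hw.2]
    obtain ⟨h1, h2⟩ := hw
    interval_cases w <;> rfl
  have hw := hC.weightCount_eq_getD h0 hz
  have hcard : (Nat.card C : ℤ) = 2 ^ 34 := by
    rw [hC.natCard (m := 34) rfl]
    norm_num
  have hs := weightList_solve (fun v => (weightCount C v : ℤ)) β γ ?_ ?_
  rotate_left
  · intro k hk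
    have h1 := hC.sum_weightCount_mul_krawtchouk (2 * k)
    rw [Finset.sum_congr rfl fun w h => by rw [hw w h], hcard,
      hA _ (by have := Finset.mem_range.1 hk; omega)] at h1
    refine h1.trans ?_
    fin_cases hk <;> rfl
  · intro k hk
    have h1 := hC.sum_weightCount_mul_chi_mul_krawtchouk (2 * k)
    rw [Finset.sum_congr rfl fun w h => by rw [hw w h], hcard,
      hB _ (by have := Finset.mem_range.1 hk; omega)] at h1
    refine h1.trans ?_
    have : ((β - 14 * γ : ℕ) : ℤ) = β - 14 * γ := by push_cast [hβ]; rfl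
    rw [← this]
    fin_cases hk <;> rfl
  obtain ⟨s12, s14, s16, s18, s20, s22, s24, s26, s28, s30, s32, s34⟩ := hs
  have hmin : HasMinDist C 12 := by
    refine hasMinDist_of_weightCount (by omega) (by decide) fun w h => ?_
    rw [Finset.mem_Ioo] at h
    rcases eq_or_ne w 11 with rfl | hne
    · exact hC.weightCount_odd (by decide)
    · exact hz w (Finset.mem_Ioo.2 ⟨h.1, by omega⟩)
  refine ⟨⟨hC, hmin⟩, ?_, hmin, ?_⟩
  · have := hC.two_mul_finrank
    omega
  · rw [weightEnumerator_eq, Finset.sum_congr rfl fun w h => by rw [hw w h]]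
    simp only [weightList, s12, s14, s16, s18, s20, s22, s24, s26, s28, s30, s32, s34,
      Finset.sum_range_succ, Finset.sum_range_zero, List.getD_cons_zero, List.getD_cons_succ,
      map_zero, zero_mul, add_zero, zero_add, map_one, one_mul, pow_zero, W682]
    ring

/-! ### Counting light codewords with a systematic generator matrix -/

theorem dotProduct_systematic_eq {n m : ℕ} (e : Fin m ⊕ Fin m ≃ Fin n)
    (M : Matrix (Fin m) (Fin m) F2) (y : Fin n → F2) (i : Fin m) :
    y ⬝ᵥ systematic e M i = y (e (Sum.inl i)) + M.mulVec (fun j => y (e (Sum.inr j))) i :=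
  dotProduct_systematic e M y i

theorem systematic_inl {n m : ℕ} (e : Fin m ⊕ Fin m ≃ Fin n) (M : Matrix (Fin m) (Fin m) F2)
    (i j : Fin m) : systematic e M i (e (Sum.inl j)) = if i = j then 1 else 0 := by
  simp [systematic, Matrix.one_apply]

theorem systematic_inr {n m : ℕ} (e : Fin m ⊕ Fin m ≃ Fin n) (M : Matrix (Fin m) (Fin m) F2)
    (i j : Fin m) : systematic e M i (e (Sum.inr j)) = M i j := by
  simp [systematic]

/-- Orthogonality of the rows of `(I | M)` reads `I + M Mᵀ = 0`, so orthogonality of `M` needs no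
computation. -/
theorem IsSelfDual.mul_transpose_eq_one {n m : ℕ} {C : Code F2 n} (hC : IsSelfDual C)
    {e : Fin m ⊕ Fin m ≃ Fin n} {M : Matrix (Fin m) (Fin m) F2}
    (hM : ∀ i, systematic e M i ∈ C) : M * M.transpose = 1 := by
  ext i j
  have h := hC.dotProduct_eq_zero (hM j) (hM i)
  rw [dotProduct_systematic_eq, systematic_inl] at h
  simp only [systematic_inr] at h
  rw [Matrix.mul_apply, Matrix.one_apply]
  simp only [Matrix.transpose_apply]
  rw [Matrix.mulVec, dotProduct, CharTwo.add_eq_zero] at h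
  rw [← h]
  simp only [eq_comm]

theorem sum_smul_systematic {n m : ℕ} {e : Fin m ⊕ Fin m ≃ Fin n} {M : Matrix (Fin m) (Fin m) F2}
    (hM : M * M.transpose = 1) {y : Fin n → F2}
    (hy : (fun i => y (e (Sum.inl i))) = M.mulVec fun i => y (e (Sum.inr i))) :
    ∑ i, y (e (Sum.inl i)) • systematic e M i = y := by
  funext k
  rw [Finset.sum_apply]
  obtain ⟨s | s, rfl⟩ := e.surjective k
  · simp [systematic_inl]
  · simp only [Pi.smul_apply, smul_eq_mul, systematic_inr]
    have h : (fun i => y (e (Sum.inr i))) = M.transpose.mulVec fun i => y (e (Sum.inl i)) := by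
      rw [hy, Matrix.mulVec_mulVec, transpose_mul_self hM, Matrix.one_mulVec]
    rw [congrFun h s, Matrix.mulVec, dotProduct]
    exact Finset.sum_congr rfl fun i _ => mul_comm _ _

/-- The same rows serve as parity checks, giving necessity, and as generators, giving sufficiency.
Equality of `C` with their span follows without a dimension count. -/
theorem IsSelfDual.mem_iff_systematic {n m : ℕ} {C : Code F2 n} (hC : IsSelfDual C)
    {e : Fin m ⊕ Fin m ≃ Fin n} {M : Matrix (Fin m) (Fin m) F2}
    (hM : ∀ i, systematic e M i ∈ C) (y : Fin n → F2) :
    y ∈ C ↔ (fun i => y (e (Sum.inl i))) = M.mulVec fun i => y (e (Sum.inr i)) := by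
  constructor
  · intro hy
    funext i
    have h := hC.dotProduct_eq_zero hy (hM i)
    rwa [dotProduct_systematic_eq, CharTwo.add_eq_zero] at h
  · intro hy
    rw [← sum_smul_systematic (hC.mul_transpose_eq_one hM) hy]
    exact Submodule.sum_mem _ fun i _ => Submodule.smul_mem _ _ (hM i)

/-- Two functionals agree on `C` once they agree on the rows of `(I | M)`, and row `i` gives the
`i`th equation of the affine system. For the half weight this describes the shadow as a coset. -/
theorem IsSelfDual.forall_eq_dotProduct_iff {n m : ℕ} {C : Code F2 n} (hC : IsSelfDual C)
    {e : Fin m ⊕ Fin m ≃ Fin n} {M : Matrix (Fin m) (Fin m) F2}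
    (hM : ∀ i, systematic e M i ∈ C) (f : C →ₗ[F2] F2) (y : Fin n → F2) :
    (∀ c : C, f c = (c : Fin n → F2) ⬝ᵥ y) ↔ (fun i => y (e (Sum.inl i))) =
      (M.mulVec fun i => y (e (Sum.inr i))) + fun i => f ⟨systematic e M i, hM i⟩ := by
  have h1 : ∀ i, f ⟨systematic e M i, hM i⟩ = systematic e M i ⬝ᵥ y ↔ y (e (Sum.inl i)) =
      M.mulVec (fun i => y (e (Sum.inr i))) i + f ⟨systematic e M i, hM i⟩ := by
    intro i
    rw [dotProduct_comm, dotProduct_systematic_eq]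
    have : ∀ a b c : F2, a = b + c ↔ b = c + a := by decide
    exact this _ _ _
  rw [funext_iff]
  simp only [Pi.add_apply, ← h1]
  refine ⟨fun h i => h _, fun h c => ?_⟩
  have hc := sum_smul_systematic (hC.mul_transpose_eq_one hM) ((hC.mem_iff_systematic hM _).1 c.2)
  have hc' : c = ∑ i, (c : Fin n → F2) (e (Sum.inl i)) • (⟨systematic e M i, hM i⟩ : C) := by
    apply Subtype.ext
    rw [AddSubmonoidClass.coe_finsetSum]
    exact hc.symm
  rw [hc', map_sum, AddSubmonoidClass.coe_finsetSum, sum_dotProduct]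
  refine Finset.sum_congr rfl fun i _ => ?_
  rw [map_smul, h, Submodule.coe_smul, smul_dotProduct]

theorem hammingNorm_eq_add {n m : ℕ} (e : Fin m ⊕ Fin m ≃ Fin n) (y : Fin n → F2) :
    hammingNorm y = hammingNorm (fun i => y (e (Sum.inl i))) +
      hammingNorm (fun i => y (e (Sum.inr i))) := by
  simp only [hammingNorm, Finset.card_filter]
  rw [← e.sum_comp, Fintype.sum_sum_type]

theorem hammingNorm_systematic {n m : ℕ} (e : Fin m ⊕ Fin m ≃ Fin n)
    (M : Matrix (Fin m) (Fin m) F2) (i : Fin m) :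
    hammingNorm (systematic e M i) = 1 + hammingNorm (M i) := by
  rw [hammingNorm_eq_add e]
  simp only [systematic_inl, systematic_inr]
  congr 1
  simp [hammingNorm, Finset.filter_eq]

/-- Splitting a vector into the information part and the redundancy part. -/
def splitEquiv {n m : ℕ} (e : Fin m ⊕ Fin m ≃ Fin n) :
    (Fin n → F2) ≃ (Fin m → F2) × (Fin m → F2) :=
  (e.arrowCongr (Equiv.refl F2)).symm.trans (Equiv.sumArrowEquivProdArrow _ _ _)

theorem card_filter_split {n m q : ℕ} (e : Fin m ⊕ Fin m ≃ Fin n) (P : (Fin n → F2) → Prop)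
    [DecidablePred P] (Q : (Fin m → F2) × (Fin m → F2) → Prop) [DecidablePred Q]
    (h : ∀ y, P y ↔ Q (fun i => y (e (Sum.inl i)), fun i => y (e (Sum.inr i)))) :
    (Finset.univ.filter fun y => P y ∧ hammingNorm y = q).card =
      (Finset.univ.filter fun x => Q x ∧ hammingNorm x.1 + hammingNorm x.2 = q).card := by
  refine Finset.card_equiv (splitEquiv e) fun y => ?_
  simp only [Finset.mem_filter, Finset.mem_univ, true_and, h, hammingNorm_eq_add e]
  rfl

/-- A row has at most 34 ones, so the fuel 64 is not exhausted. -/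
theorem pop_eq_hammingNorm {rows : List ℕ} (hlt : ∀ r ∈ rows, r < 2 ^ 34) (i : Fin 34) :
    pop 64 (rows.getD i 0) = hammingNorm (bitMatrix rows i) := by
  have h : rows.getD i 0 < 2 ^ 34 := by
    rcases Nat.lt_or_ge i rows.length with hi | hi
    · rw [List.getD_eq_getElem _ _ hi]
      exact hlt _ (List.getElem_mem hi)
    · rw [List.getD_eq_default _ _ hi]
      decide
  rw [pop_eq 64 _ 34 fun j hj =>
    Nat.testBit_lt_two_pow (h.trans_le (Nat.pow_le_pow_right (by decide) hj))]
  have h1 : ((Finset.range 34).filter fun j => (rows.getD i 0).testBit j = true).card =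
      hammingNorm (bitMatrix rows i) := by
    rw [hammingNorm, Finset.card_filter, Finset.card_filter, Finset.sum_range]
    refine Finset.sum_congr rfl fun j _ => ?_
    rw [bitMatrix_apply]
    cases (rows.getD i 0).testBit j <;> rfl
  rw [h1, min_eq_right]
  exact hammingNorm_le_card_fintype.trans (by decide)

theorem isExtremal68_of_systematic {C : Code F2 68} (hC : IsSelfDual C)
    (e : Fin 34 ⊕ Fin 34 ≃ Fin 68) {rows : List ℕ} (hrows : rows.length = 34)
    (hlt : ∀ r ∈ rows, r < 2 ^ 34) (hM : ∀ i, systematic e (bitMatrix rows) i ∈ C) {β γ : ℕ}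
    (hβ : 14 * γ ≤ β) (hβγ : β - 14 * γ < 128) (hγ : γ < 128)
    (h : lightCountsAre rows [1, 0, 0, 0, 0, 0, 0, 0, 0, 0, 0]
      [0, 0, 0, 0, 0, 0, γ, 0, 0, 0, β - 14 * γ] = true) : IsExtremal68 C β γ := by
  classical
  have hA := hC.mul_transpose_eq_one hM
  -- The identity block adds one to the weight of each row, hence the `1 + pop 64 r` in
  -- `halfWeights`.
  have hσ : bitsOf (fun i => hC.halfWeight ⟨systematic e (bitMatrix rows) i, hM i⟩) =
      halfWeights rows := by
    apply List.ext_getElem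
    · simp [bitsOf, halfWeights, hrows]
    · intro i h1 h2
      have hi : i < 34 := by simpa [bitsOf] using h1
      have hi' : i < rows.length := by omega
      simp only [bitsOf, halfWeights, List.getElem_ofFn, List.getElem_map]
      have e1 := pop_eq_hammingNorm hlt ⟨i, hi⟩
      rw [List.getD_eq_getElem _ _ hi'] at e1
      rw [e1]
      change decide (((hammingNorm (systematic e (bitMatrix rows) ⟨i, hi⟩) / 2 : ℕ) : F2) = 1) = _
      rw [hammingNorm_systematic]
      generalize (1 + hammingNorm (bitMatrix rows ⟨i, hi⟩)) / 2 = t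
      rw [Bool.eq_iff_iff, decide_eq_true_iff, Nat.beq_eq, ← Nat.cast_one,
        ZMod.natCast_eq_natCast_iff, Nat.ModEq]
  have key := fun q (hq : q < 11) => card_of_lightCountsAre hrows h (by
      intro v hv
      simp only [List.mem_cons, List.not_mem_nil, or_false] at hv
      omega) (by
      intro v hv
      simp only [List.mem_cons, List.not_mem_nil, or_false] at hv
      omega) hA _ hσ hq
  refine isExtremal68_of_counts hC hβ (fun q hq => ?_) (fun q hq => ?_)
  · rw [← (key q hq).1, weightCount]
    convert card_filter_split e (· ∈ C) (fun x => x.1 = (bitMatrix rows).mulVec x.2)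
      (hC.mem_iff_systematic hM)
  · rw [← (key q hq).2, IsSelfDual.shadowCount]
    convert card_filter_split e _ (fun x => x.1 = (bitMatrix rows).mulVec x.2 +
      fun i => hC.halfWeight ⟨systematic e (bitMatrix rows) i, hM i⟩)
      (hC.forall_eq_dotProduct_iff hM hC.halfWeight)

/-! ### Binary vectors given by the bits of a natural number -/

/-- The vector of the bits of `m`. -/
def natVec {n : ℕ} (m : ℕ) : Fin n → F2 := fun j => bit (m.testBit j)

theorem natVec_xor {n : ℕ} (a b : ℕ) : (natVec (a ^^^ b) : Fin n → F2) = natVec a + natVec b := by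
  funext j
  simp only [natVec, Nat.testBit_xor, Pi.add_apply]
  cases a.testBit j <;> cases b.testBit j <;> rfl

theorem natVec_zero {n : ℕ} : (natVec 0 : Fin n → F2) = 0 := by
  funext j
  simp [natVec, bit]

theorem natVec_dotProduct {n : ℕ} (a b : ℕ) (ha : a < 2 ^ n) :
    (natVec a : Fin n → F2) ⬝ᵥ natVec b = (pop n (a &&& b) : ℕ) := by
  have h : a &&& b < 2 ^ n := Nat.and_le_left.trans_lt ha
  rw [pop_eq n _ n fun j hj =>
    Nat.testBit_lt_two_pow (h.trans_le (Nat.pow_le_pow_right (by decide) hj)), min_eq_right,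
    Finset.card_filter, Finset.sum_range, dotProduct, Nat.cast_sum]
  · refine Finset.sum_congr rfl fun j _ => ?_
    simp only [natVec, Nat.testBit_and]
    cases a.testBit j <;> cases b.testBit j <;> rfl
  · exact (Finset.card_filter_le _ _).trans_eq (Finset.card_range n)

/-- Exchanging the bits `p.1` and `p.2` of `m`. -/
def swapBits (p : ℕ × ℕ) (m : ℕ) : ℕ :=
  bif (m.testBit p.1) ^^ (m.testBit p.2) then m ^^^ (2 ^ p.1 ||| 2 ^ p.2) else m

theorem natVec_swapBits {n : ℕ} (p : Fin n × Fin n) (m : ℕ) :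
    (natVec (swapBits (p.1, p.2) m) : Fin n → F2) = natVec m ∘ Equiv.swap p.1 p.2 := by
  obtain ⟨a, b⟩ := p
  funext j
  simp only [natVec, Function.comp]
  congr 1
  rw [swapBits]
  by_cases ha : j = a
  · subst ha
    rw [Equiv.swap_apply_left]
    cases h1 : m.testBit j <;> cases h2 : m.testBit b <;>
      simp [h1, Nat.testBit_xor, Nat.testBit_or, Nat.testBit_two_pow_self]
  · by_cases hb : j = b
    · subst hb
      rw [Equiv.swap_apply_right]
      cases h1 : m.testBit j <;> cases h2 : m.testBit a <;>
        simp [h1, Nat.testBit_xor, Nat.testBit_or, Nat.testBit_two_pow_self]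
    · rw [Equiv.swap_apply_of_ne_of_ne ha hb]
      have h1 : (a : ℕ) ≠ j := fun h => ha (Fin.ext h.symm)
      have h2 : (b : ℕ) ≠ j := fun h => hb (Fin.ext h.symm)
      cases (m.testBit a ^^ m.testBit b) <;>
        simp [Nat.testBit_xor, Nat.testBit_or, Nat.testBit_two_pow_of_ne h1,
          Nat.testBit_two_pow_of_ne h2]

/-- A product of transpositions of the coordinates. -/
def swapsPerm {n : ℕ} (sw : List (Fin n × Fin n)) : Equiv.Perm (Fin n) :=
  sw.foldr (fun p σ => Equiv.swap p.1 p.2 * σ) 1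

def swapsBits {n : ℕ} (sw : List (Fin n × Fin n)) (m : ℕ) : ℕ :=
  sw.foldr (fun p m => swapBits (p.1, p.2) m) m

theorem natVec_swapsBits {n : ℕ} (sw : List (Fin n × Fin n)) (m : ℕ) (j : Fin n) :
    (natVec (swapsBits sw m) : Fin n → F2) (swapsPerm sw j) = natVec m j := by
  induction sw with
  | nil => rfl
  | cons p sw ih =>
    rw [swapsBits, List.foldr_cons, natVec_swapBits, ← ih]
    simp [swapsPerm, swapsBits]

/-- The coordinates in which a generator matrix becomes systematic after the exchanges `sw`. -/
def swapsEquiv (sw : List (Fin 68 × Fin 68)) : Fin 34 ⊕ Fin 34 ≃ Fin 68 :=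
  (finSumFinEquiv (m := 34) (n := 34)).trans (swapsPerm sw)

/-- The rows of the generator matrix which becomes `(I | M)` after the exchanges `sw`, where `M`
has the rows `rows`. -/
def generators (sw : List (Fin 68 × Fin 68)) (rows : List ℕ) : List ℕ :=
  (List.range 34).map fun i => swapsBits sw (2 ^ i ||| (rows.getD i 0) <<< 34)

theorem systematic_eq_natVec (sw : List (Fin 68 × Fin 68)) (rows : List ℕ) (i : Fin 34) :
    systematic (swapsEquiv sw) (bitMatrix rows) i =
      natVec (swapsBits sw (2 ^ (i : ℕ) ||| (rows.getD i 0) <<< 34)) := by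
  funext k
  obtain ⟨s, rfl⟩ := (swapsEquiv sw).surjective k
  change _ = natVec _ (swapsPerm sw (finSumFinEquiv (m := 34) (n := 34) s))
  rw [natVec_swapsBits]
  rcases s with j | j
  · rw [systematic_inl, finSumFinEquiv_apply_left]
    simp only [natVec, Fin.val_castAdd, Nat.testBit_or, Nat.testBit_two_pow, Nat.testBit_shiftLeft,
      Nat.not_le_of_lt j.2, decide_false, Bool.false_and, Bool.or_false, bit, Fin.ext_iff,
      decide_eq_true_eq]
  · rw [systematic_inr, finSumFinEquiv_apply_right, bitMatrix_apply]
    have : (i : ℕ) ≠ 34 + j := by omega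
    simp [natVec, -Fin.natAdd_eq_addNat, Nat.testBit_or, this]

theorem systematic_mem_of_generators {C : Code F2 68} {sw : List (Fin 68 × Fin 68)} {rows : List ℕ}
    (h : ∀ g ∈ generators sw rows, natVec g ∈ C) (i : Fin 34) :
    systematic (swapsEquiv sw) (bitMatrix rows) i ∈ C := by
  rw [systematic_eq_natVec]
  exact h _ (List.mem_map.2 ⟨i, List.mem_range.2 i.2, rfl⟩)

/-- Whether `m` is reduced to zero by the vectors `g` at the positions `p`, for the pairs `(p, g)` in
the list. -/
def reduceBits : List (ℕ × ℕ) → ℕ → Bool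
  | [], m => Nat.beq 0 m
  | p :: l, m => bif m.testBit p.1 then force (m ^^^ p.2) (reduceBits l) else reduceBits l m

/-- Remainder zero means that `m` is the XOR of the vectors subtracted on the way. The pivots only
steer the reduction, so nothing has to be proved about them. -/
theorem natVec_mem_of_reduceBits {n : ℕ} {C : Code F2 n} {l : List (ℕ × ℕ)}
    (hl : ∀ p ∈ l, natVec p.2 ∈ C) {m : ℕ} (h : reduceBits l m = true) :
    natVec m ∈ C := by
  induction l generalizing m with
  | nil =>
    rw [← Nat.eq_of_beq_eq_true h, natVec_zero]
    exact C.zero_mem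
  | cons p l ih =>
    have hl' := fun q hq => hl q (List.mem_cons_of_mem p hq)
    rw [reduceBits] at h
    cases hb : m.testBit p.1 with
    | false =>
      rw [hb] at h
      exact ih hl' h
    | true =>
      rw [hb, cond_true, force_eq] at h
      have h1 := Submodule.add_mem _ (ih hl' h) (hl p List.mem_cons_self)
      rwa [← natVec_xor, Nat.xor_assoc, Nat.xor_self, Nat.xor_zero] at h1

/-! ### The extended codes -/

instance : DecidableEq F2u := inferInstanceAs (DecidableEq (F2 × F2))

/-- The redundancy part of the generator matrix of `codeF2`. -/
def matrixF2 : Matrix (Fin 8 ⊕ Fin 8) (Fin 8 ⊕ Fin 8) F2u :=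
  let A := (circ fun i => dig (![2, 2, 0, 2, 1, 2, 1, 2] i : ℕ) : Matrix (Fin 8) (Fin 8) F2u)
  let B := (circ fun i => dig (![2, 2, 2, 0, 0, 1, 1, 3] i : ℕ) : Matrix (Fin 8) (Fin 8) F2u)
  let C := (revCirc fun i => dig (![0, 0, 3, 0, 0, 0, 3, 0] i : ℕ) : Matrix (Fin 8) (Fin 8) F2u)
  Matrix.fromBlocks A (B + C) (B.transpose + C) A.transpose

/-- The redundancy part of the generator matrix of `codeE6`. -/
def matrixE6 : Matrix (Fin 4 ⊕ Fin 4) (Fin 4 ⊕ Fin 4) F4u :=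
  let A := (circ fun i => hex (![15, 9, 7, 9] i : ℕ) : Matrix (Fin 4) (Fin 4) F4u)
  let B := (circ fun i => hex (![2, 4, 3, 15] i : ℕ) : Matrix (Fin 4) (Fin 4) F4u)
  let C := ((circ fun i => hex (![15, 5, 11, 8] i : ℕ)) * backDiag : Matrix (Fin 4) (Fin 4) F4u)
  Matrix.fromBlocks A (B + C) (B.transpose + C) A.transpose

/-- The coordinates of the generalized four circulant construction. -/
def blocks (m : ℕ) : (Fin m ⊕ Fin m) ⊕ (Fin m ⊕ Fin m) ≃ Fin ((m + m) + (m + m)) :=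
  ((finSumFinEquiv (m := m) (n := m)).sumCongr (finSumFinEquiv (m := m) (n := m))).trans
    finSumFinEquiv

theorem codeF2_eq : codeF2 = rowCode (systematic (blocks 8) matrixF2) := rfl

theorem codeE6_eq : codeE6 = rowCode (systematic (blocks 4) matrixE6) := rfl

set_option maxRecDepth 100000 in
theorem matrixF2_mul_transpose : matrixF2 * matrixF2.transpose = -1 := by
  have h : ∀ i j, (matrixF2 * matrixF2.transpose) i j = if i = j then -1 else 0 := by
    decide +kernel
  ext1 i j
  rw [h, Matrix.neg_apply, Matrix.one_apply, neg_ite, neg_zero]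

set_option maxRecDepth 100000 in
theorem matrixE6_mul_transpose : matrixE6 * matrixE6.transpose = -1 := by
  have h : ∀ i j, (matrixE6 * matrixE6.transpose) i j = if i = j then -1 else 0 := by
    decide +kernel
  ext1 i j
  rw [h, Matrix.neg_apply, Matrix.one_apply, neg_ite, neg_zero]

theorem isSelfDual_codeF2 : IsSelfDual codeF2 :=
  isSelfDual_systematic (blocks 8) matrixF2 matrixF2_mul_transpose

theorem isSelfDual_codeE6 : IsSelfDual codeE6 :=
  isSelfDual_systematic (blocks 4) matrixE6 matrixE6_mul_transpose

/-- Self-duality turns membership into orthogonality to the rows, a finite check that needs no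
coefficients. -/
theorem mem_codeF2 {v : Fin 32 → F2u} (h : ∀ i, v (blocks 8 (Sum.inl i)) +
    ∑ j, matrixF2 i j * v (blocks 8 (Sum.inr j)) = 0) : v ∈ codeF2 := by
  rw [← isSelfDual_codeF2, codeF2_eq]
  refine mem_dualCode_rowCode.2 fun i => ?_
  rw [dotProduct_systematic]
  exact h i

theorem mem_codeE6 {v : Fin 16 → F4u} (h : ∀ i, v (blocks 4 (Sum.inl i)) +
    ∑ j, matrixE6 i j * v (blocks 4 (Sum.inr j)) = 0) : v ∈ codeE6 := by
  rw [← isSelfDual_codeE6, codeE6_eq]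
  refine mem_dualCode_rowCode.2 fun i => ?_
  rw [dotProduct_systematic]
  exact h i

theorem unitD_sq (i : Fin 2) : unitD i ^ 2 = 1 := by
  revert i; decide +kernel

theorem isUnit_unitD (i : Fin 2) : IsUnit (unitD i) :=
  IsUnit.of_pow_eq_one (unitD_sq i) two_ne_zero

theorem vecD_dotProduct (i : Fin 2) : vecD i ⬝ᵥ vecD i = 1 := by
  revert i; decide +kernel

theorem vecC68_dotProduct : vecC68 ⬝ᵥ vecC68 = 1 := by
  decide +kernel

theorem isSelfDual_codeD (i : Fin 2) : IsSelfDual (codeD i) :=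
  isSelfDual_binaryImage (isSelfDual_extendCode (F2u.add_self 1) isSelfDual_codeF2 (unitD_sq i)
    (vecD_dotProduct i))

theorem isSelfDual_psiImage_codeE6 : IsSelfDual (psiImage codeE6) :=
  isSelfDual_psiImage isSelfDual_codeE6

theorem isSelfDual_codeC68 : IsSelfDual codeC68 :=
  isSelfDual_binaryImage (isSelfDual_extendCode (F2u.add_self 1) isSelfDual_psiImage_codeE6
    (one_pow 2) vecC68_dotProduct)

/-- The vector of `F₂ᵘⁿ` that is extended to the inverse image of `y` under the Gray map. -/
def baseVector {n : ℕ} (c : F2u) (X : Fin n → F2u) (y : Fin (n + 2) → F2u) (i : Fin n) : F2u :=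
  y i.succ.succ + (y 0 + c * y 1) * X i

/-- Both constructions are undone explicitly: the Gray map by `grayPhiInv`, the extension by
`mem_extendCode_of`. What remains can be decided on literals. -/
theorem mem_binaryImage_extendCode {n : ℕ} {C : Code F2u n} {c : F2u} (hc : c ^ 2 = 1)
    {X : Fin n → F2u} (hX : X ⬝ᵥ X = 1) (v : Fin ((n + 2) + (n + 2)) → F2)
    (hp : grayPhiInv v 0 + ∑ i, grayPhiInv v (Fin.succ (Fin.succ i)) * X i = 0)
    (hz : baseVector c X (grayPhiInv v) ∈ C) : v ∈ binaryImage (extendCode C c X) := by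
  refine mem_binaryImage.2 ⟨grayPhiInv v, ?_, grayPhi_grayPhiInv v⟩
  have h := mem_extendCode_of (F2u.add_self 1) hc hX (q := grayPhiInv v 1)
    (z := fun i => grayPhiInv v (Fin.succ (Fin.succ i))) hp hz
  convert h
  funext i
  refine Fin.cases rfl (fun i => Fin.cases rfl (fun i => rfl) i) i

/-- The exchanges of coordinates for which `codeD i` has a generator matrix `(I | M)`. -/
def swapsD : Fin 2 → List (Fin 68 × Fin 68) := ![[], [(32, 34)]]

/-- The rows of `M`. -/
def rowsD : Fin 2 → List ℕ := ![
    [7199408722, 1391246783, 12683009566, 5569713830, 1007847367, 13687151306, 4558218481,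
    11667530618, 9646020498, 3522201021, 8488161118, 8412181542, 8313714990, 8013994178,
    7483810021, 6419016530, 4353981484, 17151864093, 10148318215, 8982672395, 2222113789,
    7086026702, 436080558, 2638591854, 10398285549, 2032914926, 4777245169, 11136333177,
    10717425558, 1394793909, 16962207246, 14104559237, 7585660009, 12231508388],
    [1003553671, 14807254533, 13086597616, 3020548424, 12408325011, 12081931556, 9391611723,
    7194876742, 4921749422, 16937188871, 12386203490, 177556424, 276547264, 576268076,
    2050104461, 10287780718, 16775117822, 3727480487, 10321268609, 3370266719, 15637067847,
    1504628768, 12924188562, 5951146112, 15836299909, 6557347328, 9609577035, 14292420881,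
    15053099128, 14820222479, 3903833650, 1758070079, 7199408722, 1029015158]]

/-- The rows of `M` for the generator matrix `(I | M)` of `codeC68`. -/
def rowsC68 : List ℕ :=
    [11729237316, 7960100838, 7864662467, 15743366400, 14345596736, 6591518434, 6300864887,
    7726940198, 5887935839, 7955638322, 3319120187, 4341205526, 13209387119, 6625444383,
    15258187667, 10867838441, 12639362759, 14407078368, 3976582343, 2114658497, 13829887763,
    15378572074, 6569458990, 8176971236, 4207268945, 14391360347, 4377593300, 14547837867,
    1396380503, 11435573321, 6904809430, 14527358639, 3471997950, 11445456921]

set_option maxRecDepth 100000 in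
theorem generators_mem_codeD (i : Fin 2) : ∀ g ∈ generators (swapsD i) (rowsD i),
    natVec g ∈ codeD i := by
  have h : ∀ i, ∀ g ∈ generators (swapsD i) (rowsD i),
      let y : Fin 34 → F2u := grayPhiInv (natVec g)
      y 0 + ∑ k, y (Fin.succ (Fin.succ k)) * vecD i k = 0 ∧
      ∀ s, baseVector (unitD i) (vecD i) y (blocks 8 (Sum.inl s)) +
        ∑ t, matrixF2 s t * baseVector (unitD i) (vecD i) y (blocks 8 (Sum.inr t)) = 0 := by
    decide +kernel
  intro g hg
  exact mem_binaryImage_extendCode (unitD_sq i) (vecD_dotProduct i) _ (h i g hg).1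
    (mem_codeF2 (h i g hg).2)

set_option maxRecDepth 100000 in
theorem generators_mem_codeC68 : ∀ g ∈ generators [] rowsC68, natVec g ∈ codeC68 := by
  have h : ∀ g ∈ generators [] rowsC68,
      let y : Fin 34 → F2u := grayPhiInv (natVec g)
      let z : Fin 16 → F4u := grayPsiInv (baseVector 1 vecC68 y)
      y 0 + ∑ k, y (Fin.succ (Fin.succ k)) * vecC68 k = 0 ∧
      ∀ s, z (blocks 4 (Sum.inl s)) + ∑ t, matrixE6 s t * z (blocks 4 (Sum.inr t)) = 0 := by
    decide +kernel
  intro g hg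
  exact mem_binaryImage_extendCode (one_pow 2) vecC68_dotProduct _ (h g hg).1
    (mem_psiImage.2 ⟨_, mem_codeE6 (h g hg).2, grayPsi_grayPsiInv _⟩)

/-! ### Neighbors -/

theorem placeAt_eq_natVec (sw : List (Fin 68 × Fin 68)) {pos : Fin 34 → Fin 68} {t : Fin 34 → ℕ}
    (hpos : ∀ k, pos k = swapsPerm sw (lastHalf k)) {x : ℕ}
    (hx : ∀ k : Fin 34, (t k : F2) = bit (x.testBit k)) :
    placeAt pos t = natVec (swapsBits sw (x <<< 34)) := by
  funext j
  obtain ⟨j, rfl⟩ := (swapsPerm sw).surjective j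
  rw [natVec_swapsBits, placeAt, Finset.sum_apply]
  have h : ∀ k, (Pi.single (pos k) (t k : F2) : Fin 68 → F2) (swapsPerm sw j) =
      if lastHalf k = j then (t k : F2) else 0 := fun k => by
    rw [Pi.single_apply, hpos k]
    exact if_congr (by rw [EmbeddingLike.apply_eq_iff_eq, eq_comm]) rfl rfl
  simp only [h]
  refine Fin.addCases (m := 34) (n := 34) (fun i => ?_) (fun i => ?_) j
  · rw [Finset.sum_eq_zero fun k _ => if_neg fun e => ?_]
    · simp [natVec, bit, Nat.testBit_shiftLeft]
    · have := congrArg Fin.val e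
      simp only [lastHalf, Fin.val_natAdd, Fin.val_castAdd] at this
      omega
  · have h' : ∀ k : Fin 34, lastHalf k = Fin.natAdd 34 i ↔ k = i := fun k => by
      rw [lastHalf, Fin.ext_iff, Fin.ext_iff, Fin.val_natAdd, Fin.val_natAdd]
      omega
    simp only [h', Finset.sum_ite_eq', Finset.mem_univ, if_true, hx]
    simp [natVec, -Fin.natAdd_eq_addNat, Nat.testBit_shiftLeft]

/-- The conditions for `x` to give a neighbor of the code generated by the vectors in `P`, with
generators `gens`. -/
def neighborCheck (P : List (ℕ × ℕ)) (x : ℕ) (gens : List ℕ) : Bool :=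
  Nat.blt x (2 ^ 68) && Nat.beq (pop 68 (x &&& x) % 2) 0 &&
    (P.any fun p => Nat.beq (pop 68 (x &&& p.2) % 2) 1) &&
    gens.all fun g => force g fun g =>
      Nat.beq (pop 68 (x &&& g) % 2) 0 && (reduceBits P g || reduceBits P (g ^^^ x))

theorem natVec_dotProduct_eq_zero {n a b : ℕ} (ha : a < 2 ^ n)
    (h : Nat.beq (pop n (a &&& b) % 2) 0 = true) :
    (natVec a : Fin n → F2) ⬝ᵥ natVec b = 0 := by
  rw [natVec_dotProduct a b ha, ZMod.natCast_eq_zero_iff]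
  exact Nat.dvd_of_mod_eq_zero (Nat.eq_of_beq_eq_true h)

/-- A codeword with odd inner product with `x` shows `x ∉ C`. A vector `g` orthogonal to `x` lies in
the neighbor as soon as `g` or `g + x` is in `C`, the latter being orthogonal to `x` too since `⟨x,
x⟩ = 0`. -/
theorem of_neighborCheck {C : Code F2 68} (hC : IsSelfDual C) {P : List (ℕ × ℕ)}
    (hP : ∀ p ∈ P, natVec p.2 ∈ C) {x : ℕ} {gens : List ℕ} (h : neighborCheck P x gens = true) :
    (natVec x : Fin 68 → F2) ⬝ᵥ natVec x = 0 ∧ natVec x ∉ C ∧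
      ∀ g ∈ gens, natVec g ∈ neighborCode C (natVec x) := by
  simp only [neighborCheck, force_eq, Bool.and_eq_true, Bool.or_eq_true, List.any_eq_true,
    List.all_eq_true, Nat.blt_eq] at h
  obtain ⟨⟨⟨h1, h2⟩, p, hp, h3⟩, h4⟩ := h
  have hx := natVec_dotProduct_eq_zero h1 h2
  refine ⟨hx, fun hmem => ?_, fun g hg => ?_⟩
  · have h5 := hC.dotProduct_eq_zero hmem (hP p hp)
    rw [natVec_dotProduct x p.2 h1, ZMod.natCast_eq_zero_iff] at h5
    have := Nat.eq_of_beq_eq_true h3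
    omega
  · have h5 := natVec_dotProduct_eq_zero h1 (h4 g hg).1
    rw [dotProduct_comm] at h5
    rcases (h4 g hg).2 with h6 | h6
    · exact mem_neighborCode_of_mem (natVec_mem_of_reduceBits hP h6) h5
    · have h7 := natVec_mem_of_reduceBits hP h6
      refine mem_neighborCode.2 ⟨_, h7, ?_, 1, ?_⟩
      · rw [natVec_xor, add_dotProduct, h5, hx, add_zero]
      · rw [one_smul, ← natVec_xor, Nat.xor_assoc, Nat.xor_self, Nat.xor_zero]

/-- The conditions on the rows of `M` for the generator matrix `(I | M)` to give a code with the
weight enumerator `W_{68,2}(β, γ)`. -/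
def rowsCheck (rows : List ℕ) (β γ : ℕ) : Bool :=
  Nat.beq rows.length 34 && (rows.all fun r => Nat.blt r (2 ^ 34)) && Nat.ble (14 * γ) β &&
    Nat.blt (β - 14 * γ) 128 && Nat.blt γ 128 &&
    lightCountsAre rows [1, 0, 0, 0, 0, 0, 0, 0, 0, 0, 0]
      [0, 0, 0, 0, 0, 0, γ, 0, 0, 0, β - 14 * γ]

theorem isExtremal68_of_rowsCheck {C : Code F2 68} (hC : IsSelfDual C)
    {sw : List (Fin 68 × Fin 68)} {rows : List ℕ} (hmem : ∀ g ∈ generators sw rows, natVec g ∈ C)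
    {β γ : ℕ} (h : rowsCheck rows β γ = true) : IsExtremal68 C β γ := by
  simp only [rowsCheck, Bool.and_eq_true, List.all_eq_true, Nat.blt_eq, Nat.ble_eq,
    Nat.beq_eq] at h
  obtain ⟨⟨⟨⟨⟨h1, h2⟩, h3⟩, h4⟩, h5⟩, h6⟩ := h
  exact isExtremal68_of_systematic hC (swapsEquiv sw) h1 h2
    (systematic_mem_of_generators hmem) h3 h4 h5 h6

/-- The data of a neighbor: the last `34` entries of the vector `x`, as the bits of a natural
number, the exchanges of coordinates after which the code has a generator matrix `(I | M)`, and the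
rows of `M`. -/
structure NeighborData where
  direction : ℕ
  swaps : List (Fin 68 × Fin 68)
  rows : List ℕ

/-- The condition that the data describe a neighbor of the code generated by the vectors in `P`. -/
def NeighborData.check (D : NeighborData) (sw : List (Fin 68 × Fin 68)) (P : List (ℕ × ℕ)) : Bool :=
  force (swapsBits sw (D.direction <<< 34)) fun x =>
    neighborCheck P x (generators D.swaps D.rows)

/-- Two sets of exchanges occur: `sw` belongs to the parent code and places the entries of `x`,
while `D.swaps` brings the neighbor itself into systematic form. -/
theorem NeighborData.spec {C : Code F2 68} (hC : IsSelfDual C) {P : List (ℕ × ℕ)}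
    (hP : ∀ p ∈ P, natVec p.2 ∈ C) (sw : List (Fin 68 × Fin 68)) {pos : Fin 34 → Fin 68}
    {t : Fin 34 → ℕ} (hpos : ∀ k, pos k = swapsPerm sw (lastHalf k)) {D : NeighborData}
    (ht : ∀ k : Fin 34, (t k : F2) = bit (D.direction.testBit k)) {β γ : ℕ}
    (hD : D.check sw P = true) (h : rowsCheck D.rows β γ = true) :
    AreNeighbors C (neighborCode C (placeAt pos t)) ∧
      IsExtremal68 (neighborCode C (placeAt pos t)) β γ := by
  rw [placeAt_eq_natVec sw hpos ht]
  rw [NeighborData.check, force_eq] at hD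
  obtain ⟨h1, h2, h3⟩ := of_neighborCheck hC hP hD
  exact ⟨areNeighbors_neighborCode hC h1 h2,
    isExtremal68_of_rowsCheck (isSelfDual_neighborCode hC h1 h2) h3 h⟩

/-- The generators of `codeD i` with their pivots. -/
def pairsD : Fin 2 → List (ℕ × ℕ) := ![
    [(0, 123684900046108622849), (1, 23901437734600835074), (2, 217892445203300614148), (3,
    95686954991715614728), (4, 17314685922498838544), (5, 235143468938694754336), (6,
    78309597215671189568), (7, 200446649717554675840), (8, 165717370301822533888), (9,
    60510952780531237376), (10, 145825497619955188736), (11, 144520178443619403776), (12,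
    142828535961259872256), (13, 137679371619377618944), (14, 128570877158688309248), (15,
    110277864275333644288), (16, 74800832324678254592), (17, 294666781379486941184), (18,
    174346779371304648704), (19, 154321136668828499968), (20, 38175624206983626752), (21,
    121737011774693048320), (22, 7491806940129918976), (23, 45330662881696415744), (24,
    178641185469714399232), (25, 34925212490914594816), (26, 82072447063383080960), (27,
    191320747170433335296), (28, 184123969075966640128), (29, 23962376895796871168), (30,
    291408501559250649088), (31, 242314482591786336256), (32, 130320646633215229952), (33,
    210135714037428649984)],
    [(0, 17240920774018072577), (1, 254386695838246109186), (2, 224826035106526265348), (3,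
    51892626788257366024), (4, 213173400468650459152), (5, 207566003622121570336), (6,
    161346660815175942208), (7, 123607041222564118656), (8, 84555011226387611904), (9,
    290978689135595749888), (10, 212793355644604253184), (11, 3050396137098840064), (12,
    4751045818713116672), (13, 9900210160595378176), (14, 35220526440629944320), (15,
    176742726928917626880), (16, 288194329728147062784), (17, 64037627139687841792), (18,
    177318044502661005312), (19, 57900741334724509696), (20, 268642780019908673536), (21,
    25849325404725182464), (22, 222035868804513267712), (23, 102239911699038601216), (24,
    272065560782342979584), (25, 112654369289125494784), (26, 165091276362052796416), (27,
    245541921045499346944), (28, 258610273833092907008), (29, 254609483454648156160), (30,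
    67067351424170983424), (31, 30203413962787127296), (34, 123684900063288492032), (33,
    17678345811383025664)]]

/-- The generators of `codeC68` with their pivots. -/
def pairsC68 : List (ℕ × ℕ) :=
    [(0, 201506762716971270145), (1, 136753491088288776194), (2, 135113872359374716932), (3,
    270468975267781017608), (4, 246455475290897383440), (5, 113241424420044537888), (6,
    108248034504718942272), (7, 132747821794231058560), (8, 101153967477805285632), (9,
    136676825647177269760), (10, 57022050618633618432), (11, 74581343037537912832), (12,
    226935542705234644992), (13, 113824267785807601664), (14, 262133668103982170112), (15,
    186708042729226534912), (16, 217142598768741384192), (17, 247511721685876342784), (18,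
    68317164452144480256), (19, 36329556347294580736), (20, 237595662597743443968), (21,
    264201856468037664768), (22, 112862446057856958464), (23, 140479296155819180032), (24,
    72280330097022468096), (25, 247241688141298401280), (26, 75206480234821976064), (27,
    249929951465235808256), (28, 23989634372896555008), (29, 196461653699357310976), (30,
    118623722748923346944), (31, 249578121009219764224), (32, 59648470592411140096), (33,
    196631452662477357056)]

/-- The table stores the generators already expanded, so that the many reductions modulo the parent
code work on literals. -/
theorem pairsD_mem (i : Fin 2) : ∀ p ∈ pairsD i, natVec p.2 ∈ codeD i := by
  have h : ∀ i, (pairsD i).map Prod.snd = generators (swapsD i) (rowsD i) := by decide +kernel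
  intro p hp
  exact generators_mem_codeD i _ (h i ▸ List.mem_map_of_mem hp)

theorem pairsC68_mem : ∀ p ∈ pairsC68, natVec p.2 ∈ codeC68 := by
  have h : pairsC68.map Prod.snd = generators [] rowsC68 := by decide +kernel
  intro p hp
  exact generators_mem_codeC68 _ (h ▸ List.mem_map_of_mem hp)

/-- The data of the codes `codeN i`. -/
def dataN (i : Fin 6) : NeighborData :=
  [
    {
      direction := 67779189
      swaps := [(30, 34)]
      rows :=
        [3614769089, 15538928195, 16721274819, 1554395003, 12475054566, 12081931556, 11868660493,
        5443607925, 4921749422, 13374390849, 12386203490, 3795488251, 276547264, 3405177119,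
        2526535883, 10965800285, 13143915981, 847850209, 10931925959, 608685081, 14104347649,
        1504628768, 16827068833, 5951146112, 15768549616, 6148253747, 12086115853, 16093607255,
        14656198219, 14886673530, 7199408722, 1824538442, 67779188, 1029015158] },
    {
      direction := 3807337264
      swaps := [(32, 34), (33, 38)]
      rows :=
        [3832274641, 15790381907, 13712238486, 1806906398, 12327945717, 8851650674, 12623954461,
        7194876742, 4921749422, 13659939665, 12386203490, 177556424, 3485539222, 576268076,
        2777203163, 11719527992, 16551411096, 3727480487, 10321268609, 705522543, 15637067847,
        2249461110, 16655068322, 5951146112, 15836299909, 6557347328, 9609577035, 15855145505,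
        16045938206, 15785294681, 3589947476, 1436517209, 5636168034, 3807337248] },
    {
      direction := 414710256
      swaps := [(32, 38)]
      rows :=
        [6685243445, 14807254548, 13232134144, 3020548424, 14202323409, 12081931556, 15474959609,
        7194876742, 4921749422, 9732965813, 12386203490, 177556424, 7077002595, 6844095631,
        2050104476, 10287780718, 9844144557, 6098873621, 10321268624, 3495283134, 15637067862,
        1504628768, 13335826018, 3609129763, 9030564151, 863016355, 15190669817, 14148628720,
        9330381355, 11927756221, 4028121026, 1887304926, 414710240, 6715851813] },
    {
      direction := 11329769531
      swaps := [(31, 34)]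
      rows :=
        [11150529468, 7815714366, 7642100981, 10729913421, 10927343277, 463941665, 9781287541,
        7194876742, 16892525227, 15456205625, 12386203490, 11829108429, 276547264, 576268076,
        12238752950, 10287780718, 5039156987, 3068580761, 3296501690, 10396409956, 16320085369,
        11042178341, 12924188562, 5951146112, 4507062974, 6557347328, 10000041845, 13877840943,
        5548574077, 13347365681, 9179976503, 7199408722, 11329769530, 1029015158] },
    {
      direction := 5604409527
      swaps := [(33, 34)]
      rows :=
        [14832124919, 16205626541, 12683009566, 15350437635, 15754856149, 13687151306,
        11151762915, 1853776607, 3892090423, 14075167919, 8488161118, 8412181542, 13799733387,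
        8013994178, 9279070711, 6419016530, 16551411081, 11548503466, 13202590896, 14384641212,
        13211026159, 7086026702, 11826892299, 9735747275, 13518618202, 2032914926, 1387428166,
        4307842155, 2814438963, 4784545026, 5000183723, 8703114802, 2318367966, 5604409526] },
    {
      direction := 2010360361
      swaps := [(29, 34)]
      rows :=
        [1275242926, 30302219, 143437271, 3020548424, 11077921210, 7862921475, 5848054085,
        7194876742, 9157403529, 15139034158, 12386203490, 13121636335, 13236357863, 13536078603,
        13042760323, 10287780718, 16775117822, 2852093070, 8873158056, 16034338385, 3612352073,
        14447795207, 115243957, 5951146112, 16512542892, 10776224295, 9849612386, 549433119,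
        15053099128, 7199408722, 3903833650, 521776918, 2010360360, 1029015158] }].getD i ⟨0, [], []⟩

/-- The data of the codes `codeC i`. -/
def dataC (i : Fin 34) : NeighborData :=
  [
    {
      direction := 15049964799
      swaps := [(32, 34)]
      rows :=
        [11729237316, 7960100838, 10029172028, 15743366400, 15466632383, 6591518434, 9536919159,
        4336761817, 12347963808, 4643296205, 14040038852, 7720923625, 2455469200, 8789458656,
        209275756, 7654099689, 7493327303, 15372708383, 14697490488, 13723068353, 2007830547,
        14400100565, 5526226641, 8176971236, 15925482321, 3636889508, 4377593300, 752886955,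
        16411733928, 4975574198, 5729254441, 3773422160, 15049964798, 5020576998] },
    {
      direction := 14838919754
      swaps := [(32, 35)]
      rows :=
        [4321737970, 11509337516, 4734796351, 15743366400, 14345596736, 5470481694, 8656544573,
        4336761818, 6710935203, 4643296206, 15865099121, 10581604444, 1730196005, 5437536739,
        14017825903, 5322802271, 9658377531, 14407078368, 15459296909, 2114658497, 1277470041,
        14400100566, 12681875300, 8176971236, 4207268945, 15421980839, 4377593300, 392794593,
        13544251677, 4615342591, 12616005020, 361895141, 14838919752, 11445456921] },
    {
      direction := 4800078017
      swaps := [(33, 34)]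
      rows :=
        [4550116765, 7960100838, 3403569410, 15743366400, 14345596736, 9609815611, 16605004143,
        10614173951, 1089054110, 7955638322, 10467283235, 11658672847, 7405342839, 2498962142,
        4953909131, 15466327336, 16899259910, 4002554169, 9784657119, 12150436057, 9232201682,
        15378572074, 9457716727, 9987300669, 9948234825, 9794870170, 4377593300, 7670182835,
        5588939670, 15963938952, 9389455119, 10737321582, 14946061095, 4800078016] },
    {
      direction := 7363522276
      swaps := [(32, 36)]
      rows :=
        [13119495072, 1821577474, 2899389661, 15743366400, 14345596736, 4042687484, 7407004301,
        4336761820, 3893668795, 2720365868, 7478563877, 7720923628, 11369787019, 5437536741,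
        12706734733, 10867838441, 14088351779, 9171797246, 603434813, 2114658497, 13829887763,
        12561315380, 5526226644, 4992325150, 4207268945, 9158176325, 7685979694, 14547837867,
        2647222445, 16400323927, 761882930, 15822462293, 7363522272, 11445456921] },
    {
      direction := 10274980863
      swaps := [(32, 34)]
      rows :=
        [11729237316, 4639360025, 15848897084, 15743366400, 15466632383, 5470481693, 16593856887,
        4336761817, 13868271264, 4643296205, 10456955195, 7720923625, 6295159696, 16886759904,
        4964536211, 760985065, 2503122232, 14407078368, 10895365944, 12156573889, 6758002451,
        15378572074, 5526226641, 8176971236, 11251881902, 8377533275, 4377593300, 4419854420,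
        9518239912, 3455239094, 5729254441, 4387906896, 10274980862, 3462140902] },
    {
      direction := 8063024649
      swaps := [(32, 34)]
      rows :=
        [11729237316, 7960100838, 877840330, 14572244735, 14345596736, 6591518434, 2534961022,
        4336761817, 3194305366, 7955638322, 4920065842, 4341205526, 12679429734, 2760755177,
        11325731429, 14618325984, 13183393998, 15372708383, 4522650318, 6956048072, 12226701594,
        15378572074, 6569458990, 4992325147, 7862243751, 10597908141, 4377593300, 9889900125,
        6398318241, 14110359104, 6904809430, 9923748697, 8063024648, 14137175568] },
    {
      direction := 9660326163
      swaps := [(31, 34)]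
      rows :=
        [11729237316, 2220652635, 11628765037, 15743366400, 14345596736, 3603665247, 8966010841,
        7726940198, 14516364364, 2216193935, 15639521173, 4341205526, 1924310721, 12533474481,
        7293474432, 8156080967, 3465658324, 14407078368, 15248405097, 9693544914, 4422874624,
        15378572074, 3652778643, 8176971236, 15487480575, 942628341, 1522909801, 50038021,
        10418123332, 2521948506, 6904809430, 9660326162, 3471997950, 2516529418] },
    {
      direction := 6538292784
      swaps := [(30, 38)]
      rows :=
        [11360574642, 7588288016, 7700500533, 15910690038, 14112327350, 6591518434, 4063887175,
        7726940198, 3313353369, 1102999540, 5877974781, 2572062160, 13110225305, 291980761,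
        8736938403, 11173585951, 12639362759, 14407078368, 3976582343, 1613908279, 11339059413,
        15378572074, 6872929496, 8176971236, 6433258081, 12289103211, 2170203108, 14984612445,
        7894564199, 11670940095, 6538292768, 14527358639, 5557720526, 13682196009] },
    {
      direction := 11793027233
      swaps := [(33, 34)]
      rows :=
        [11729237316, 7762476895, 15015012827, 15743366400, 14022143993, 6916019803, 16605004143,
        7924564127, 16644675070, 7955638322, 10657632666, 4341205526, 7405342839, 13436162567,
        4953909131, 959274312, 1533972191, 14199951705, 9784657119, 11825868896, 6555174834,
        15040439187, 6569458990, 8384032093, 9948234825, 8388176707, 4566828397, 7670182835,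
        12579783670, 393629928, 6699845487, 8037250574, 3471997950, 11793027232] },
    {
      direction := 8132903091
      swaps := [(32, 34)]
      rows :=
        [10568568507, 7960100838, 4277469839, 15743366400, 14345596736, 6591518434, 2471350724,
        4336761817, 3123742188, 4643296205, 4850155912, 7720923625, 9553017635, 1848246956,
        11396271327, 14546128218, 13247651444, 14407078368, 4459041908, 6891855986, 12290430880,
        15378572074, 5526226641, 4992325147, 4798780642, 11761417192, 7685979691, 9817708775,
        6325741595, 14182990074, 5729254441, 10823902748, 8132903090, 14209355946] },
    {
      direction := 14494038103
      swaps := [(33, 34)]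
      rows :=
        [11729237316, 800053161, 15015012827, 15743366400, 11321132815, 6591518434, 16605004143,
        7726940198, 16991196487, 7955638322, 15472572780, 4145750617, 1287534648, 12163562056,
        3533443012, 771087857, 7226009232, 11532253615, 9784657119, 13453383830, 6750766859,
        10225240933, 6569458990, 314049963, 15656070150, 103006988, 4377593300, 1022827516,
        12768035663, 8429795358, 6904809430, 7714780855, 5287498673, 14494038102] },
    {
      direction := 1790489190
      swaps := [(33, 35)]
      rows :=
        [11729237316, 7261244800, 7490866085, 4300432667, 14345596736, 14099805343, 15955456778,
        7083618880, 5172262713, 7256791636, 2943185757, 6047742064, 14930670089, 8058368121,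
        5603464686, 10867838441, 836123834, 8330494459, 2277336737, 12150436058, 14276093301,
        17148072268, 14077828947, 14182088191, 4207268945, 13748013373, 4377593300, 7039418838,
        964927793, 11435573321, 8341927344, 13075567817, 8832752003, 1790489188] },
    {
      direction := 2097198335
      swaps := [(33, 34)]
      rows :=
        [11729237316, 13107600129, 15015012827, 15743366400, 6444747687, 6591518434, 16605004143,
        13350249665, 4898058656, 13103140053, 10467283235, 4341205526, 14736159888, 8454207200,
        16919151468, 12797262102, 1533972191, 14407078368, 9784657119, 12150436057, 14048027628,
        15378572074, 6569458990, 13695568131, 2277859502, 13502123940, 16439550259, 7670182835,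
        12768035663, 12157039798, 14172316465, 13369692752, 3471997950, 2097198334] },
    {
      direction := 2140620304
      swaps := [(31, 38)]
      rows :=
        [11729237316, 7960100838, 7864662467, 15743366400, 922061311, 12499513437, 10368135640,
        7726940198, 9672091120, 7074098722, 16570081684, 9071438521, 13209387119, 8413709327,
        16959811971, 8156080982, 12639362759, 996112223, 15248405112, 2114658497, 14088933635,
        15378572074, 6569458990, 10846948187, 16722130174, 13528595787, 6366659524, 50038036,
        14181577720, 7658333942, 10837927801, 2140620288, 2976202222, 12174267913] },
    {
      direction := 10852500743
      swaps := [(33, 34)]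
      rows :=
        [11139162203, 8432298745, 14262287556, 15743366400, 14345596736, 7047300093, 16605004143,
        8059360569, 16511844440, 7955638322, 10467283235, 5069758217, 6803899752, 13089654552,
        4490621588, 18483438, 2004966336, 14407078368, 9784657119, 12764784070, 6750766859,
        15378572074, 7172139057, 7710013691, 9948234825, 8388176707, 4377593300, 8149690028,
        12768035663, 61788241, 7371543241, 8174298024, 3793596129, 10852500742] },
    {
      direction := 9851358357
      swaps := [(30, 34)]
      rows :=
        [13431403155, 1106933809, 15567877462, 15743366400, 12022933655, 6591518434, 11394832949,
        1459668977, 10977676829, 7955638322, 10988686766, 4341205526, 3287780141, 16135982730,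
        1574288593, 5761320619, 3128070738, 11831449143, 13919133573, 9481546836, 6232513414,
        15378572074, 6569458990, 8176971236, 11574843588, 4611995598, 2674115075, 4969312062,
        8993955778, 6329060107, 9851358356, 5012859450, 3471997950, 3776715916] },
    {
      direction := 12369076527
      swaps := [(32, 34)]
      rows :=
        [11729237316, 4639360025, 13782751468, 15743366400, 15466632383, 6591518434, 14365281191,
        7726940198, 14785027983, 7955638322, 9203671060, 4341205526, 5316549311, 14691164976,
        7025864003, 1720134854, 270303208, 14407078368, 8795780584, 9960978961, 4695526851,
        14400100565, 5526226641, 4992325147, 9051633022, 6282666379, 7685979691, 6482248324,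
        10679241095, 2251184793, 6904809430, 6453249920, 12369076526, 1265824054] },
    {
      direction := 1080684353
      swaps := [(33, 34)]
      rows :=
        [11729237316, 13693305023, 6789322370, 15743366400, 14345596736, 6591518434, 16605004143,
        13536460671, 16991196487, 7955638322, 10467283235, 16787420495, 7405342839, 7692463454,
        4953909131, 11940127400, 11562955142, 14407078368, 9784657119, 1046663040, 6750766859,
        6425173107, 14726972023, 13106713277, 3131849488, 13315036186, 4377593300, 7670182835,
        324205590, 12515077896, 6904809430, 13447727598, 9204941991, 1080684352] },
    {
      direction := 4707232296
      swaps := [(33, 37)]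
      rows :=
        [4458319741, 7960100838, 10307781626, 15743366400, 14345596736, 9567464667, 6300864887,
        7726940198, 1180725111, 10344206859, 10467283242, 11549077551, 8787454535, 13436162574,
        1070861738, 771087864, 12639362759, 14407078368, 3976582343, 2114658497, 13829887763,
        10941942018, 2667796230, 8176971236, 4207268945, 9686225267, 11648483309, 7670182842,
        1396380503, 15855495777, 6904809430, 7714780862, 10280348655, 4707232288] },
    {
      direction := 11425118339
      swaps := [(28, 34)]
      rows :=
        [1088134801, 13450286131, 6576548501, 15743366400, 7194674325, 6591518434, 16633752052,
        7726940198, 17013128668, 13454738407, 2532233837, 17062945219, 7443462380, 7949472073,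
        4924641040, 792425834, 1503667780, 14407078368, 9763859524, 758133655, 6722301840,
        6163794175, 14971016955, 13365462577, 9969380562, 8341930968, 17165889025, 7715625768,
        11425118338, 23099594, 6904809430, 7668801068, 3471997950, 47098010] },
    {
      direction := 13686230842
      swaps := [(33, 35)]
      rows :=
        [288236895, 12712292572, 12801439481, 15743366400, 14345596736, 219285955, 10071367245,
        1233084167, 3674364542, 1606547219, 5371158042, 2268140855, 11117518670, 11360996645,
        8732928178, 10867838441, 8029868541, 14407078368, 16152697853, 2114658497, 11771562034,
        8880585739, 39936527, 14182088191, 9948234826, 12284732538, 4377593300, 1289563281,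
        14981553261, 61788242, 11614832876, 12416547214, 16663000260, 13686230840] },
    {
      direction := 9190776705
      swaps := [(32, 34)]
      rows :=
        [11729237316, 4639360025, 13856366013, 14572244735, 14345596736, 6591518434, 15479993609,
        4336761817, 15901696289, 4643296205, 12449078970, 7720923625, 5109145582, 14626203233,
        7225042962, 2752909928, 478100153, 15372708383, 12060052294, 10164584256, 7875933037,
        15378572074, 6569458990, 8176971236, 8990994479, 7330127653, 7685979691, 6681266133,
        11779274537, 2320310216, 5729254441, 6656852689, 9190776704, 2313408408] },
    {
      direction := 7094929922
      swaps := [(32, 35)]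
      rows :=
        [11729237316, 4639360026, 1914778561, 15743366400, 9647300286, 5470481694, 7407004299,
        1785448996, 6710935203, 2094359088, 5959174969, 7720923626, 16603495315, 739002397,
        9320889745, 16908319767, 9658377531, 14407078368, 603434811, 4665987391, 17022659823,
        14400100566, 5526226642, 8176971236, 4207268945, 12871184729, 4377593300, 11911457193,
        8420006229, 11435573321, 5729254442, 11928726701, 7094929920, 11445456921] },
    {
      direction := 1418733902
      swaps := [(32, 35)]
      rows :=
        [11729237316, 4639360026, 4734796351, 15743366400, 14345596736, 5470481694, 4884248633,
        4336761818, 4469222417, 6687900028, 187153095, 5743158104, 14089152801, 8027401041,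
        14017825903, 10867838441, 9658377531, 14407078368, 603434811, 3832115827, 14709653085,
        14400100566, 5526226642, 6392184662, 4207268945, 15421980839, 6955112294, 13816974053,
        2647222443, 11435573321, 7769894552, 13781815265, 1418733900, 11445456921] },
    {
      direction := 3915965231
      swaps := [(32, 34)]
      rows :=
        [11729237316, 7960100838, 8378097939, 15743366400, 14345596736, 6591518434, 6960935512,
        4336761817, 6331850127, 7955638322, 3796851179, 7720923625, 17083376448, 7204952783,
        15752752963, 11280356665, 12193351191, 15372708383, 74266600, 2539897838, 16395252796,
        14400100565, 6569458990, 4992325147, 330119038, 15848331380, 7685979691, 15207923844,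
        1956744071, 10972797081, 6904809430, 15175845248, 3915965230, 9719984950] },
    {
      direction := 252718388
      swaps := [(31, 36)]
      rows :=
        [11610740848, 11736750413, 7864662467, 3298131615, 14345596736, 12450225533, 8966010844,
        7577005330, 5668792427, 11622720429, 3319120187, 4526810914, 1924310724, 6542618411,
        15258187667, 8207451766, 6722992236, 877615743, 15248405100, 2114658497, 1453759628,
        15378572074, 6585176090, 10846948175, 4207268945, 14391360347, 10285032319, 14547837867,
        1546337891, 7640501206, 12791243133, 252718384, 3252836042, 11445456921] },
    {
      direction := 9941838624
      swaps := [(33, 39)]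
      rows :=
        [288236925, 15214908614, 15015012858, 4300432697, 8541945721, 6212103675, 13541046871,
        5203589951, 5887935839, 4841722667, 1064466978, 15719356975, 5431831375, 13436162598,
        4953909162, 3612501705, 12639362759, 15571167993, 9784657150, 12150436088, 13829887763,
        7586842634, 6395676215, 4794423037, 9948234856, 14391360347, 4377593300, 15463995570,
        12768035694, 11435573321, 13719361519, 5124492687, 878035175, 9941838592] },
    {
      direction := 11454516311
      swaps := [(31, 34)]
      rows :=
        [14768545725, 288265503, 11628765037, 10221215737, 14345596736, 6591518434, 8966010841,
        7726940198, 16983574792, 7955638322, 15639521173, 4341205526, 1924310721, 13427428936,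
        4962614212, 762839486, 1541624464, 11037408025, 15248405097, 13420643951, 1505145277,
        15378572074, 6569458990, 741951261, 9940228102, 8379479820, 4377593300, 50038021,
        12776185600, 52628510, 6904809430, 11454516310, 3471997950, 9296974] },
    {
      direction := 4899595799
      swaps := [(32, 34)]
      rows :=
        [11729237316, 7960100838, 4039958484, 14572244735, 14345596736, 5470481693, 1401321312,
        7726940198, 3020511415, 7955638322, 5086534867, 7720923625, 9518884472, 2934023176,
        11433447812, 14717652993, 13348815663, 15372708383, 4429072687, 5805098710, 12124211963,
        15378572074, 5526226641, 4992325147, 4567484857, 10699889996, 4377593300, 9782658492,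
        7411371711, 15260247646, 6904809430, 10923965255, 4899595798, 15271081486] },
    {
      direction := 12706805441
      swaps := [(28, 34)]
      rows :=
        [11729237316, 7960100838, 13449514754, 15743366400, 14345596736, 13668971381, 4910776865,
        14677353905, 15763288990, 7955638322, 2532233837, 4341205526, 8157214382, 15024665822,
        16614581445, 1923382056, 71247878, 14407078368, 3191785361, 758133655, 7737516498,
        5150279357, 13451696313, 8176971236, 8852578960, 13068511245, 15614713923, 6819681642,
        12706805440, 1560245896, 6904809430, 6786879598, 3471997950, 1599186648] },
    {
      direction := 413519379
      swaps := [(33, 34)]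
      rows :=
        [160164687, 7960100838, 15015012827, 15743366400, 8145760587, 13865617641, 6160015204,
        15000526381, 5475076940, 7955638322, 3715108648, 15843431453, 13085347452, 6749522956,
        15398386048, 771087857, 1533972191, 8190201835, 4120910548, 1722740434, 6750766859,
        15378572074, 13774611237, 8176971236, 3797948994, 8388176707, 15946406879, 7670182835,
        12768035663, 61788241, 13574412765, 14919149756, 3471997950, 413519378] },
    {
      direction := 3532178018
      swaps := [(32, 35)]
      rows :=
        [11398499546, 4639360026, 4400741281, 15940062366, 14345596736, 5470481694, 7407004299,
        4798743108, 6651774781, 4643296206, 187153095, 7720923626, 16137552397, 5437536739,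
        14495364593, 11202770039, 9191136421, 14407078368, 1066210981, 1651611999, 16825161073,
        14400100566, 5526226642, 8176971236, 4207268945, 15221291321, 4707482698, 15802832983,
        2647222443, 11435573321, 5520213428, 15822462291, 3532178016, 11445456921] },
    {
      direction := 14251748870
      swaps := [(28, 35)]
      rows :=
        [7404947479, 6598585523, 6576548502, 15743366400, 1431507475, 12240746724, 4910776866,
        11240189472, 8850680665, 6594132839, 15379312445, 9994626064, 13965742906, 12273593369,
        16614581446, 6535082170, 11314548114, 1492774067, 16047258305, 2114658497, 14686897222,
        3319401772, 7862939259, 12434133175, 17054476546, 13068511246, 8702113927, 845548973,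
        14251748868, 11435573321, 11995146704, 815630505, 15561528824, 11445456921] },
    {
      direction := 5648942205
      swaps := [(33, 34)]
      rows :=
        [11729237316, 7960100838, 15015012827, 1357341029, 14345596736, 6591518434, 658216202,
        7726940198, 239517986, 9138781271, 6801179974, 4341205526, 7405342839, 13436162567,
        4953909131, 771087857, 15601326778, 14407078368, 7477514426, 5079246012, 10349925230,
        15378572074, 10688538955, 9091512705, 7154552876, 8749236006, 4377593300, 7670182835,
        4354676522, 17065116724, 6904809430, 9417384658, 13765029787, 5648942204] }].getD i ⟨0, [], []⟩

/-! ### Evaluation of the certificates -/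

theorem redundancyD_eq (i : Fin 2) (k : Fin 34) :
    redundancyD i k = swapsPerm (swapsD i) (lastHalf k) := by
  revert i k; decide +kernel

theorem vecN_eq (i : Fin 6) (k : Fin 34) :
    (vecN i k : F2) = bit ((dataN i).direction.testBit k) := by
  revert i k; decide +kernel

theorem vecC_eq (i : Fin 34) (k : Fin 34) :
    (vecC i k : F2) = bit ((dataC i).direction.testBit k) := by
  revert i k; decide +kernel

theorem dataN_check (i : Fin 6) :
    (dataN i).check (swapsD (parentN i)) (pairsD (parentN i)) = true := by
  revert i; decide +kernel

theorem dataC_check (i : Fin 34) : (dataC i).check [] pairsC68 = true := by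
  revert i; decide +kernel

theorem dataN_rowsCheck (i : Fin 6) :
    rowsCheck (dataN i).rows (betaOf (.n i)) (gammaOf (.n i)) = true := by
  revert i; decide +kernel

/-- This is the enumeration proper: two balls per code, each used for the code and for its shadow.
-/
theorem dataC_rowsCheck (i : Fin 34) :
    rowsCheck (dataC i).rows (betaOf (.c i)) (gammaOf (.c i)) = true := by
  revert i; decide +kernel

theorem rowsD_check (i : Fin 2) :
    rowsCheck (rowsD i) (betaOf (.d i)) (gammaOf (.d i)) = true := by
  revert i; decide +kernel

theorem rowsC68_check : rowsCheck rowsC68 (betaOf .c68) (gammaOf .c68) = true := by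
  decide +kernel

theorem codeN_spec (i : Fin 6) : AreNeighbors (codeD (parentN i)) (codeN i) ∧
    IsExtremal68 (codeN i) (betaOf (.n i)) (gammaOf (.n i)) :=
  NeighborData.spec (isSelfDual_codeD _) (pairsD_mem _) (swapsD (parentN i)) (redundancyD_eq _)
    (vecN_eq i) (dataN_check i) (dataN_rowsCheck i)

theorem codeC_spec (i : Fin 34) : AreNeighbors codeC68 (codeC i) ∧
    IsExtremal68 (codeC i) (betaOf (.c i)) (gammaOf (.c i)) :=
  NeighborData.spec isSelfDual_codeC68 pairsC68_mem [] (fun _ => rfl)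
    (vecC_eq i) (dataC_check i) (dataC_rowsCheck i)

theorem newCode_spec (j : NewIndex) : IsExtremal68 (newCode j) (betaOf j) (gammaOf j) :=
  match j with
  | .d i => isExtremal68_of_rowsCheck (isSelfDual_codeD i) (generators_mem_codeD i) (rowsD_check i)
  | .n i => (codeN_spec i).2
  | .c68 => isExtremal68_of_rowsCheck isSelfDual_codeC68 generators_mem_codeC68 rowsC68_check
  | .c i => (codeC_spec i).2

/-! ### The parameters -/

/-- The index type as a sum. -/
def newIndexEquiv : NewIndex ≃ Fin 2 ⊕ Fin 6 ⊕ Unit ⊕ Fin 34 where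
  toFun
    | .d i => .inl i
    | .n i => .inr (.inl i)
    | .c68 => .inr (.inr (.inl ()))
    | .c i => .inr (.inr (.inr i))
  invFun
    | .inl i => .d i
    | .inr (.inl i) => .n i
    | .inr (.inr (.inl ())) => .c68
    | .inr (.inr (.inr i)) => .c i
  left_inv j := by cases j <;> rfl
  right_inv j := by rcases j with _ | _ | _ | _ <;> rfl

theorem natCard_newIndex : Nat.card NewIndex = 43 := by
  rw [Nat.card_congr newIndexEquiv]
  simp

/-- The parameters `(γ, β)`. -/
def parameters (j : NewIndex) : ℕ × ℕ := (gammaOf j, betaOf j)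

theorem range_parameters : Set.range parameters =
    ((({5} : Finset ℕ) ×ˢ betas5 ∪ ({6} : Finset ℕ) ×ˢ betas6 : Finset (ℕ × ℕ)) : Set (ℕ × ℕ)) := by
  have h : Finset.univ.image (parameters ∘ newIndexEquiv.symm) =
      ({5} : Finset ℕ) ×ˢ betas5 ∪ ({6} : Finset ℕ) ×ˢ betas6 := by
    decide +kernel
  rw [← h, Finset.coe_image, Finset.coe_univ, Set.image_univ, newIndexEquiv.symm.surjective.range_comp]

/-- The question is moved to a sum of finite types, where injectivity is decidable by evaluation. -/
theorem parameters_injective : Function.Injective parameters := by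
  have h : Function.Injective (parameters ∘ newIndexEquiv.symm) := by
    decide +kernel
  exact (newIndexEquiv.symm.injective_comp parameters).1 h

theorem coeff_twelve_W682 (β γ : ℤ) : (W682 β γ).coeff 12 = 442 + 4 * β := by
  simp only [W682, coeff_add, coeff_C_mul, coeff_X_pow, coeff_one]
  norm_num

theorem coeff_fourteen_W682 (β γ : ℤ) :
    (W682 β γ).coeff 14 = 14960 - 8 * β - 256 * γ := by
  simp only [W682, coeff_add, coeff_C_mul, coeff_X_pow, coeff_one]
  norm_num

/-- The coefficient `442 + 4β` of `y^12` determines `β`, and then `14960 - 8β - 256γ` determines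
`γ`. -/
theorem weightEnumerator_newCode_injective :
    Function.Injective fun j => weightEnumerator (newCode j) := by
  intro j k h
  simp only [(newCode_spec _).2.2.2] at h
  have h12 := congrArg (coeff · 12) h
  have h14 := congrArg (coeff · 14) h
  simp only [coeff_twelve_W682, coeff_fourteen_W682] at h12 h14
  exact parameters_injective (Prod.ext (by simp only [parameters]; omega)
    (by simp only [parameters]; omega))

end SelfDualCodes

/-- The `43` listed codes of length `68` are extremal self-dual `[68, 34, 12]` codes with the listed
weight enumerators in `W_{68,2}`, obtained by the extension and the neighbor constructions; the
pairs `(γ, β)` that occur are `7` with `γ = 5` and `36` with `γ = 6`. -/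
theorem mainTheorem4 :
    -- the codes that are extended are self-dual, and the data satisfy the conditions of the extension
    (SelfDualCodes.IsSelfDual SelfDualCodes.codeF2 ∧
      (∀ i : Fin 2, IsUnit (SelfDualCodes.unitD i) ∧ SelfDualCodes.unitD i ^ 2 = 1 ∧
        SelfDualCodes.vecD i ⬝ᵥ SelfDualCodes.vecD i = 1) ∧
      SelfDualCodes.IsSelfDual SelfDualCodes.codeE6 ∧
      SelfDualCodes.IsSelfDual (SelfDualCodes.psiImage SelfDualCodes.codeE6) ∧
      SelfDualCodes.vecC68 ⬝ᵥ SelfDualCodes.vecC68 = 1) ∧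
    -- the codes given by the neighbor construction are neighbors
    (∀ i : Fin 6, SelfDualCodes.AreNeighbors
      (SelfDualCodes.codeD (SelfDualCodes.parentN i)) (SelfDualCodes.codeN i)) ∧
    (∀ i : Fin 34, SelfDualCodes.AreNeighbors SelfDualCodes.codeC68 (SelfDualCodes.codeC i)) ∧
    -- all the codes are extremal self-dual [68, 34, 12] codes with the listed weight enumerators
    (∀ j : SelfDualCodes.NewIndex,
      SelfDualCodes.IsExtremal (SelfDualCodes.newCode j) ∧
      Module.finrank SelfDualCodes.F2 (SelfDualCodes.newCode j) = 34 ∧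
      SelfDualCodes.HasMinDist (SelfDualCodes.newCode j) 12 ∧
      SelfDualCodes.weightEnumerator (SelfDualCodes.newCode j) =
        SelfDualCodes.W682 (SelfDualCodes.betaOf j) (SelfDualCodes.gammaOf j)) ∧
    -- there are 43 of them, with different parameters, which are the listed ones
    Nat.card SelfDualCodes.NewIndex = 43 ∧
    Function.Injective (fun j => SelfDualCodes.weightEnumerator (SelfDualCodes.newCode j)) ∧
    Function.Injective (fun j => (SelfDualCodes.gammaOf j, SelfDualCodes.betaOf j)) ∧
    Set.range (fun j => (SelfDualCodes.gammaOf j, SelfDualCodes.betaOf j)) =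
      {p : ℕ × ℕ | (p.1 = 5 ∧ p.2 ∈ SelfDualCodes.betas5) ∨
        (p.1 = 6 ∧ p.2 ∈ SelfDualCodes.betas6)} ∧
    SelfDualCodes.betas5.card = 7 ∧ SelfDualCodes.betas6.card = 36 := by
  open SelfDualCodes in
  refine ⟨⟨isSelfDual_codeF2, fun i => ⟨isUnit_unitD i, unitD_sq i, vecD_dotProduct i⟩,
    isSelfDual_codeE6, isSelfDual_psiImage_codeE6, vecC68_dotProduct⟩,
    fun i => (codeN_spec i).1, fun i => (codeC_spec i).1, newCode_spec, natCard_newIndex,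
    weightEnumerator_newCode_injective, parameters_injective, ?_, by decide, by decide⟩
  refine SelfDualCodes.range_parameters.trans ?_
  ext ⟨g, b⟩
  simp [eq_comm, and_comm]
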